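/- Let $p$ be a prime, $s\ge 1$, $\zeta_{p^s}$ a primitive $p^s$-th root of unity, $\zeta_{p^m}=\zeta_{p^s}^{p^{s-m}}$, $K=\mathbb{Q}(\zeta_{p^s})$, $R=\mathbb{Z}_{(p)}[\zeta_{p^s}]$, $\pi=\zeta_{p^s}-1$, $\lambda=\zeta_p-1$, and let $\nu$ be the valuation of $K$ above $p$ with $\nu(p)=1$. For $1\le m\le s$ put $E_{m,p}(t)=\exp\bigl(\sum_{i=0}^{m-1}(\zeta_{p^{m-i}}-1)t^{p^i}/p^i\bigr)$. For a Witt vector $\underline a=(a_0,a_1,\dots)$ (only the first $m$ components matter) put $E_{m,p}(\underline a)=\prod_{i=0}^{m-1}E_{m-i,p}(a_i)$ and $G_{m,p}(\underline a)=E_{m,p}(p\underline a)/E_{m-1,p}(\underline a)$, where $p\underline a$ is the multiple in the ring of Witt vectors and $E_{0,p}=1$. Define recursively, for $0\le i\le s-1$, power series without constant term $X_i'\in K[[X_0,\dots,X_i]]$, $Y_i'\in K[[Y_0,\dots,Y_i]]$, and $G_{i+1}$, $E_{i+1}$, as follows: $G_{i+1}$ consists of the terms of $G_{i+1,p}((X_0',\dots,X_{i-1}',0))$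 whose coefficients have valuation $\le\frac{p}{p-1}$, $E_{i+1}$ consists of the terms of $E_{i+1,p}((Y_0',\dots,Y_{i-1}',0))$ whose coefficients have valuation $<\frac1{p-1}$ (so $G_1=E_1=1$), and $$X_i'=\frac1{p\lambda}\ln\frac{G_{i+1}+p\lambda X_i}{G_{i+1,p}((X_0',\dots,X_{i-1}',0))},\qquad Y_i'=\frac1{\lambda}\ln\frac{E_{i+1}+\lambda Y_i}{E_{i+1,p}((Y_0',\dots,Y_{i-1}',0))}.$$ Then $G_{i+1}$ and $E_{i+1}$ are polynomials with coefficients in $R$, in the variables $X_0,\dots,X_{i-1}$ and $Y_0,\dots,Y_{i-1}$ respectively. Put $u_i=G_{i+1}(X_0,\dots,X_{i-1})+p\lambda X_i$ and $$\mathcal{O}_{\mathcal{V}_s}=R\Bigl[X_0,\dots,X_{s-1},\tfrac1{u_0},\dots,\tfrac1{u_{s-1}}\Bigr],\qquad \mathcal V_s=\operatorname{Spec}\mathcal{O}_{\mathcal{V}_s}.$$ Let $L_s=K(X_0,\dots,X_{s-1})(Z_{s-1})$ be the Kummer extension given by $Z_{s-1}^{p^s}=\prod_{i=0}^{s-1}u_i^{p^i}$.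 There are elements $Z_0,\dots,Z_{s-1}$ (the last one being the given $Z_{s-1}$) and $Y_0,\dots,Y_{s-1}$ of $L_s$ with $$Z_i^p=Z_{i-1}u_i\quad(Z_{-1}=1),\qquad Z_i=E_{i+1}(Y_0,\dots,Y_{i-1})+\lambda Y_i\qquad(0\le i\le s-1),$$ the elements $Y_0,\dots,Y_{s-1}$ are algebraically independent over $K$, and the following hold. 1. The integral closure in $L_s$ of $B_{s-1}=R\bigl[Y_0,\dots,Y_{s-2},X_{s-1},\frac1{Z_0},\dots,\frac1{Z_{s-2}},\frac1{u_{s-1}}\bigr]$ is $$B_s=R\Bigl[Y_0,\dots,Y_{s-1},\tfrac1{1+\lambda Y_0},\tfrac1{E_2(Y_0)+\lambda Y_1},\dots,\tfrac1{E_s(Y_0,\dots,Y_{s-2})+\lambda Y_{s-1}}\Bigr].$$ 2. $B_s$ is also the integral closure of $\mathcal{O}_{\mathcal{V}_s}$ in $L_s$. 3. $\mathcal W_s:=\operatorname{Spec}B_s\to\mathcal V_s$ is a finite étale Galois cover with group $\mathbb{Z}/p^s$ (a $\mathbb{Z}/p^s$-torsor). 4. It has good reduction: $B_s$ and $\mathcal{O}_{\mathcal{V}_s}$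 are smooth over $R$, and $B_s/\pi B_s=\mathbb{F}_p[y_0,\dots,y_{s-1}]$ and $\mathcal{O}_{\mathcal{V}_s}/\pi\mathcal{O}_{\mathcal{V}_s}=\mathbb{F}_p[x_0,\dots,x_{s-1}]$ are polynomial rings in the classes $y_i$ of $Y_i$ and $x_i$ of $X_i$. -/

import Mathlib

open scoped TensorProduct

noncomputable section

namespace KASW

/-! ### The base ring and its valuation -/

section Base

variable {K : Type*} [Field K]

/-- The ring `ℤ_(p)[ζ]`, as a subring of a field containing `ζ`: it is generated by `ζ` and by
the inverses of the natural numbers prime to `p`. -/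
def baseRing (p : ℕ) (ζ : K) : Subring K :=
  Subring.closure ({ζ} ∪ {a | ∃ m : ℕ, ¬ p ∣ m ∧ a = (m : K)⁻¹})

/-- The element `π = ζ - 1` of `ℤ_(p)[ζ]`. -/
def unif (p : ℕ) (ζ : K) : baseRing p ζ :=
  ⟨ζ, Subring.subset_closure (Or.inl rfl)⟩ - 1

/-- For `ζ = ζ_{p^s}`, the root of unity `ζ_{p^m} = ζ ^ (p^(s-m))`, where `m ≤ s`. -/
def zetaPow (p s : ℕ) (ζ : K) (m : ℕ) : K := ζ ^ p ^ (s - m)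

/-- `λ = ζ_p - 1`. -/
def lam (p s : ℕ) (ζ : K) : K := zetaPow p s ζ 1 - 1

/-- The valuation `ν` of `K = ℚ(ζ_{p^s})` above `p` with `ν p = 1`, on nonzero elements. As `p` is
totally ramified in `K`, it is the unique extension of the `p`-adic valuation of `ℚ`, hence is
given by the norm. (The value at `0` is never used.) -/
def nu (p : ℕ) [CharZero K] (a : K) : ℚ :=
  (padicValRat p (Algebra.norm ℚ a) : ℚ) / (Module.finrank ℚ K : ℚ)

end Base

/-! ### The deformed Artin-Hasse exponentials and the polynomials `G_i`, `E_i` -/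

section Series

variable {K : Type*} [Field K] [CharZero K] (p s : ℕ) [Fact p.Prime] (ζ : K)

/-- `E_{m,p}(t) = exp (∑_{i < m} (ζ_{p^{m-i}} - 1) t^{p^i} / p^i)`. -/
def dexp (m : ℕ) : PowerSeries K :=
  (PowerSeries.exp K).subst
    (∑ i ∈ Finset.range m,
      PowerSeries.C ((zetaPow p s ζ (m - i) - 1) / (p : K) ^ i) * PowerSeries.X ^ p ^ i :
      PowerSeries K)

/-- `E_{m,p}((a_0, …, a_{m-1})) = ∏_{i < m} E_{m-i,p}(a_i)`, for a Witt vector whose components are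
power series without constant term. -/
def EW (m : ℕ) (a : WittVector p (MvPowerSeries (Fin s) K)) : MvPowerSeries (Fin s) K :=
  ∏ i ∈ Finset.range m, (dexp p s ζ (m - i)).subst (a.coeff i)

/-- `G_{m,p}(a) = E_{m,p}(p a) / E_{m-1,p}(a)`, where `p a` is computed in the Witt vectors. -/
def GW (m : ℕ) (a : WittVector p (MvPowerSeries (Fin s) K)) : MvPowerSeries (Fin s) K :=
  EW p s ζ m (p * a) * (EW p s ζ (m - 1) a)⁻¹

variable {s} in
/-- The series formed by the terms of `f` whose coefficients satisfy `P`. -/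
def keepTerms (P : K → Prop) (f : MvPowerSeries (Fin s) K) : MvPowerSeries (Fin s) K :=
  open Classical in fun n => if P (MvPowerSeries.coeff n f) then MvPowerSeries.coeff n f else 0

/-- The variable number `n < s` (counted from `0`). -/
def var (n : ℕ) : MvPowerSeries (Fin s) K :=
  if h : n < s then MvPowerSeries.X ⟨n, h⟩ else 0

/-- The logarithm of a power series with constant term `1`. -/
def ln (f : MvPowerSeries (Fin s) K) : MvPowerSeries (Fin s) K :=
  (PowerSeries.log K).subst (f - 1)

/-- The terms of `G_{n+1,p}(a)` whose coefficients have valuation at most `p / (p - 1)`. -/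
def truncG (n : ℕ) (a : WittVector p (MvPowerSeries (Fin s) K)) : MvPowerSeries (Fin s) K :=
  keepTerms (fun c => nu p c ≤ (p : ℚ) / (p - 1)) (GW p s ζ (n + 1) a)

/-- The terms of `E_{n+1,p}(a)` whose coefficients have valuation less than `1 / (p - 1)`. -/
def truncE (n : ℕ) (a : WittVector p (MvPowerSeries (Fin s) K)) : MvPowerSeries (Fin s) K :=
  keepTerms (fun c => nu p c < 1 / ((p : ℚ) - 1)) (EW p s ζ (n + 1) a)

/-- The Witt vector `(X_0', …, X_{n-1}', 0, 0, …)`, where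
`X_n' = (pλ)⁻¹ ln ((G_{n+1} + pλ X_n) / G_{n+1,p}((X_0', …, X_{n-1}', 0)))`
and `G_{n+1}` is the truncation of `G_{n+1,p}((X_0', …, X_{n-1}', 0))`. -/
def wittX : ℕ → WittVector p (MvPowerSeries (Fin s) K)
  | 0 => WittVector.mk p fun _ => 0
  | n + 1 => WittVector.mk p (Function.update (wittX n).coeff n
      (MvPowerSeries.C ((p : K) * lam p s ζ)⁻¹ *
        ln s ((truncG p s ζ n (wittX n) + MvPowerSeries.C ((p : K) * lam p s ζ) * var s n) *
          (GW p s ζ (n + 1) (wittX n))⁻¹)))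

/-- The Witt vector `(Y_0', …, Y_{n-1}', 0, 0, …)`, where
`Y_n' = λ⁻¹ ln ((E_{n+1} + λ Y_n) / E_{n+1,p}((Y_0', …, Y_{n-1}', 0)))`
and `E_{n+1}` is the truncation of `E_{n+1,p}((Y_0', …, Y_{n-1}', 0))`. -/
def wittY : ℕ → WittVector p (MvPowerSeries (Fin s) K)
  | 0 => WittVector.mk p fun _ => 0
  | n + 1 => WittVector.mk p (Function.update (wittY n).coeff n
      (MvPowerSeries.C (lam p s ζ)⁻¹ *
        ln s ((truncE p s ζ n (wittY n) + MvPowerSeries.C (lam p s ζ) * var s n) *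
          (EW p s ζ (n + 1) (wittY n))⁻¹)))

/-- `G_{n+1}(X_0, …, X_{n-1})`, written as a power series. -/
def seriesG (n : ℕ) : MvPowerSeries (Fin s) K := truncG p s ζ n (wittX p s ζ n)

/-- `E_{n+1}(Y_0, …, Y_{n-1})`, written as a power series. -/
def seriesE (n : ℕ) : MvPowerSeries (Fin s) K := truncE p s ζ n (wittY p s ζ n)

variable {p s ζ} in
/-- The polynomial `f` over `ℤ_(p)[ζ]` is, as a power series over `K`, equal to `g`. -/
def IsPolynomialFor (f : MvPolynomial (Fin s) (baseRing p ζ)) (g : MvPowerSeries (Fin s) K) :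
    Prop :=
  ((MvPolynomial.map (baseRing p ζ).subtype f : MvPolynomial (Fin s) K) :
    MvPowerSeries (Fin s) K) = g

end Series

/-! ### The coordinate rings, inside a field `L` containing `K` -/

section Rings

variable {K : Type*} [Field K] {L : Type*} [Field L] [Algebra K L]
variable {p s : ℕ} (ζ : K)

/-- `u_i = G_{i+1}(X_0, …, X_{i-1}) + pλ X_i`. -/
def kummerU (G : Fin s → MvPolynomial (Fin s) (baseRing p ζ)) (x : Fin s → L) (i : Fin s) : L :=
  MvPolynomial.aeval x (G i) + algebraMap K L ((p : K) * lam p s ζ) * x i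

variable (p)

/-- The coordinate ring `R[X_0, …, X_{s-1}, 1/u_0, …, 1/u_{s-1}]` of `𝒱_s`. -/
def coordV (x u : Fin s → L) : Subalgebra (baseRing p ζ) L :=
  Algebra.adjoin (baseRing p ζ) {a | ∃ i, a = x i ∨ a = (u i)⁻¹}

/-- The ring `B_{s-1} = R[Y_0, …, Y_{s-2}, X_{s-1}, 1/Z_0, …, 1/Z_{s-2}, 1/u_{s-1}]`
(here `Z i.succ` stands for `Z_i`). -/
def coordB (x u Y : Fin s → L) (Z : Fin (s + 1) → L) : Subalgebra (baseRing p ζ) L :=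
  Algebra.adjoin (baseRing p ζ)
    ({a | ∃ i : Fin s, (i : ℕ) + 1 < s ∧ (a = Y i ∨ a = (Z i.succ)⁻¹)} ∪
      {a | ∃ i : Fin s, (i : ℕ) + 1 = s ∧ (a = x i ∨ a = (u i)⁻¹)})

/-- The ring `B_s = R[Y_0, …, Y_{s-1}, 1/Z_0, …, 1/Z_{s-1}]` (here `Z i.succ` stands for `Z_i`). -/
def coordW (Y : Fin s → L) (Z : Fin (s + 1) → L) : Subalgebra (baseRing p ζ) L :=
  Algebra.adjoin (baseRing p ζ) {a | ∃ i : Fin s, a = Y i ∨ a = (Z i.succ)⁻¹}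

variable {p}

/-- The reduction `S / π S` of a subring `S ⊇ R` of `L` is the polynomial ring over `𝔽_p` on the
classes of the elements `t_0, …, t_{s-1}` of `S`. -/
def ReductionIsPolynomialRing (S : Subalgebra (baseRing p ζ) L) (t : Fin s → L) : Prop :=
  ∃ e : MvPolynomial (Fin s) (ZMod p) ≃+*
      (S ⧸ Ideal.span {algebraMap (baseRing p ζ) S (unif p ζ)}),
    ∀ i, ∃ hi : t i ∈ S, e (MvPolynomial.X i) = Ideal.Quotient.mk _ ⟨t i, hi⟩

end Rings

/-! ### Étale Galois covers -/

section Covers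

variable (A B : Type*) [CommRing A] [CommRing B] [Algebra A B]

variable {A B} in
/-- The map `B ⊗_A B → ∏_{g ∈ G} B`, `b ⊗ b' ↦ (b * g b')_g`, of an action of `G` on `B` by
`A`-algebra automorphisms. -/
def torsorMap {G : Type*} [Group G] (ρ : G →* (B ≃ₐ[A] B)) : B ⊗[A] B →ₐ[A] (G → B) :=
  Algebra.TensorProduct.lift (Pi.constAlgHom A G B)
    (AlgHom.pi fun g => ((ρ g : B ≃ₐ[A] B) : B →ₐ[A] B)) (fun _ _ => Commute.all _ _)

/-- `Spec B → Spec A` is a finite étale surjective Galois cover with group `G`, that is, a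
`G`-torsor. -/
def IsEtaleGaloisCover (G : Type*) [Group G] : Prop :=
  Algebra.Etale A B ∧ Module.Finite A B ∧ Module.FaithfullyFlat A B ∧
    ∃ ρ : G →* (B ≃ₐ[A] B), Function.Bijective (torsorMap ρ)

end Covers

end KASW

end

/-! Write E_m for E_{m,p} and AH for the Artin-Hasse exponential. Since ζ_{p^m}^{p^i} = ζ_{p^{m-i}},
one has E_m(t) = AH(ζ_{p^m} t) / AH(t), so E_m is integral by Dwork's criterion and congruent to 1
modulo π. On Witt vectors E_m is the exponential of a linear combination of ghost components; hence
E_m(pa) = E_m(a)^p, and G_{m,p}(a) is the product of the series E_{m-i}(t)^p / E_{m-i-1}(t) at t =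
a_i. The analytic heart (`gexp_mem_Rst`) is that these quotients are restricted, i.e. their
coefficients tend to 0, although E_m itself is only integral. To see this, replace ζ_{p^m} by an
indeterminate x: in log(E(x,t)^p / E(x^p,t)) the coefficient of each power of x - 1 is restricted up
to a factorial, so the same holds for the exponential up to denominators. Integrality removes the
denominators, and x - 1 is finally specialised to a multiple of π.

Restrictedness makes G_{n+1} a polynomial and X_n' a restricted series. For E_{n+1} let V =
E_{n+1,p}((Y_0',…,Y_{n-1}',0)). The induction `GoodFam` writes each X_j as a restricted series in
the Y's under which X_j' becomes Y_j', and shows E_n(Y') = Z_{n-1}. Then V^p = Z_{n-1}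
G_{n+1,p}((X_0',…,X_{n-1}',0)) is restricted, and `mem_polyMod_lam_of_pow` extracts the p-th root: V
is a polynomial modulo λ, so E_{n+1} is a polynomial. As λ^p is pλ times a unit, Z_n ≡ V mod λ gives
Z_n^p ≡ V^p ≡ Z_{n-1} G_{n+1} mod pλ, and the quotient defines X_n as an integral series in the Y's,
which closes the induction.

In L the Z_i are found by descending from Z_{s-1}, and the Y_i by solving a triangular system. The
integrality of the series for X_i is transported to L by `mem_graph_of_mul_mem`: a division by pλ
that is possible for power series is already possible for the polynomials involved. Hence X_i lies
in R[Y_0,…,Y_i,1/Z_0,…,1/Z_i]. It follows that L = K(Y), so the Y_i are independent by transcendence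
degree. Dividing (E_{i+1} + λY_i)^p = Z_{i-1}u_i by λ^p gives a monic equation of degree p for Y_i,
a deformation of an Artin-Schreier equation. Conversely B_s is a localisation of a polynomial ring
over a discrete valuation ring, hence normal; so it is the integral closure. The inverted elements
are 1 modulo π, whence smoothness and the special fibres.

Finally u_0 has degree 1 in X_0 and is not a p-th power, so L over K(X) is cyclic of degree p^s. If
σ ≠ 1 and Z_j is the first Z that σ moves, then σ Y_j - Y_j is a unit of R times Z_j. Such unit
displacements make the action free, and `isEtaleGaloisCover_of_isUnit` yields the torsor. -/

noncomputable section

namespace KASW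

set_option linter.unusedSectionVars false
set_option linter.unusedVariables false

/-! ### Denominators and units in ℤ_(p)[ζ]. -/

section BaseRing

variable {K : Type*} [Field K] {p : ℕ} {ζ : K}

theorem zeta_mem : ζ ∈ baseRing p ζ := Subring.subset_closure (Or.inl rfl)

theorem inv_natCast_mem {m : ℕ} (hm : ¬ p ∣ m) : (m : K)⁻¹ ∈ baseRing p ζ :=
  Subring.subset_closure (Or.inr ⟨m, hm, rfl⟩)

theorem pi_mem : ζ - 1 ∈ baseRing p ζ := sub_mem zeta_mem (one_mem _)

theorem coe_unif : (unif p ζ : K) = ζ - 1 := rfl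

theorem zetaPow_mem (s m : ℕ) : zetaPow p s ζ m ∈ baseRing p ζ := pow_mem zeta_mem _

theorem lam_mem (s : ℕ) : lam p s ζ ∈ baseRing p ζ := sub_mem (zetaPow_mem _ _) (one_mem _)

theorem not_dvd_mul_of_not_dvd [Fact p.Prime] {a b : ℕ} (ha : ¬ p ∣ a) (hb : ¬ p ∣ b) :
    ¬ p ∣ a * b := (Fact.out : p.Prime).not_dvd_mul ha hb

/-- Every element of the base ring becomes integral over `ℤ` after multiplication by an integer
prime to `p`. -/
theorem exists_isIntegral_natCast_mul [CharZero K] [Fact p.Prime]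
    (hζ : IsIntegral ℤ ζ) {x : K} (hx : x ∈ baseRing p ζ) :
    ∃ m : ℕ, ¬ p ∣ m ∧ IsIntegral ℤ ((m : K) * x) := by
  have h1 : ¬ p ∣ 1 := (Fact.out : p.Prime).one_lt.ne' ∘ Nat.dvd_one.1
  have hN (n : ℕ) : IsIntegral ℤ (n : K) := by
    simpa using (isIntegral_algebraMap (R := ℤ) (A := K) (x := (n : ℤ)))
  induction hx using Subring.closure_induction with
  | mem x hx =>
    rcases hx with rfl | ⟨m, hm, rfl⟩
    · exact ⟨1, h1, by simpa using hζ⟩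
    · refine ⟨m, hm, ?_⟩
      have : (m : K) ≠ 0 := by
        rintro h; rw [Nat.cast_eq_zero] at h; exact hm (h ▸ dvd_zero p)
      rw [mul_inv_cancel₀ this]; exact isIntegral_one
  | zero => exact ⟨1, h1, by simpa using isIntegral_zero⟩
  | one => exact ⟨1, h1, by simpa using isIntegral_one⟩
  | add x y _ _ hx hy =>
    obtain ⟨a, ha, hx⟩ := hx
    obtain ⟨b, hb, hy⟩ := hy
    refine ⟨a * b, not_dvd_mul_of_not_dvd ha hb, ?_⟩
    have := ((hN b).mul hx).add ((hN a).mul hy)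
    have e : ((a * b : ℕ) : K) * (x + y) = b * (a * x) + a * (b * y) := by push_cast; ring
    rwa [e]
  | neg x _ hx =>
    obtain ⟨a, ha, hx⟩ := hx
    exact ⟨a, ha, by simpa using hx.neg⟩
  | mul x y _ _ hx hy =>
    obtain ⟨a, ha, hx⟩ := hx
    obtain ⟨b, hb, hy⟩ := hy
    refine ⟨a * b, not_dvd_mul_of_not_dvd ha hb, ?_⟩
    have e : ((a * b : ℕ) : K) * (x * y) = (a * x) * (b * y) := by push_cast; ring
    rw [e]; exact hx.mul hy

theorem inv_intCast_mem {m : ℤ} (hm : ¬ (p : ℤ) ∣ m) : (m : K)⁻¹ ∈ baseRing p ζ := by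
  have h : ¬ p ∣ m.natAbs := by rwa [← Int.natCast_dvd]
  rcases Int.natAbs_eq m with h' | h' <;> rw [h']
  · simpa using inv_natCast_mem (ζ := ζ) (K := K) h
  · simpa using inv_natCast_mem (ζ := ζ) (K := K) h

/-- `1 - p y` is invertible in the base ring. -/
theorem inv_one_sub_mul_mem [CharZero K] [hp : Fact p.Prime]
    (hζ : IsIntegral ℤ ζ) {y : K} (hy : y ∈ baseRing p ζ) :
    1 - (p : K) * y ≠ 0 ∧ (1 - (p : K) * y)⁻¹ ∈ baseRing p ζ := by
  obtain ⟨m, hm, P, hP, hPy⟩ := exists_isIntegral_natCast_mul hζ hy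
  have hp1 := hp.out.one_lt
  -- Q is monic, kills p(my), and reduces to a power of T modulo p, so the integer Q(m) is prime to
  -- p. As b - m divides Q(b) - Q(m) = -Q(m) with b = pmy, the element m(1 - py) divides a unit.
  set Q := P.scaleRoots (p : ℤ) with hQ
  have hQr : Polynomial.aeval ((p : K) * (m * y)) Q = 0 := by
    have := Polynomial.scaleRoots_aeval_eq_zero (r := (p : ℤ)) (A := K)
      (p := P) (a := (m : K) * y) hPy
    simpa using this
  have hmod : ¬ (p : ℤ) ∣ Q.eval (m : ℤ) := by
    intro h
    rw [← ZMod.intCast_zmod_eq_zero_iff_dvd] at h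
    have h2 : ((Q.eval (m : ℤ) : ℤ) : ZMod p) = (m : ZMod p) ^ P.natDegree := by
      have hmap : Q.map (Int.castRingHom (ZMod p)) = Polynomial.X ^ P.natDegree := by
        rw [hQ, Polynomial.map_scaleRoots _ _ _ (by simp [hP.leadingCoeff])]
        simp [Polynomial.scaleRoots_zero, hP.natDegree_map, (hP.map _).leadingCoeff]
      have := Polynomial.eval_map_apply (Int.castRingHom (ZMod p)) (p := Q) (m : ℤ)
      rw [hmap] at this
      simpa using this.symm
    rw [h2] at h
    have := eq_zero_of_pow_eq_zero h
    rw [ZMod.natCast_eq_zero_iff] at this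
    exact hm this
  have hmR : (m : K) * y ∈ baseRing p ζ := mul_mem (natCast_mem _ m) hy
  let b : baseRing p ζ := (p : baseRing p ζ) * ⟨(m : K) * y, hmR⟩
  have hdvd : b - (m : baseRing p ζ) ∣ Polynomial.aeval b Q - Polynomial.aeval (m : baseRing p ζ) Q := by
    have := Polynomial.sub_dvd_eval_sub b (m : baseRing p ζ) (Q.map (algebraMap ℤ (baseRing p ζ)))
    simpa [Polynomial.aeval_def, Polynomial.eval_map] using this
  obtain ⟨c, hc⟩ := hdvd
  have hc' := congrArg (baseRing p ζ).subtype hc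
  have e1 : (baseRing p ζ).subtype (Polynomial.aeval b Q) = 0 := by
    have := Polynomial.map_aeval_eq_aeval_map (R := ℤ) (S := baseRing p ζ) (T := ℤ) (U := K)
      (φ := RingHom.id ℤ) (ψ := (baseRing p ζ).subtype) (RingHom.ext_int _ _) Q b
    rw [this]; simpa [b] using hQr
  have e2 : (baseRing p ζ).subtype (Polynomial.aeval (m : baseRing p ζ) Q) = ((Q.eval (m : ℤ) : ℤ) : K) := by
    have h3 : Polynomial.aeval (m : baseRing p ζ) Q = algebraMap ℤ _ (Q.eval (m : ℤ)) := by
      have := Polynomial.aeval_algebraMap_apply (A := ℤ) (baseRing p ζ) (m : ℤ) Q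
      simpa using this
    rw [h3]; simp
  rw [map_sub, e1, e2, map_mul, map_sub] at hc'
  simp [b] at hc'
  set N := Q.eval (m : ℤ)
  have hN0 : (N : K) ≠ 0 := by
    rw [Int.cast_ne_zero]; rintro h; exact hmod (h ▸ dvd_zero _)
  have key : (N : K) = (1 - p * y) * (m * c) := by linear_combination -hc'
  have hne : 1 - (p : K) * y ≠ 0 := by
    intro h; rw [h, zero_mul] at key; exact hN0 key
  refine ⟨hne, ?_⟩
  have : (1 - (p : K) * y)⁻¹ = m * c * (N : K)⁻¹ := by
    have h0 : (m : K) * c ≠ 0 := by rintro h; rw [h, mul_zero] at key; exact hN0 key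
    rw [key, mul_inv, mul_comm (1 - (p : K) * y)⁻¹, mul_inv_cancel_left₀ h0]
  rw [this]
  exact mul_mem (mul_mem (natCast_mem _ m) c.2) (inv_intCast_mem hmod)

/-- The base ring modulo `π` is spanned by the natural numbers. -/
theorem exists_natCast_sub_mem [CharZero K] [hp : Fact p.Prime] (hpπ : ∃ y ∈ baseRing p ζ, (p : K) = (ζ - 1) * y)
    {x : K} (hx : x ∈ baseRing p ζ) :
    ∃ n : ℕ, ∃ y ∈ baseRing p ζ, x = n + (ζ - 1) * y := by
  obtain ⟨q, hq, hpq⟩ := hpπ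
  induction hx using Subring.closure_induction with
  | mem x hx =>
    rcases hx with rfl | ⟨m, hm, rfl⟩
    · exact ⟨1, 1, one_mem _, by simp⟩
    · rcases eq_or_ne (m : K) 0 with h0 | h0
      · exact ⟨0, 0, zero_mem _, by simp [h0]⟩
      have hcop : Nat.Coprime m p := (hp.out.coprime_iff_not_dvd.2 hm).symm
      obtain ⟨n, -, hn⟩ := Nat.exists_mul_mod_eq_one_of_coprime hcop hp.out.one_lt
      refine ⟨n, -((m : K)⁻¹ * (q * (m * n / p : ℕ))), neg_mem (mul_mem (inv_natCast_mem hm)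
        (mul_mem hq (natCast_mem _ _))), ?_⟩
      have h1 : (m : K) * n = 1 + p * (m * n / p : ℕ) := by
        have := Nat.mod_add_div (m * n) p
        rw [hn] at this
        exact_mod_cast this.symm
      rw [hpq] at h1
      field_simp
      linear_combination -h1
  | zero => exact ⟨0, 0, zero_mem _, by simp⟩
  | one => exact ⟨1, 0, zero_mem _, by simp⟩
  | add x y _ _ hx hy =>
    obtain ⟨a, u, hu, rfl⟩ := hx
    obtain ⟨b, v, hv, rfl⟩ := hy
    exact ⟨a + b, u + v, add_mem hu hv, by push_cast; ring⟩
  | neg x _ hx =>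
    obtain ⟨a, u, hu, rfl⟩ := hx
    refine ⟨(p - 1) * a, -u - q * a, sub_mem (neg_mem hu) (mul_mem hq (natCast_mem _ _)), ?_⟩
    push_cast [hp.out.one_lt.le]
    linear_combination (-(a : K)) * hpq
  | mul x y hx' hy' hx hy =>
    obtain ⟨a, u, hu, rfl⟩ := hx
    obtain ⟨b, v, hv, rfl⟩ := hy
    refine ⟨a * b, a * v + u * b + (ζ - 1) * (u * v), ?_, by push_cast; ring⟩
    exact add_mem (add_mem (mul_mem (natCast_mem _ _) hv) (mul_mem hu (natCast_mem _ _)))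
      (mul_mem pi_mem (mul_mem hu hv))

end BaseRing

/-! ### The uniformizer π, the element λ and the valuation. -/

section Uniformizer

variable {K : Type*} [Field K] [CharZero K] {p s : ℕ} [hp : Fact p.Prime] {ζ : K}

theorem zetaPow_isPrimitiveRoot (hζ : IsPrimitiveRoot ζ (p ^ s)) {m : ℕ} (hm : m ≤ s) :
    IsPrimitiveRoot (zetaPow p s ζ m) (p ^ m) :=
  hζ.pow (pow_pos hp.out.pos _) (by rw [← pow_add]; congr 1; omega)

theorem zetaPow_zero (hζ : IsPrimitiveRoot ζ (p ^ s)) : zetaPow p s ζ 0 = 1 := by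
  simp [zetaPow, hζ.pow_eq_one]

theorem exists_zetaPow_sub_one_eq (m : ℕ) :
    ∃ y ∈ baseRing p ζ, zetaPow p s ζ m - 1 = (ζ - 1) * y :=
  ⟨_, sum_mem fun i _ => pow_mem zeta_mem i, (mul_geom_sum ζ (p ^ (s - m))).symm⟩

theorem exists_lam_eq : ∃ y ∈ baseRing p ζ, lam p s ζ = (ζ - 1) * y := exists_zetaPow_sub_one_eq 1

theorem lam_ne_zero (hs : 1 ≤ s) (hζ : IsPrimitiveRoot ζ (p ^ s)) : lam p s ζ ≠ 0 := by
  have := zetaPow_isPrimitiveRoot hζ hs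
  rw [pow_one] at this
  exact sub_ne_zero.2 (this.ne_one hp.out.one_lt)

/-- `p = λ^(p-1) w` with `w ≡ -1` modulo `π`. -/
theorem exists_natCast_prime_eq (hs : 1 ≤ s) (hζ : IsPrimitiveRoot ζ (p ^ s)) :
    ∃ w ∈ baseRing p ζ, (p : K) = lam p s ζ ^ (p - 1) * w ∧
      ∃ y ∈ baseRing p ζ, w = -1 + (ζ - 1) * y := by
  set R := baseRing p ζ with hR
  set μ := zetaPow p s ζ 1 with hμ
  have hμp : IsPrimitiveRoot μ (p - 1 + 1) := by
    have := zetaPow_isPrimitiveRoot hζ hs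
    rwa [show p ^ 1 = p - 1 + 1 by have := hp.out.one_lt; simp; omega] at this
  let ζR : R := ⟨ζ, zeta_mem⟩
  let μR : R := ζR ^ p ^ (s - 1)
  -- Each factor of p = ∏ (1 - μ^{k+1}) is -λ times a geometric sum. Modulo π the sums become k + 1,
  -- so w becomes (p-1)! up to the sign (-1)^{p-1}, and Wilson's theorem gives -1.
  let w : R := (-1) ^ (p - 1) * ∏ k ∈ Finset.range (p - 1), ∑ i ∈ Finset.range (k + 1), μR ^ i
  have hpw : (p : K) = lam p s ζ ^ (p - 1) * w := by
    have h1 := hμp.prod_one_sub_pow_eq_order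
    have h2 : ((p - 1 : ℕ) : K) + 1 = p := by exact_mod_cast Nat.sub_add_cancel hp.out.one_lt.le
    rw [h2] at h1
    rw [← h1]
    have h3 (k : ℕ) : 1 - μ ^ (k + 1) = (-1 * lam p s ζ) * ∑ i ∈ Finset.range (k + 1), μ ^ i := by
      rw [← mul_neg_geom_sum μ (k + 1), lam]; ring
    rw [Finset.prod_congr rfl fun k _ => h3 k, Finset.prod_mul_distrib, Finset.prod_const,
      Finset.card_range, mul_pow]
    simp only [w, μR, ζR]
    push_cast
    rw [hμ, zetaPow]
    ring
  refine ⟨w, w.2, hpw, ?_⟩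
  let q := Ideal.Quotient.mk (Ideal.span {unif p ζ})
  have hqζ : q ζR = 1 := by
    rw [← map_one q, Ideal.Quotient.eq, Ideal.mem_span_singleton]; exact dvd_rfl
  have hqμ : q μR = 1 := by rw [map_pow, hqζ, one_pow]
  have hqp : (p : R ⧸ Ideal.span {unif p ζ}) = 0 := by
    rw [← map_natCast q, Ideal.Quotient.eq_zero_iff_mem, Ideal.mem_span_singleton]
    obtain ⟨y, hy, hly⟩ := exists_lam_eq (K := K) (p := p) (s := s) (ζ := ζ)
    have hp2 : p - 1 = p - 2 + 1 := by have := hp.out.two_le; omega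
    refine ⟨⟨y, hy⟩ * ⟨_, lam_mem s⟩ ^ (p - 2) * w, ?_⟩
    ext
    push_cast
    rw [coe_unif, hpw, hp2, pow_succ, hly]
    ring
  have hcast (a : ℤ) (ha : (a : ZMod p) = 0) : (a : R ⧸ Ideal.span {unif p ζ}) = 0 := by
    obtain ⟨b, rfl⟩ := (ZMod.intCast_zmod_eq_zero_iff_dvd a p).1 ha
    push_cast; rw [hqp, zero_mul]
  have hqw : q (w + 1) = 0 := by
    have : q (w + 1) = (((-1) ^ (p - 1) * ∏ k ∈ Finset.range (p - 1), (k + 1 : ℕ) + 1 : ℤ) :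
        R ⧸ Ideal.span {unif p ζ}) := by
      simp only [w, map_add, map_mul, map_pow, map_prod, map_sum, hqμ, map_neg, map_one]
      push_cast
      simp
    rw [this]
    apply hcast
    rw [Finset.prod_range_add_one_eq_factorial]
    push_cast
    rw [ZMod.wilsons_lemma, ZMod.pow_card_sub_one_eq_one (neg_ne_zero.2 one_ne_zero)]
    ring
  rw [Ideal.Quotient.eq_zero_iff_mem, Ideal.mem_span_singleton] at hqw
  obtain ⟨y, hy⟩ := hqw
  refine ⟨y, y.2, ?_⟩
  have := congrArg (baseRing p ζ).subtype hy
  simp at this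
  rw [coe_unif] at this
  linear_combination this

theorem exists_natCast_prime_eq_pi_mul (hs : 1 ≤ s) (hζ : IsPrimitiveRoot ζ (p ^ s)) :
    ∃ y ∈ baseRing p ζ, (p : K) = (ζ - 1) * y := by
  obtain ⟨w, hw, hpw, -⟩ := exists_natCast_prime_eq hs hζ
  obtain ⟨y, hy, hly⟩ := exists_lam_eq (K := K) (p := p) (s := s) (ζ := ζ)
  have hp2 : p - 1 = p - 2 + 1 := by have := hp.out.two_le; omega
  refine ⟨y * lam p s ζ ^ (p - 2) * w, mul_mem (mul_mem hy (pow_mem (lam_mem s) _)) hw, ?_⟩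
  rw [hpw, hp2, pow_succ, hly]; ring

/-- Frobenius modulo p: 1 = (π + 1)^{p^s} ≡ π^{p^s} + 1. This is what lets finite geometric sums
invert elements congruent to 1 modulo π. -/
theorem exists_pi_pow_eq (hζ : IsPrimitiveRoot ζ (p ^ s)) :
    ∃ y ∈ baseRing p ζ, (ζ - 1) ^ p ^ s = p * y := by
  set R := baseRing p ζ
  let ζR : R := ⟨ζ, zeta_mem⟩
  obtain ⟨r, hr⟩ := exists_add_pow_prime_pow_eq hp.out (ζR - 1) 1 s
  refine ⟨-((ζ - 1) * 1 * r), neg_mem (mul_mem (mul_mem pi_mem (one_mem _)) r.2), ?_⟩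
  have := congrArg R.subtype hr
  simp [ζR, hζ.pow_eq_one] at this
  linear_combination -this

theorem isIntegral_zeta (hζ : IsPrimitiveRoot ζ (p ^ s)) : IsIntegral ℤ ζ :=
  hζ.isIntegral (pow_pos hp.out.pos _)

/-- An element of the base ring is divisible by `π` or invertible. -/
theorem mem_pi_or_inv_mem (hs : 1 ≤ s) (hζ : IsPrimitiveRoot ζ (p ^ s)) {x : K}
    (hx : x ∈ baseRing p ζ) :
    (∃ y ∈ baseRing p ζ, x = (ζ - 1) * y) ∨ (x ≠ 0 ∧ x⁻¹ ∈ baseRing p ζ) := by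
  have hpπ := exists_natCast_prime_eq_pi_mul hs hζ
  obtain ⟨n, y, hy, rfl⟩ := exists_natCast_sub_mem hpπ hx
  obtain ⟨q, hq, hpq⟩ := hpπ
  by_cases hn : p ∣ n
  · left
    obtain ⟨m, rfl⟩ := hn
    exact ⟨q * m + y, add_mem (mul_mem hq (natCast_mem _ _)) hy, by push_cast; rw [hpq]; ring⟩
  · right
    have hn0 : (n : K) ≠ 0 := by rw [Nat.cast_ne_zero]; rintro rfl; exact hn (dvd_zero _)
    obtain ⟨r, hr, hπr⟩ := exists_pi_pow_eq hζ
    set t := -((n : K)⁻¹ * y) with ht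
    have htR : t ∈ baseRing p ζ := neg_mem (mul_mem (inv_natCast_mem hn) hy)
    have h1 : (n : K) + (ζ - 1) * y = n * (1 - (ζ - 1) * t) := by
      rw [ht]; field_simp; ring
    obtain ⟨h2, h3⟩ := inv_one_sub_mul_mem (isIntegral_zeta hζ)
      (mul_mem hr (pow_mem htR (p ^ s)))
    -- The geometric sum reduces the inversion of 1 - πt to that of 1 - (πt)^{p^s}, which has the
    -- form 1 - py already treated.
    have h4 : 1 - (p : K) * (r * t ^ p ^ s) =
        (1 - (ζ - 1) * t) * ∑ i ∈ Finset.range (p ^ s), ((ζ - 1) * t) ^ i := by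
      rw [mul_neg_geom_sum, mul_pow, hπr]; ring
    set S := ∑ i ∈ Finset.range (p ^ s), ((ζ - 1) * t) ^ i with hS
    have hSR : S ∈ baseRing p ζ := sum_mem fun i _ => pow_mem (mul_mem pi_mem htR) i
    have h5 : 1 - (ζ - 1) * t ≠ 0 := by rintro h; rw [h, zero_mul] at h4; exact h2 h4
    have h6 : S ≠ 0 := by rintro h; rw [h, mul_zero] at h4; exact h2 h4
    refine ⟨by rw [h1]; exact mul_ne_zero hn0 h5, ?_⟩
    have : ((n : K) + (ζ - 1) * y)⁻¹ = (n : K)⁻¹ * (S * (1 - (p : K) * (r * t ^ p ^ s))⁻¹) := by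
      rw [h1, h4]; field_simp
    rw [this]
    exact mul_mem (inv_natCast_mem hn) (mul_mem hSR h3)

variable [IsCyclotomicExtension {p ^ s} ℚ K]

theorem nu_mul (hζ : IsPrimitiveRoot ζ (p ^ s)) {a b : K} (ha : a ≠ 0) (hb : b ≠ 0) :
    nu p (a * b) = nu p a + nu p b := by
  have := IsCyclotomicExtension.finiteDimensional {p ^ s} ℚ K
  rw [nu, nu, nu, map_mul, padicValRat.mul (Algebra.norm_ne_zero_iff.2 ha)
    (Algebra.norm_ne_zero_iff.2 hb)]
  push_cast; ring

theorem nu_one (hζ : IsPrimitiveRoot ζ (p ^ s)) : nu p (1 : K) = 0 := by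
  have := nu_mul hζ (one_ne_zero (α := K)) one_ne_zero
  rw [mul_one] at this; linarith

theorem nu_pow (hζ : IsPrimitiveRoot ζ (p ^ s)) {a : K} (ha : a ≠ 0) (n : ℕ) :
    nu p (a ^ n) = n * nu p a := by
  induction n with
  | zero => simp [nu_one hζ]
  | succ n ih => rw [pow_succ, nu_mul hζ (pow_ne_zero _ ha) ha, ih]; push_cast; ring

theorem nu_inv (hζ : IsPrimitiveRoot ζ (p ^ s)) {a : K} (ha : a ≠ 0) :
    nu p a⁻¹ = - nu p a := by
  have := nu_mul hζ ha (inv_ne_zero ha)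
  rw [mul_inv_cancel₀ ha, nu_one hζ] at this; linarith

theorem nu_natCast (hζ : IsPrimitiveRoot ζ (p ^ s)) {n : ℕ} (hn : n ≠ 0) :
    nu p (n : K) = padicValNat p n := by
  have := IsCyclotomicExtension.finiteDimensional {p ^ s} ℚ K
  have h : (n : K) = algebraMap ℚ K n := by simp
  have h2 : (Module.finrank ℚ K : ℚ) ≠ 0 := by
    rw [Nat.cast_ne_zero]; exact Module.finrank_pos.ne'
  rw [nu, h, Algebra.norm_algebraMap, padicValRat.pow, padicValRat.of_nat]
  rw [Int.cast_mul, Int.cast_natCast, Int.cast_natCast, mul_div_cancel_left₀ _ h2]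

theorem nu_prime (hζ : IsPrimitiveRoot ζ (p ^ s)) : nu p (p : K) = 1 := by
  rw [nu_natCast hζ hp.out.ne_zero, padicValNat_self, Nat.cast_one]

/-- A multiple by an integer prime to p is integral over ℤ and has the same valuation, and its norm
is a rational integer. -/
theorem nu_nonneg_of_mem (hζ : IsPrimitiveRoot ζ (p ^ s)) {a : K} (ha : a ∈ baseRing p ζ) :
    0 ≤ nu p a := by
  have hfd := IsCyclotomicExtension.finiteDimensional {p ^ s} ℚ K
  rcases eq_or_ne a 0 with rfl | ha0
  · simp [nu]
  obtain ⟨m, hm, hi⟩ := exists_isIntegral_natCast_mul (isIntegral_zeta hζ) ha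
  have hm0 : m ≠ 0 := by rintro rfl; exact hm (dvd_zero _)
  have h1 := nu_mul hζ (Nat.cast_ne_zero.2 hm0) ha0
  rw [nu_natCast hζ hm0, padicValNat.eq_zero_of_not_dvd hm, Nat.cast_zero, zero_add] at h1
  rw [← h1, nu]
  obtain ⟨n, hn⟩ := IsIntegrallyClosed.isIntegral_iff.1 (Algebra.isIntegral_norm (R := ℤ) ℚ hi)
  rw [← hn]
  simp only [algebraMap_int_eq, eq_intCast, padicValRat.of_int]
  positivity

theorem pi_ne_zero (hs : 1 ≤ s) (hζ : IsPrimitiveRoot ζ (p ^ s)) : ζ - 1 ≠ 0 :=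
  sub_ne_zero.2 (hζ.ne_one (Nat.one_lt_pow (by omega) hp.out.one_lt))

theorem nu_pi_pos (hs : 1 ≤ s) (hζ : IsPrimitiveRoot ζ (p ^ s)) : 0 < nu p (ζ - 1) := by
  obtain ⟨y, hy, h⟩ := exists_pi_pow_eq hζ
  have h0 := pi_ne_zero hs hζ
  have hy0 : y ≠ 0 := by
    rintro rfl; rw [mul_zero] at h; exact pow_ne_zero _ h0 h
  have h1 := congrArg (nu p) h
  rw [nu_pow hζ h0, nu_mul hζ (Nat.cast_ne_zero.2 hp.out.ne_zero) hy0, nu_prime hζ] at h1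
  have h2 := nu_nonneg_of_mem hζ hy
  by_contra hcon
  have : (((p ^ s : ℕ) : ℚ)) * nu p (ζ - 1) ≤ 0 :=
    mul_nonpos_of_nonneg_of_nonpos (by positivity) (not_lt.1 hcon)
  linarith

theorem nu_eq_zero_of_mem_of_inv_mem (hζ : IsPrimitiveRoot ζ (p ^ s)) {a : K}
    (ha : a ∈ baseRing p ζ) (ha0 : a ≠ 0) (ha' : a⁻¹ ∈ baseRing p ζ) : nu p a = 0 := by
  have h1 := nu_nonneg_of_mem hζ ha
  have h2 := nu_nonneg_of_mem hζ ha'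
  rw [nu_inv hζ ha0] at h2
  linarith

/-- Divide by π as long as the element is not a unit. The process stops because each division lowers
ν by the fixed amount ν(π) > 0, while ν stays nonnegative on the ring. -/
theorem exists_eq_pi_pow_mul (hs : 1 ≤ s) (hζ : IsPrimitiveRoot ζ (p ^ s)) {a : K}
    (ha : a ∈ baseRing p ζ) (ha0 : a ≠ 0) :
    ∃ (k : ℕ) (u : K), u ∈ baseRing p ζ ∧ u ≠ 0 ∧ u⁻¹ ∈ baseRing p ζ ∧ a = (ζ - 1) ^ k * u := by
  have hπ := nu_pi_pos hs hζ
  obtain ⟨N, hN⟩ := exists_nat_gt (nu p a / nu p (ζ - 1))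
  rw [div_lt_iff₀ hπ] at hN
  induction N generalizing a with
  | zero =>
    have := nu_nonneg_of_mem hζ ha
    simp at hN; linarith
  | succ N ih =>
    rcases mem_pi_or_inv_mem hs hζ ha with ⟨y, hy, rfl⟩ | ⟨-, h⟩
    · have hy0 := right_ne_zero_of_mul ha0
      rw [nu_mul hζ (pi_ne_zero hs hζ) hy0] at hN
      obtain ⟨k, u, h1, h2, h3, rfl⟩ := ih hy hy0 (by push_cast at hN; linarith)
      exact ⟨k + 1, u, h1, h2, h3, by rw [pow_succ]; ring⟩
    · exact ⟨0, a, ha, ha0, h, by simp⟩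

theorem exists_natCast_mul_mem (hζ : IsPrimitiveRoot ζ (p ^ s)) (a : K) :
    ∃ n : ℕ, n ≠ 0 ∧ (n : K) * a ∈ baseRing p ζ := by
  have : NeZero (p ^ s) := ⟨(pow_pos hp.out.pos _).ne'⟩
  have h := IsCyclotomicExtension.adjoin_primitive_root_eq_top (A := ℚ) hζ
  have ha : a ∈ Algebra.adjoin ℚ ({ζ} : Set K) := h ▸ Algebra.mem_top
  induction ha using Algebra.adjoin_induction with
  | mem x hx => rw [Set.mem_singleton_iff.1 hx]; exact ⟨1, one_ne_zero, by simpa using zeta_mem⟩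
  | algebraMap r =>
    refine ⟨r.den, r.den_ne_zero, ?_⟩
    have : (r.den : K) * algebraMap ℚ K r = (r.num : K) := by
      rw [eq_ratCast, mul_comm]; exact_mod_cast r.mul_den_eq_num
    rw [this]; exact intCast_mem _ _
  | add x y _ _ hx hy =>
    obtain ⟨m, hm, hx⟩ := hx
    obtain ⟨n, hn, hy⟩ := hy
    refine ⟨m * n, mul_ne_zero hm hn, ?_⟩
    have : ((m * n : ℕ) : K) * (x + y) = n * (m * x) + m * (n * y) := by push_cast; ring
    rw [this]
    exact add_mem (mul_mem (natCast_mem _ _) hx) (mul_mem (natCast_mem _ _) hy)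
  | mul x y _ _ hx hy =>
    obtain ⟨m, hm, hx⟩ := hx
    obtain ⟨n, hn, hy⟩ := hy
    refine ⟨m * n, mul_ne_zero hm hn, ?_⟩
    have : ((m * n : ℕ) : K) * (x * y) = (m * x) * (n * y) := by push_cast; ring
    rw [this]; exact mul_mem hx hy

/-- Clear a denominator n and compare the π-adic factorisations of na and of n: nonnegative
valuation means that the exponent for n is at most the one for na. -/
theorem mem_baseRing_iff (hs : 1 ≤ s) (hζ : IsPrimitiveRoot ζ (p ^ s)) {a : K} (ha : a ≠ 0) :
    a ∈ baseRing p ζ ↔ 0 ≤ nu p a := by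
  refine ⟨nu_nonneg_of_mem hζ, fun h => ?_⟩
  obtain ⟨n, hn, hna⟩ := exists_natCast_mul_mem hζ a
  have hn0 : (n : K) ≠ 0 := Nat.cast_ne_zero.2 hn
  obtain ⟨k, u, hu, hu0, hu', hk⟩ := exists_eq_pi_pow_mul hs hζ hna (mul_ne_zero hn0 ha)
  obtain ⟨l, v, hv, hv0, hv', hl⟩ := exists_eq_pi_pow_mul hs hζ (natCast_mem _ n) hn0
  have h0 := pi_ne_zero hs hζ
  have h1 : nu p ((n : K) * a) = k * nu p (ζ - 1) := by
    rw [hk, nu_mul hζ (pow_ne_zero _ h0) hu0, nu_pow hζ h0, nu_eq_zero_of_mem_of_inv_mem hζ hu hu0 hu',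
      add_zero]
  have h2 : nu p (n : K) = l * nu p (ζ - 1) := by
    rw [hl, nu_mul hζ (pow_ne_zero _ h0) hv0, nu_pow hζ h0, nu_eq_zero_of_mem_of_inv_mem hζ hv hv0 hv',
      add_zero]
  rw [nu_mul hζ hn0 ha, h2] at h1
  have hlk : l ≤ k := by
    have h3 := nu_pi_pos hs hζ
    have : (l : ℚ) * nu p (ζ - 1) ≤ k * nu p (ζ - 1) := by linarith
    exact_mod_cast le_of_mul_le_mul_right this h3
  have : a = (ζ - 1) ^ (k - l) * u * v⁻¹ := by
    have e : (ζ - 1) ^ k = (ζ - 1) ^ (k - l) * (ζ - 1) ^ l := by rw [← pow_add]; congr 1; omega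
    rw [hl, e] at hk
    have hl0 := pow_ne_zero l h0
    field_simp at hk ⊢
    linear_combination hk
  rw [this]
  exact mul_mem (mul_mem (pow_mem pi_mem _) hu) hv'

/-- Translates the cut-offs on valuations in the definitions of the truncations into divisibility in
the base ring, the only form used from the power series on. -/
theorem exists_mul_iff_nu_le (hs : 1 ≤ s) (hζ : IsPrimitiveRoot ζ (p ^ s)) {a b : K} (ha : a ≠ 0)
    (hb : b ≠ 0) : (∃ y ∈ baseRing p ζ, b = a * y) ↔ nu p a ≤ nu p b := by
  have h1 : nu p (b * a⁻¹) = nu p b - nu p a := by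
    rw [nu_mul hζ hb (inv_ne_zero ha), nu_inv hζ ha]; ring
  have h2 := mem_baseRing_iff hs hζ (mul_ne_zero hb (inv_ne_zero ha))
  rw [h1, sub_nonneg] at h2
  rw [← h2]
  constructor
  · rintro ⟨y, hy, rfl⟩
    rwa [mul_comm a, mul_inv_cancel_right₀ ha]
  · intro h
    exact ⟨_, h, by field_simp⟩

theorem nu_lam (hs : 1 ≤ s) (hζ : IsPrimitiveRoot ζ (p ^ s)) :
    nu p (lam p s ζ) = 1 / ((p : ℚ) - 1) := by
  obtain ⟨w, hw, hpw, y, hy, hwy⟩ := exists_natCast_prime_eq hs hζ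
  have hp1 : (1 : ℚ) < p := by exact_mod_cast hp.out.one_lt
  have hw' : w ≠ 0 := by
    rintro rfl; rw [mul_zero, Nat.cast_eq_zero] at hpw; exact hp.out.ne_zero hpw
  have h0 := pi_ne_zero hs hζ
  have hwν : nu p w = 0 := by
    refine le_antisymm ?_ (nu_nonneg_of_mem hζ hw)
    by_contra hcon
    rcases mem_pi_or_inv_mem hs hζ hw with ⟨z, hz, hwz⟩ | ⟨-, h⟩
    · have h1 : (1 : K) = (ζ - 1) * (y - z) := by linear_combination hwy - hwz
      have h2 := nu_one (K := K) hζ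
      have hyz : y - z ≠ 0 := by intro h; rw [h, mul_zero] at h1; exact one_ne_zero h1
      rw [h1, nu_mul hζ h0 hyz] at h2
      have := nu_nonneg_of_mem hζ (sub_mem hy hz)
      have := nu_pi_pos hs hζ
      linarith
    · have := nu_nonneg_of_mem hζ h
      rw [nu_inv hζ hw'] at this; linarith
  have hl := lam_ne_zero hs hζ
  have h1 := nu_prime hζ
  rw [hpw, nu_mul hζ (pow_ne_zero _ hl) hw', nu_pow hζ hl, hwν,
    Nat.cast_sub hp.out.one_lt.le] at h1
  have h3 : (p : ℚ) - 1 ≠ 0 := by linarith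
  field_simp
  push_cast at h1
  linarith

/-- Needed for unique factorisation: it makes polynomial rings over the base ring factorial, so that
their localisations are normal. -/
theorem isDiscreteValuationRing_baseRing (hs : 1 ≤ s) (hζ : IsPrimitiveRoot ζ (p ^ s)) :
    IsDiscreteValuationRing (baseRing p ζ) := by
  have h0 := pi_ne_zero hs hζ
  have hnu : ¬ IsUnit (unif p ζ) := by
    rintro ⟨u, hu⟩
    have h1 : (ζ - 1) * ((u⁻¹ : (baseRing p ζ)ˣ) : baseRing p ζ) = 1 := by
      rw [← coe_unif (p := p), ← hu]; exact congrArg (baseRing p ζ).subtype u.mul_inv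
    have h2 := nu_one (K := K) hζ
    have h3 := right_ne_zero_of_mul (h1.trans_ne one_ne_zero)
    rw [← h1, nu_mul hζ h0 h3] at h2
    have := nu_nonneg_of_mem hζ ((u⁻¹ : (baseRing p ζ)ˣ) : baseRing p ζ).2
    have := nu_pi_pos hs hζ
    linarith
  apply IsDiscreteValuationRing.ofHasUnitMulPowIrreducibleFactorization
  have hdec (x : baseRing p ζ) (hx : x ≠ 0) : ∃ n : ℕ, Associated (unif p ζ ^ n) x := by
    obtain ⟨k, u, hu, hu0, hu', h⟩ := exists_eq_pi_pow_mul hs hζ x.2 (by simpa using hx)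
    refine ⟨k, ⟨⟨u, hu⟩, ⟨u⁻¹, hu'⟩, ?_, ?_⟩, ?_⟩
    · ext; simp [hu0]
    · ext; simp [hu0]
    · ext; simp [coe_unif, h]
  refine ⟨unif p ζ, ⟨hnu, fun a b hab => ?_⟩, fun {x} hx => hdec x hx⟩
  by_contra hcon
  push Not at hcon
  have hd (c : baseRing p ζ) (hc : ¬ IsUnit c) : ∃ d, c = unif p ζ * d := by
    rcases mem_pi_or_inv_mem hs hζ c.2 with ⟨y, hy, h⟩ | ⟨h, h'⟩
    · exact ⟨⟨y, hy⟩, by ext; simpa [coe_unif] using h⟩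
    · exact absurd (IsUnit.of_mul_eq_one ⟨(c : K)⁻¹, h'⟩ (by ext; simp [h])) hc
  obtain ⟨a', rfl⟩ := hd a hcon.1
  obtain ⟨b', rfl⟩ := hd b hcon.2
  apply hnu
  have hu0 : unif p ζ ≠ 0 := by
    intro h; exact h0 (congrArg (baseRing p ζ).subtype h)
  refine IsUnit.of_mul_eq_one (a' * b') (mul_left_cancel₀ hu0 ?_)
  linear_combination -hab

end Uniformizer

/-! ### The formal exponential turns sums into products. -/

section ExpLog

variable {K : Type*} [CommRing K] [Algebra ℚ K] {σ τ : Type*}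

/-- The exponential of a power series without constant term. -/
def ex (f : MvPowerSeries σ K) : MvPowerSeries σ K := (PowerSeries.exp K).subst f

theorem hasSubst_of_constantCoeff {f : MvPowerSeries σ K} (hf : f.constantCoeff = 0) :
    PowerSeries.HasSubst f := PowerSeries.HasSubst.of_constantCoeff_zero hf

theorem ex_zero : ex (0 : MvPowerSeries σ K) = 1 := by
  rw [ex, PowerSeries.subst_zero_eq_C_constantCoeff, PowerSeries.constantCoeff_exp, map_one,
    map_one]

theorem constantCoeff_subst_eq {f : MvPowerSeries σ K} (hf : f.constantCoeff = 0)
    (g : PowerSeries K) : (g.subst f).constantCoeff = PowerSeries.constantCoeff g := by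
  have h : g = PowerSeries.C (PowerSeries.constantCoeff g) + (g - PowerSeries.C (PowerSeries.constantCoeff g)) := by ring
  nth_rw 1 [h]
  rw [PowerSeries.subst_add (hasSubst_of_constantCoeff hf), map_add,
    PowerSeries.constantCoeff_subst_eq_zero hf (g - _) (by simp), PowerSeries.subst_C]
  simp

theorem constantCoeff_ex {f : MvPowerSeries σ K} (hf : f.constantCoeff = 0) :
    (ex f).constantCoeff = 1 := by
  rw [ex, constantCoeff_subst_eq hf, PowerSeries.constantCoeff_exp]

/-- The universal case in two variables, by comparing coefficients through the formula for binomial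
coefficients; `ex_add` follows by substitution. -/
theorem exp_subst_add_univ :
    ex (MvPowerSeries.X 0 + MvPowerSeries.X 1 : MvPowerSeries (Fin 2) K) =
      ex (MvPowerSeries.X 0) * ex (MvPowerSeries.X 1) := by
  ext e
  rw [ex, ex, ex, PowerSeries.coeff_subst_X_zero_add_X_one,
    PowerSeries.coeff_subst_X_zero_subst_mul_X_one]
  simp only [PowerSeries.coeff_exp]
  have h := Nat.add_choose_mul_factorial_mul_factorial (e 0) (e 1)
  have h1 : ((e 0).factorial : ℚ) ≠ 0 := Nat.cast_ne_zero.2 (Nat.factorial_ne_zero _)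
  have h2 : ((e 1).factorial : ℚ) ≠ 0 := Nat.cast_ne_zero.2 (Nat.factorial_ne_zero _)
  have h3 : ((e 0 + e 1).factorial : ℚ) ≠ 0 := Nat.cast_ne_zero.2 (Nat.factorial_ne_zero _)
  have h' : ((e 0 + e 1).choose (e 0) : ℚ) * (e 0).factorial * (e 1).factorial =
      (e 0 + e 1).factorial := by
    rw [Nat.choose_symm_add]; exact_mod_cast congrArg (Nat.cast (R := ℚ)) h
  rw [← map_natCast (algebraMap ℚ K), ← map_mul, ← map_mul]
  congr 1
  field_simp
  exact h'

theorem subst_ex {a : σ → MvPowerSeries τ K} (ha : MvPowerSeries.HasSubst a) {f : MvPowerSeries σ K}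
    (hf : f.constantCoeff = 0) : MvPowerSeries.subst a (ex f) = ex (MvPowerSeries.subst a f) := by
  rw [ex, ex, PowerSeries.subst, PowerSeries.subst]
  exact MvPowerSeries.subst_comp_subst_apply (hasSubst_of_constantCoeff hf).const ha _

theorem subst_subst {a : σ → MvPowerSeries τ K} (ha : MvPowerSeries.HasSubst a) {f : MvPowerSeries σ K}
    (hf : f.constantCoeff = 0) (g : PowerSeries K) :
    MvPowerSeries.subst a (g.subst f) = g.subst (MvPowerSeries.subst a f) := by
  rw [PowerSeries.subst, PowerSeries.subst]
  exact MvPowerSeries.subst_comp_subst_apply (hasSubst_of_constantCoeff hf).const ha _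

theorem subst_ex' {a : MvPowerSeries τ K} (ha : a.constantCoeff = 0) {f : PowerSeries K}
    (hf : PowerSeries.constantCoeff f = 0) : PowerSeries.subst a (ex f) = ex (PowerSeries.subst a f) :=
  subst_ex (hasSubst_of_constantCoeff ha).const hf

theorem ex_add {f g : MvPowerSeries σ K} (hf : f.constantCoeff = 0) (hg : g.constantCoeff = 0) :
    ex (f + g) = ex f * ex g := by
  have ha : MvPowerSeries.HasSubst (![f, g] : Fin 2 → MvPowerSeries σ K) :=
    MvPowerSeries.hasSubst_of_constantCoeff_zero (by intro i; fin_cases i <;> simp [hf, hg])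
  have h := congrArg (MvPowerSeries.subst (![f, g] : Fin 2 → MvPowerSeries σ K))
    (exp_subst_add_univ (K := K))
  rw [MvPowerSeries.subst_mul ha, subst_ex ha (by simp), subst_ex ha (by simp),
    subst_ex ha (by simp), MvPowerSeries.subst_add ha, MvPowerSeries.subst_X ha,
    MvPowerSeries.subst_X ha] at h
  simpa using h

theorem ex_neg_mul {f : MvPowerSeries σ K} (hf : f.constantCoeff = 0) : ex (-f) * ex f = 1 := by
  rw [← ex_add (by simp [hf]) hf, neg_add_cancel, ex_zero]

theorem ex_sum {ι : Type*} (t : Finset ι) {f : ι → MvPowerSeries σ K}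
    (hf : ∀ i ∈ t, (f i).constantCoeff = 0) : ex (∑ i ∈ t, f i) = ∏ i ∈ t, ex (f i) := by
  classical
  induction t using Finset.induction_on with
  | empty => simp [ex_zero]
  | insert a t ha ih =>
    rw [Finset.sum_insert ha, Finset.prod_insert ha, ex_add (hf a (Finset.mem_insert_self _ _)),
      ih fun i hi => hf i (Finset.mem_insert_of_mem hi)]
    rw [map_sum]
    exact Finset.sum_eq_zero fun i hi => hf i (Finset.mem_insert_of_mem hi)

theorem ex_pow {f : MvPowerSeries σ K} (hf : f.constantCoeff = 0) (n : ℕ) :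
    ex f ^ n = ex ((n : MvPowerSeries σ K) * f) := by
  have := ex_sum (Finset.range n) (f := fun _ => f) fun _ _ => hf
  simpa using this.symm

end ExpLog

/-! ### Exponential and logarithm are mutually inverse. -/

section ExpLogField

variable {K : Type*} [Field K] [CharZero K] {σ τ : Type*}

theorem deriv_log_mul : PowerSeries.derivative K (PowerSeries.log K) * (1 + PowerSeries.X) = 1 := by
  rw [PowerSeries.deriv_log]
  ext n
  rw [mul_add, mul_one, map_add]
  cases n with
  | zero => simp
  | succ n => simp [PowerSeries.coeff_succ_mul_X, pow_succ, PowerSeries.coeff_one]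

/-- With ℓ = log' and F = exp(log), one has F' = Fℓ and ℓ(1 + X) = 1. Hence Fℓ has zero derivative
and constant term 1, so Fℓ = 1. -/
theorem ex_log : ex (PowerSeries.log K : PowerSeries K) = (1 + PowerSeries.X : PowerSeries K) := by
  set F : PowerSeries K := ex (PowerSeries.log K : PowerSeries K) with hF
  have hd : PowerSeries.derivative K F = F * PowerSeries.derivative K (PowerSeries.log K) := by
    rw [hF, ex, PowerSeries.derivative_subst PowerSeries.HasSubst.log, PowerSeries.derivative_exp]
  set ℓ := PowerSeries.derivative K (PowerSeries.log K)
  have hℓ : ℓ * (1 + PowerSeries.X) = 1 := deriv_log_mul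
  have hdℓ : PowerSeries.derivative K (F * ℓ) = 0 := by
    have h1 := congrArg (PowerSeries.derivative K) hℓ
    simp only [Derivation.leibniz, map_add, smul_eq_mul, PowerSeries.derivative_X] at h1
    simp at h1
    rw [Derivation.leibniz, smul_eq_mul, smul_eq_mul, hd]
    have h2 : (F * PowerSeries.derivative K ℓ + ℓ * (F * ℓ)) * (1 + PowerSeries.X) = 0 := by
      linear_combination F * h1 + (F * ℓ) * hℓ - F * ℓ * hℓ + F * ℓ * (hℓ)
    refine (mul_eq_zero.1 h2).resolve_right ?_
    exact right_ne_zero_of_mul_eq_one hℓ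
  have h3 : F * ℓ = 1 := by
    apply PowerSeries.derivative.ext
    · rw [hdℓ]; simp
    · have hF0 : PowerSeries.constantCoeff F = 1 :=
        constantCoeff_ex (f := (PowerSeries.log K : PowerSeries K)) PowerSeries.constantCoeff_log
      have h5 := congrArg (PowerSeries.constantCoeff (R := K)) hℓ
      simp at h5
      simp [hF0, h5]
  calc F = F * ℓ * (1 + PowerSeries.X) := by rw [mul_assoc, hℓ, mul_one]
    _ = _ := by rw [h3, one_mul]

theorem log_exp : (PowerSeries.log K).subst (PowerSeries.exp K - 1 : PowerSeries K) =
    (PowerSeries.X : PowerSeries K) := by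
  apply PowerSeries.derivative.ext
  · rw [PowerSeries.derivative_subst PowerSeries.HasSubst.exp_sub_one]
    have h := congrArg (PowerSeries.subst (PowerSeries.exp K - 1 : PowerSeries K))
      (deriv_log_mul (K := K))
    have hs := PowerSeries.HasSubst.exp_sub_one (A := K)
    rw [PowerSeries.subst_mul hs, PowerSeries.subst_add hs, PowerSeries.subst_X hs,
      ← PowerSeries.coe_substAlgHom hs, map_one, add_sub_cancel] at h
    rw [map_sub, PowerSeries.derivative_exp, PowerSeries.derivative_X,
      Derivation.map_one_eq_zero, sub_zero]
    rwa [← PowerSeries.coe_substAlgHom hs]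
  · have := constantCoeff_subst_eq (σ := Unit) (f := (PowerSeries.exp K - 1 : PowerSeries K))
      (by have := PowerSeries.constantCoeff_exp (A := K); simp [PowerSeries.constantCoeff] at this ⊢; simp [this]) (PowerSeries.log K)
    rw [PowerSeries.constantCoeff_log] at this
    exact this.trans (by simp)

theorem log_ex {f : MvPowerSeries σ K} (hf : f.constantCoeff = 0) :
    (PowerSeries.log K).subst (ex f - 1) = f := by
  have hs := hasSubst_of_constantCoeff hf
  have h := congrArg (PowerSeries.subst f) (log_exp (K := K))
  rw [PowerSeries.subst_comp_subst_apply PowerSeries.HasSubst.exp_sub_one hs,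
    PowerSeries.subst_X hs, PowerSeries.subst_sub hs] at h
  rw [← PowerSeries.coe_substAlgHom hs, map_one] at h
  rw [ex, ← PowerSeries.coe_substAlgHom hs]
  exact h

theorem ex_injective {f g : MvPowerSeries σ K} (hf : f.constantCoeff = 0)
    (hg : g.constantCoeff = 0) (h : ex f = ex g) : f = g := by
  rw [← log_ex hf, h, log_ex hg]

theorem ex_log_subst {f : MvPowerSeries σ K} (hf : f.constantCoeff = 1) :
    ex ((PowerSeries.log K).subst (f - 1)) = f := by
  have h0 : (f - 1).constantCoeff = 0 := by simp [hf]
  rw [← subst_ex' h0 PowerSeries.constantCoeff_log, ex_log,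
    PowerSeries.subst_add (hasSubst_of_constantCoeff h0),
    PowerSeries.subst_X (hasSubst_of_constantCoeff h0),
    ← PowerSeries.coe_substAlgHom (hasSubst_of_constantCoeff h0), map_one]
  ring

end ExpLogField

/-! ### Integral and restricted power series, and congruences between them. -/

section Restricted

variable {K : Type*} [Field K] (R : Subring K) (σ : Type*) {τ : Type*}

/-- The power series with coefficients in the subring `R`. -/
def intS : Subring (MvPowerSeries σ K) := (MvPowerSeries.map (σ := σ) R.subtype).range

/-- The embedding of polynomials over `R` in the power series. -/
def polyHom : MvPolynomial σ R →+* MvPowerSeries σ K :=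
  MvPolynomial.coeToMvPowerSeries.ringHom.comp (MvPolynomial.map R.subtype)

variable {R σ}

theorem mem_intS {f : MvPowerSeries σ K} : f ∈ intS R σ ↔ ∀ m, MvPowerSeries.coeff m f ∈ R := by
  constructor
  · rintro ⟨g, rfl⟩ m
    rw [MvPowerSeries.coeff_map]
    exact (MvPowerSeries.coeff m g).2
  · intro h
    exact ⟨fun m => ⟨MvPowerSeries.coeff m f, h m⟩, by ext m; rfl⟩

theorem coeff_polyHom (q : MvPolynomial σ R) (m : σ →₀ ℕ) :
    MvPowerSeries.coeff m (polyHom R σ q) = ((q.coeff m : R) : K) := by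
  simp [polyHom, MvPolynomial.coeff_map]

theorem polyHom_mem (q : MvPolynomial σ R) : polyHom R σ q ∈ intS R σ :=
  mem_intS.2 fun m => by rw [coeff_polyHom]; exact (q.coeff m).2

theorem polyHom_C (r : R) : polyHom R σ (MvPolynomial.C r) = MvPowerSeries.C (r : K) := by
  simp [polyHom]

theorem polyHom_X (i : σ) : polyHom R σ (MvPolynomial.X i) = MvPowerSeries.X i := by
  simp [polyHom]

theorem C_mem_intS {a : K} (ha : a ∈ R) : MvPowerSeries.C a ∈ intS R σ := by
  rw [← polyHom_C ⟨a, ha⟩]; exact polyHom_mem _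

variable (R) in
/-- Congruence of power series modulo the multiples of `a` with coefficients in `aR`. -/
def Cg (a : K) (f g : MvPowerSeries σ K) : Prop :=
  ∃ h ∈ intS R σ, f = g + MvPowerSeries.C a * h

theorem Cg.refl (a : K) (f : MvPowerSeries σ K) : Cg R a f f := ⟨0, zero_mem _, by simp⟩

theorem Cg.symm {a : K} {f g : MvPowerSeries σ K} (h : Cg R a f g) : Cg R a g f := by
  obtain ⟨h, hh, rfl⟩ := h
  exact ⟨-h, neg_mem hh, by ring⟩

theorem Cg.trans {a : K} {f g h : MvPowerSeries σ K} (h1 : Cg R a f g) (h2 : Cg R a g h) :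
    Cg R a f h := by
  obtain ⟨u, hu, rfl⟩ := h1
  obtain ⟨v, hv, rfl⟩ := h2
  exact ⟨v + u, add_mem hv hu, by ring⟩

theorem Cg.add {a : K} {f g f' g' : MvPowerSeries σ K} (h1 : Cg R a f g) (h2 : Cg R a f' g') :
    Cg R a (f + f') (g + g') := by
  obtain ⟨u, hu, rfl⟩ := h1
  obtain ⟨v, hv, rfl⟩ := h2
  exact ⟨u + v, add_mem hu hv, by ring⟩

theorem Cg.neg {a : K} {f g : MvPowerSeries σ K} (h1 : Cg R a f g) : Cg R a (-f) (-g) := by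
  obtain ⟨u, hu, rfl⟩ := h1
  exact ⟨-u, neg_mem hu, by ring⟩

theorem Cg.mul {a : K} {f g f' g' : MvPowerSeries σ K} (h1 : Cg R a f g) (h2 : Cg R a f' g')
    (hg : g ∈ intS R σ) (hf' : f' ∈ intS R σ) : Cg R a (f * f') (g * g') := by
  obtain ⟨u, hu, rfl⟩ := h1
  obtain ⟨v, hv, rfl⟩ := h2
  exact ⟨g * v + u * (g' + MvPowerSeries.C a * v), add_mem (mul_mem hg hv) (mul_mem hu hf'),
    by ring⟩

theorem Cg.mem {a : K} {f g : MvPowerSeries σ K} (ha : a ∈ R) (h : Cg R a f g)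
    (hg : g ∈ intS R σ) : f ∈ intS R σ := by
  obtain ⟨u, hu, rfl⟩ := h
  exact add_mem hg (mul_mem (C_mem_intS ha) hu)

theorem Cg.pow {a : K} {f g : MvPowerSeries σ K} (ha : a ∈ R) (h : Cg R a f g)
    (hg : g ∈ intS R σ) (n : ℕ) : Cg R a (f ^ n) (g ^ n) := by
  induction n with
  | zero => simpa using Cg.refl a _
  | succ n ih => rw [pow_succ, pow_succ]; exact ih.mul h (pow_mem hg n) (h.mem ha hg)

theorem Cg.prod {ι : Type*} {a : K} (ha : a ∈ R) (t : Finset ι) {f g : ι → MvPowerSeries σ K}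
    (h : ∀ i ∈ t, Cg R a (f i) (g i)) (hg : ∀ i ∈ t, g i ∈ intS R σ) :
    Cg R a (∏ i ∈ t, f i) (∏ i ∈ t, g i) := by
  classical
  induction t using Finset.induction_on with
  | empty => simpa using Cg.refl a _
  | insert b t hb ih =>
    rw [Finset.prod_insert hb, Finset.prod_insert hb]
    refine (h b (Finset.mem_insert_self _ _)).mul
      (ih (fun i hi => h i (Finset.mem_insert_of_mem hi))
        (fun i hi => hg i (Finset.mem_insert_of_mem hi)))
      (hg b (Finset.mem_insert_self _ _)) ?_
    exact prod_mem fun i hi => (h i (Finset.mem_insert_of_mem hi)).mem ha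
      (hg i (Finset.mem_insert_of_mem hi))

theorem Cg.of_mul {a b : K} {f g : MvPowerSeries σ K} (hb : b ∈ R) (h : Cg R (a * b) f g) :
    Cg R a f g := by
  obtain ⟨u, hu, rfl⟩ := h
  exact ⟨MvPowerSeries.C b * u, mul_mem (C_mem_intS hb) hu, by rw [map_mul]; ring⟩

theorem C_mul_cancel {a : K} (ha : a ≠ 0) {f g : MvPowerSeries σ K}
    (h : MvPowerSeries.C a * f = MvPowerSeries.C a * g) : f = g := by
  ext m
  have := congrArg (MvPowerSeries.coeff m) h
  rw [MvPowerSeries.coeff_C_mul, MvPowerSeries.coeff_C_mul] at this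
  exact mul_left_cancel₀ ha this

theorem Cg.of_C_mul {a b : K} (hb : b ≠ 0) {f g : MvPowerSeries σ K}
    (h : Cg R (b * a) (MvPowerSeries.C b * f) (MvPowerSeries.C b * g)) : Cg R a f g := by
  obtain ⟨u, hu, h⟩ := h
  refine ⟨u, hu, C_mul_cancel hb ?_⟩
  rw [h, map_mul]; ring

theorem cg_iff {a : K} {f g : MvPowerSeries σ K} :
    Cg R a f g ↔ ∀ m, ∃ y ∈ R, MvPowerSeries.coeff m f = MvPowerSeries.coeff m g + a * y := by
  constructor
  · rintro ⟨h, hh, rfl⟩ m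
    exact ⟨_, mem_intS.1 hh m, by rw [map_add, MvPowerSeries.coeff_C_mul]⟩
  · intro h
    choose y hy hf using h
    let h : MvPowerSeries σ K := fun m => y m
    exact ⟨h, mem_intS.2 hy, by ext m; rw [map_add, MvPowerSeries.coeff_C_mul, hf m]; rfl⟩

/-- The power series that are polynomials over `R` modulo `a`. -/
def polyMod (a : R) : Subring (MvPowerSeries σ K) where
  carrier := {f | ∃ q, Cg R (a : K) f (polyHom R σ q)}
  mul_mem' := by
    rintro f g ⟨q, hq⟩ ⟨r, hr⟩
    exact ⟨q * r, by rw [map_mul]; exact hq.mul hr (polyHom_mem _) (hr.mem a.2 (polyHom_mem _))⟩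
  one_mem' := ⟨1, by rw [map_one]; exact Cg.refl _ _⟩
  add_mem' := by
    rintro f g ⟨q, hq⟩ ⟨r, hr⟩
    exact ⟨q + r, by rw [map_add]; exact hq.add hr⟩
  zero_mem' := ⟨0, by rw [map_zero]; exact Cg.refl _ _⟩
  neg_mem' := by
    rintro f ⟨q, hq⟩
    exact ⟨-q, by rw [map_neg]; exact hq.neg⟩

theorem polyMod_le_intS (a : R) : polyMod (σ := σ) a ≤ intS R σ := by
  rintro f ⟨q, hq⟩; exact hq.mem a.2 (polyHom_mem _)

theorem polyMod_of_cg {a : R} {f g : MvPowerSeries σ K} (h : Cg R (a : K) f g) (hg : g ∈ polyMod a) :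
    f ∈ polyMod a := by
  obtain ⟨q, hq⟩ := hg
  exact ⟨q, h.trans hq⟩

theorem polyHom_mem_polyMod (a : R) (q : MvPolynomial σ R) : polyHom R σ q ∈ polyMod a :=
  ⟨q, Cg.refl _ _⟩

/-- `polyMod` is saturated. -/
theorem mem_polyMod_of_C_mul_mem {a b : R} (ha : a ≠ 0) {h : MvPowerSeries σ K}
    (hh : h ∈ intS R σ) (hf : MvPowerSeries.C (a : K) * h ∈ polyMod (a * b)) : h ∈ polyMod b := by
  obtain ⟨q, hq⟩ := hf
  -- The coefficients of q agree with those of ah modulo ab, and h is integral, so they are all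
  -- divisible by a and the polynomial itself can be divided.
  obtain ⟨q', rfl⟩ : MvPolynomial.C a ∣ q := by
    rw [MvPolynomial.C_dvd_iff_dvd_coeff]
    intro m
    obtain ⟨y, hy, hm⟩ := cg_iff.1 hq m
    rw [MvPowerSeries.coeff_C_mul, coeff_polyHom] at hm
    refine ⟨⟨_, mem_intS.1 hh m⟩ - b * ⟨y, hy⟩, ?_⟩
    ext
    push_cast at hm ⊢
    linear_combination -hm
  refine ⟨q', Cg.of_C_mul (b := (a : K)) (by simpa using ha) ?_⟩
  rw [map_mul, polyHom_C] at hq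
  simpa using hq

variable (R σ) in
/-- The restricted power series over `R`. -/
def Rst : Subring (MvPowerSeries σ K) := ⨅ a : {a : R // a ≠ 0}, polyMod a.1

theorem mem_Rst {f : MvPowerSeries σ K} : f ∈ Rst R σ ↔ ∀ a : R, a ≠ 0 → f ∈ polyMod a := by
  simp [Rst, Subring.mem_iInf]

theorem polyHom_mem_Rst (q : MvPolynomial σ R) : polyHom R σ q ∈ Rst R σ :=
  mem_Rst.2 fun a _ => polyHom_mem_polyMod a q

theorem Rst_le_intS : Rst R σ ≤ intS R σ := fun _ h =>
  polyMod_le_intS _ (mem_Rst.1 h 1 one_ne_zero)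

theorem C_mem_Rst {a : K} (ha : a ∈ R) : MvPowerSeries.C a ∈ Rst R σ := by
  rw [← polyHom_C ⟨a, ha⟩]; exact polyHom_mem_Rst _

theorem X_mem_Rst (i : σ) : (MvPowerSeries.X i : MvPowerSeries σ K) ∈ Rst R σ := by
  rw [← polyHom_X (R := R)]; exact polyHom_mem_Rst _

/-- The standard way of dividing by pλ below: the quotient is first shown to be integral, and is
then restricted because the product is. -/
theorem mem_Rst_of_C_mul_mem {a : R} (ha : a ≠ 0) {h : MvPowerSeries σ K}
    (hh : h ∈ intS R σ) (hf : MvPowerSeries.C (a : K) * h ∈ Rst R σ) : h ∈ Rst R σ :=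
  mem_Rst.2 fun _ hb => mem_polyMod_of_C_mul_mem ha hh (mem_Rst.1 hf _ (mul_ne_zero ha hb))

theorem inv_mem_intS {f : MvPowerSeries σ K} (hf : f ∈ intS R σ) (h1 : f.constantCoeff = 1) :
    f⁻¹ ∈ intS R σ := by
  obtain ⟨g, rfl⟩ := hf
  have hg : g.constantCoeff = ((1 : Rˣ) : R) := by
    rw [← MvPowerSeries.coeff_zero_eq_constantCoeff_apply, MvPowerSeries.coeff_map] at h1
    rw [← MvPowerSeries.coeff_zero_eq_constantCoeff_apply]
    exact Subtype.ext h1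
  have h := MvPowerSeries.mul_invOfUnit g 1 hg
  have h2 := congrArg (MvPowerSeries.map R.subtype) h
  rw [map_mul, map_one] at h2
  refine ⟨g.invOfUnit 1, ?_⟩
  · rw [MvPowerSeries.eq_inv_iff_mul_eq_one (by rw [h1]; exact one_ne_zero), mul_comm]; exact h2

theorem subst_mem_intS {a : σ → MvPowerSeries τ K} [Finite σ] (ha : ∀ i, (a i).constantCoeff = 0)
    (ha' : ∀ i, a i ∈ intS R τ) {f : MvPowerSeries σ K} (hf : f ∈ intS R σ) :
    MvPowerSeries.subst a f ∈ intS R τ := by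
  obtain ⟨g, rfl⟩ := hf
  choose b hb using ha'
  have hb' : MvPowerSeries.HasSubst b := MvPowerSeries.hasSubst_of_constantCoeff_zero fun i => by
    have := ha i
    rw [← hb i, ← MvPowerSeries.coeff_zero_eq_constantCoeff_apply, MvPowerSeries.coeff_map] at this
    rw [← MvPowerSeries.coeff_zero_eq_constantCoeff_apply]
    exact Subtype.ext this
  refine ⟨MvPowerSeries.subst b g, ?_⟩
  rw [MvPowerSeries.map_subst hb']
  simp_rw [hb]

theorem subst_C_mul {a : σ → MvPowerSeries τ K} (ha : MvPowerSeries.HasSubst a) (c : K)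
    (f : MvPowerSeries σ K) : MvPowerSeries.subst a (MvPowerSeries.C c * f) =
      MvPowerSeries.C c * MvPowerSeries.subst a f := by
  rw [MvPowerSeries.subst_mul ha, MvPowerSeries.subst_C]

theorem Cg.subst {c : K} {a : σ → MvPowerSeries τ K} [Finite σ] (ha : ∀ i, (a i).constantCoeff = 0)
    (ha' : ∀ i, a i ∈ intS R τ) {f g : MvPowerSeries σ K} (h : Cg R c f g) :
    Cg R c (MvPowerSeries.subst a f) (MvPowerSeries.subst a g) := by
  obtain ⟨u, hu, rfl⟩ := h
  have hs := MvPowerSeries.hasSubst_of_constantCoeff_zero ha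
  exact ⟨_, subst_mem_intS ha ha' hu, by rw [MvPowerSeries.subst_add hs, subst_C_mul hs]⟩

theorem subst_polyHom {a : σ → MvPowerSeries τ K} (ha : MvPowerSeries.HasSubst a)
    (q : MvPolynomial σ R) :
    MvPowerSeries.subst a (polyHom R σ q) = MvPolynomial.eval₂ (MvPowerSeries.C.comp R.subtype) a q := by
  rw [← MvPowerSeries.coe_substAlgHom ha]
  change ((MvPowerSeries.substAlgHom ha).toRingHom.comp (polyHom R σ)) q =
    (MvPolynomial.eval₂Hom (MvPowerSeries.C.comp R.subtype) a) q
  congr 1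
  apply MvPolynomial.ringHom_ext
  · intro r
    simp [polyHom_C, MvPowerSeries.coe_substAlgHom ha, MvPowerSeries.subst_C]
  · intro i
    simp [polyHom_X, MvPowerSeries.coe_substAlgHom ha, MvPowerSeries.subst_X ha]

theorem subst_polyHom_mem {a : σ → MvPowerSeries τ K} (ha : MvPowerSeries.HasSubst a)
    {S : Subring (MvPowerSeries τ K)} (hC : ∀ r ∈ R, MvPowerSeries.C r ∈ S) (haS : ∀ i, a i ∈ S)
    (q : MvPolynomial σ R) : MvPowerSeries.subst a (polyHom R σ q) ∈ S := by
  rw [subst_polyHom ha, MvPolynomial.eval₂_eq]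
  refine sum_mem fun m _ => mul_mem (hC _ (q.coeff m).2) (prod_mem fun i _ => pow_mem (haS i) _)

/-- Modulo c the series f may be replaced by a polynomial, because substituting integral series
preserves congruences; a polynomial in restricted series is restricted. -/
theorem subst_mem_Rst {a : σ → MvPowerSeries τ K} [Finite σ] (ha : ∀ i, (a i).constantCoeff = 0)
    (ha' : ∀ i, a i ∈ Rst R τ) {f : MvPowerSeries σ K} (hf : f ∈ Rst R σ) :
    MvPowerSeries.subst a f ∈ Rst R τ := by
  refine mem_Rst.2 fun c hc => ?_
  obtain ⟨q, hq⟩ := mem_Rst.1 hf c hc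
  refine polyMod_of_cg (hq.subst ha fun i => Rst_le_intS (ha' i)) ?_
  have := subst_polyHom_mem (MvPowerSeries.hasSubst_of_constantCoeff_zero ha)
    (S := Rst R τ) (fun r hr => C_mem_Rst hr) ha' q
  exact mem_Rst.1 this c hc

/-- A series whose coefficients outside a finite set are divisible by `a` is a polynomial
modulo `a`, and the polynomial can be chosen supported on that set. -/
theorem exists_polyHom_eq_of_finite {f : MvPowerSeries σ K} (hf : f ∈ intS R σ)
    (hfin : {m | MvPowerSeries.coeff m f ≠ 0}.Finite) : ∃ q, polyHom R σ q = f := by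
  classical
  refine ⟨∑ m ∈ hfin.toFinset, MvPolynomial.monomial m ⟨_, mem_intS.1 hf m⟩, ?_⟩
  ext n
  rw [coeff_polyHom, MvPolynomial.coeff_sum]
  simp only [MvPolynomial.coeff_monomial]
  rw [Finset.sum_ite_eq']
  split_ifs with h
  · rfl
  · simp at h; simp [h]

theorem finite_coeff_polyHom (q : MvPolynomial σ R) :
    {m | MvPowerSeries.coeff m (polyHom R σ q) ≠ 0}.Finite := by
  refine (q.support.finite_toSet).subset fun m hm => ?_
  rw [Set.mem_ofPred_eq, coeff_polyHom] at hm
  simp at hm ⊢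
  exact fun h => hm h

/-- Being a polynomial modulo a is a finiteness condition on the terms not divisible by a, which are
exactly those a truncation keeps. -/
theorem mem_polyMod_iff {a : R} {f : MvPowerSeries σ K} : f ∈ polyMod a ↔
    f ∈ intS R σ ∧ {m | ¬ ∃ y ∈ R, MvPowerSeries.coeff m f = a * y}.Finite := by
  classical
  constructor
  · intro hf
    refine ⟨polyMod_le_intS a hf, ?_⟩
    obtain ⟨q, hq⟩ := hf
    refine (finite_coeff_polyHom q).subset fun m hm h0 => hm ?_
    obtain ⟨y, hy, h⟩ := cg_iff.1 hq m
    exact ⟨y, hy, by rw [h, h0, zero_add]⟩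
  · rintro ⟨hf, hfin⟩
    set g : MvPowerSeries σ K := fun m =>
      if ∃ y ∈ R, MvPowerSeries.coeff m f = a * y then 0 else MvPowerSeries.coeff m f with hg
    have hgc (m) : MvPowerSeries.coeff m g =
      if ∃ y ∈ R, MvPowerSeries.coeff m f = a * y then 0 else MvPowerSeries.coeff m f := rfl
    have hgi : g ∈ intS R σ := mem_intS.2 fun m => by
      rw [hgc]; split_ifs
      · exact zero_mem _
      · exact mem_intS.1 hf m
    obtain ⟨q, hq⟩ := exists_polyHom_eq_of_finite hgi (hfin.subset fun m hm h => hm (by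
      rw [hgc, if_pos h]))
    refine ⟨q, cg_iff.2 fun m => ?_⟩
    rw [hq, hgc]
    split_ifs with h
    · simpa using h
    · exact ⟨0, zero_mem _, by simp⟩

end Restricted

/-! ### The logarithm with its multiplicative constant divided out. -/

section Rescale

variable {K : Type*} [Field K] [CharZero K] {σ : Type*}

theorem subst_C_mul_eq_rescale (g : PowerSeries K) (a : K) {f : MvPowerSeries σ K}
    (hf : f.constantCoeff = 0) :
    g.subst (MvPowerSeries.C a * f) = (PowerSeries.rescale a g).subst f := by
  have hs := hasSubst_of_constantCoeff hf
  rw [PowerSeries.rescale_eq_subst, PowerSeries.subst_comp_subst_apply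
    (PowerSeries.HasSubst.smul_X' a) hs, PowerSeries.subst_smul hs, PowerSeries.subst_X hs,
    MvPowerSeries.smul_eq_C_mul]

/-- The series `log (1 + a t) / a`. -/
def logSeries (a : K) : PowerSeries K :=
  PowerSeries.mk fun n => if n = 0 then 0 else (-1) ^ (n + 1) * a ^ (n - 1) / n

theorem log_subst_C_mul (a : K) {f : MvPowerSeries σ K} (hf : f.constantCoeff = 0) :
    (PowerSeries.log K).subst (MvPowerSeries.C a * f) =
      MvPowerSeries.C a * (logSeries a).subst f := by
  rw [subst_C_mul_eq_rescale _ _ hf]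
  have : PowerSeries.rescale a (PowerSeries.log K) = PowerSeries.C a * logSeries a := by
    ext n
    rw [PowerSeries.coeff_rescale, PowerSeries.coeff_C_mul, PowerSeries.coeff_log, logSeries,
      PowerSeries.coeff_mk]
    rcases n with _ | n
    · simp
    · simp only [Nat.add_eq_zero_iff, one_ne_zero, and_false, if_false, Nat.add_sub_cancel]
      rw [eq_ratCast]; push_cast; rw [pow_succ]; ring
  rw [this, PowerSeries.subst_mul (hasSubst_of_constantCoeff hf), PowerSeries.subst_C]

end Rescale

/-! ### The same notions in one variable, in terms of coefficients indexed by ℕ. -/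

section Univariate

variable {K : Type*} [Field K] {R : Subring K}

theorem mem_intS_powerSeries {f : PowerSeries K} :
    f ∈ intS R Unit ↔ ∀ n, PowerSeries.coeff n f ∈ R := by
  rw [mem_intS]
  constructor
  · intro h n; exact h _
  · intro h m
    have := h (m ())
    rwa [PowerSeries.coeff_def (s := m) rfl] at this

theorem cg_powerSeries {a : K} {f g : PowerSeries K} :
    Cg R a f g ↔ ∀ n, ∃ y ∈ R, PowerSeries.coeff n f = PowerSeries.coeff n g + a * y := by
  rw [cg_iff]
  constructor
  · intro h n; exact h _
  · intro h m
    have := h (m ())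
    rwa [PowerSeries.coeff_def (s := m) rfl] at this

theorem mem_polyMod_powerSeries {a : R} {f : PowerSeries K} :
    f ∈ polyMod (σ := Unit) a ↔ f ∈ intS R Unit ∧
      ∃ N, ∀ n, N ≤ n → ∃ y ∈ R, PowerSeries.coeff n f = a * y := by
  rw [mem_polyMod_iff]
  refine and_congr_right fun _ => ?_
  have hinj : Function.Injective fun n : ℕ => (Finsupp.single () n : Unit →₀ ℕ) :=
    Finsupp.single_injective ()
  constructor
  · intro h
    have h2 := h.preimage hinj.injOn
    obtain ⟨N, hN⟩ := h2.bddAbove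
    refine ⟨N + 1, fun n hn => ?_⟩
    by_contra hcon
    have := hN (show n ∈ _ from hcon)
    omega
  · rintro ⟨N, hN⟩
    refine ((Set.finite_lt_nat N).image fun n : ℕ => (Finsupp.single () n : Unit →₀ ℕ)).subset ?_
    intro m hm
    refine ⟨m (), ?_, by ext; simp⟩
    by_contra hcon
    apply hm
    obtain ⟨y, hy, h⟩ := hN (m ()) (not_lt.1 hcon)
    rw [PowerSeries.coeff_def (s := m) rfl] at h
    exact ⟨y, hy, h⟩

theorem mem_Rst_powerSeries {f : PowerSeries K} :
    f ∈ Rst R Unit ↔ f ∈ intS R Unit ∧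
      ∀ a ∈ R, a ≠ 0 → ∃ N, ∀ n, N ≤ n → ∃ y ∈ R, PowerSeries.coeff n f = a * y := by
  rw [mem_Rst]
  constructor
  · intro h
    exact ⟨polyMod_le_intS 1 (h 1 one_ne_zero), fun a ha h0 =>
      (mem_polyMod_powerSeries.1 (h ⟨a, ha⟩ (by simpa using h0))).2⟩
  · rintro ⟨h1, h2⟩ a ha
    exact mem_polyMod_powerSeries.2 ⟨h1, h2 a a.2 (by simpa using ha)⟩

end Univariate

/-! ### Restricted series over ℤ_(p)[ζ]: inverses, logarithms and p-th roots. -/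

section BaseSeries

variable {K : Type*} [Field K] [CharZero K] {p s : ℕ} [hp : Fact p.Prime] {ζ : K} {σ τ : Type*}

theorem add_pow_prime {A : Type*} [CommRing A] (S : Subring A) {x y : A} (hx : x ∈ S) (hy : y ∈ S) :
    ∃ r ∈ S, (x + y) ^ p = x ^ p + y ^ p + p * x * y * r := by
  obtain ⟨r, hr⟩ := exists_add_pow_prime_eq hp.out (⟨x, hx⟩ : S) ⟨y, hy⟩
  exact ⟨r, r.2, by simpa using congrArg S.subtype hr⟩

theorem natCast_mul_C (f : MvPowerSeries σ K) (n : ℕ) :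
    (n : MvPowerSeries σ K) = MvPowerSeries.C (n : K) := by simp

variable [IsCyclotomicExtension {p ^ s} ℚ K]

theorem pi_mul_ne_one (hs : 1 ≤ s) (hζ : IsPrimitiveRoot ζ (p ^ s)) {y : K}
    (hy : y ∈ baseRing p ζ) : (ζ - 1) * y ≠ 1 := by
  intro h1
  have h2 := nu_one (K := K) hζ
  have h3 := right_ne_zero_of_mul (h1.trans_ne one_ne_zero)
  rw [← h1, nu_mul hζ (pi_ne_zero hs hζ) h3] at h2
  have := nu_nonneg_of_mem hζ hy
  have := nu_pi_pos hs hζ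
  linarith

/-- `1 + π y` is invertible. -/
theorem inv_mem_of_eq_add (hs : 1 ≤ s) (hζ : IsPrimitiveRoot ζ (p ^ s)) {w u y : K}
    (hw : w ∈ baseRing p ζ) (hu : u ∈ baseRing p ζ) (hu0 : u ≠ 0) (hu' : u⁻¹ ∈ baseRing p ζ)
    (hy : y ∈ baseRing p ζ) (h : w = u + (ζ - 1) * y) : w ≠ 0 ∧ w⁻¹ ∈ baseRing p ζ := by
  refine (mem_pi_or_inv_mem hs hζ hw).resolve_left ?_
  rintro ⟨z, hz, hwz⟩
  refine pi_mul_ne_one hs hζ (mul_mem (sub_mem hz hy) hu') ?_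
  have : (ζ - 1) * (z - y) = u := by linear_combination h - hwz
  rw [← mul_assoc, this, mul_inv_cancel₀ hu0]

/-- `λ^p = p λ w'` with `w' ≡ -1` modulo `π`. -/
theorem exists_lam_pow_eq (hs : 1 ≤ s) (hζ : IsPrimitiveRoot ζ (p ^ s)) :
    ∃ y ∈ baseRing p ζ, lam p s ζ ^ p = p * lam p s ζ * (-1 + (ζ - 1) * y) := by
  obtain ⟨w, hw, hpw, y, hy, hwy⟩ := exists_natCast_prime_eq hs hζ
  obtain ⟨hw0, hwi⟩ := inv_mem_of_eq_add hs hζ hw (neg_mem (one_mem _)) (by simp)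
    (by simp) hy hwy
  refine ⟨y * w⁻¹, mul_mem hy hwi, ?_⟩
  have h2 : lam p s ζ ^ p = lam p s ζ ^ (p - 1) * lam p s ζ := by
    rw [← pow_succ, Nat.sub_add_cancel hp.out.one_lt.le]
  have h3 : -1 + (ζ - 1) * (y * w⁻¹) = w⁻¹ := by
    field_simp; linear_combination -hwy
  rw [h3, h2, hpw]; field_simp

theorem exists_pi_pow_eq_mul (hs : 1 ≤ s) (hζ : IsPrimitiveRoot ζ (p ^ s)) {a : K}
    (ha : a ∈ baseRing p ζ) (ha0 : a ≠ 0) :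
    ∃ N : ℕ, ∃ y ∈ baseRing p ζ, (ζ - 1) ^ N = a * y := by
  obtain ⟨k, u, hu, hu0, hu', rfl⟩ := exists_eq_pi_pow_mul hs hζ ha ha0
  exact ⟨k, u⁻¹, hu', by field_simp⟩

/-- Given a ≠ 0, some π^N is divisible by a. As 1 - f is divisible by π, the first N terms of the
geometric series in 1 - f compute the inverse modulo a. -/
theorem inv_mem_Rst (hs : 1 ≤ s) (hζ : IsPrimitiveRoot ζ (p ^ s)) {f : MvPowerSeries σ K}
    (hf : f ∈ Rst (baseRing p ζ) σ) (h0 : f.constantCoeff = 1)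
    (h1 : Cg (baseRing p ζ) (ζ - 1) f 1) : f⁻¹ ∈ Rst (baseRing p ζ) σ := by
  refine mem_Rst.2 fun a ha => ?_
  obtain ⟨N, y, hy, hN⟩ := exists_pi_pow_eq_mul hs hζ a.2 (by simpa using ha)
  have hfi := inv_mem_intS (Rst_le_intS hf) h0
  have hS : ∑ k ∈ Finset.range N, (1 - f) ^ k ∈ Rst (baseRing p ζ) σ :=
    sum_mem fun k _ => pow_mem (sub_mem (one_mem _) hf) k
  refine polyMod_of_cg ?_ (mem_Rst.1 hS a ha)
  obtain ⟨u, hu, hfu⟩ := h1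
  refine ⟨MvPowerSeries.C y * (-u) ^ N * f⁻¹, mul_mem (mul_mem (C_mem_intS hy)
    (pow_mem (neg_mem hu) N)) hfi, ?_⟩
  have h2 := mul_neg_geom_sum (1 - f) N
  have hff : f * f⁻¹ = 1 := MvPowerSeries.mul_inv_cancel f (by rw [h0]; exact one_ne_zero)
  have h3 : (1 - f) ^ N = MvPowerSeries.C (a : K) * MvPowerSeries.C y * (-u) ^ N := by
    rw [hfu, ← map_mul, ← hN, map_pow, ← mul_pow]; congr 1; ring
  rw [sub_sub_cancel, h3] at h2
  linear_combination (-f⁻¹) * h2 + (∑ k ∈ Finset.range N, (1 - f) ^ k) * hff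

theorem prime_pow_div_natCast_mem (hs : 1 ≤ s) (hζ : IsPrimitiveRoot ζ (p ^ s)) {n : ℕ}
    (hn : n ≠ 0) : (p : K) ^ (n - 1) / (n : K) ∈ baseRing p ζ := by
  have hp0 : (p : K) ≠ 0 := Nat.cast_ne_zero.2 hp.out.ne_zero
  have hn0 : (n : K) ≠ 0 := Nat.cast_ne_zero.2 hn
  rw [mem_baseRing_iff hs hζ (div_ne_zero (pow_ne_zero _ hp0) hn0), div_eq_mul_inv,
    nu_mul hζ (pow_ne_zero _ hp0) (inv_ne_zero hn0), nu_pow hζ hp0, nu_prime hζ, nu_inv hζ hn0,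
    nu_natCast hζ hn]
  have h1 : padicValNat p n < n := (Nat.lt_pow_self hp.out.one_lt).trans_le
    (Nat.le_of_dvd (Nat.pos_of_ne_zero hn) pow_padicValNat_dvd)
  have : (padicValNat p n : ℚ) ≤ (n - 1 : ℕ) := by exact_mod_cast (by omega)
  linarith

/-- Powers of a multiple of `π` are eventually divisible by any nonzero element. -/
theorem exists_forall_pow_eq_mul (hs : 1 ≤ s) (hζ : IsPrimitiveRoot ζ (p ^ s)) {a c : K}
    (ha : a ∈ baseRing p ζ) (ha0 : a ≠ 0) (hc : c ∈ baseRing p ζ) :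
    ∃ N : ℕ, ∀ n, N ≤ n → ∃ y ∈ baseRing p ζ, ((ζ - 1) * c) ^ n = a * y := by
  obtain ⟨N, y, hy, hN⟩ := exists_pi_pow_eq_mul hs hζ ha ha0
  refine ⟨N, fun n hn => ?_⟩
  obtain ⟨k, rfl⟩ := Nat.exists_eq_add_of_le hn
  refine ⟨y * c ^ N * ((ζ - 1) * c) ^ k, mul_mem (mul_mem hy (pow_mem hc _))
    (pow_mem (mul_mem pi_mem hc) _), ?_⟩
  rw [pow_add, mul_pow, hN]; ring

/-- The series `log (1 + pλ t) / (pλ)` is restricted. -/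
theorem logSeries_mem_Rst (hs : 1 ≤ s) (hζ : IsPrimitiveRoot ζ (p ^ s)) {c : K}
    (hc : c ∈ baseRing p ζ) : logSeries (p * ((ζ - 1) * c)) ∈ Rst (baseRing p ζ) Unit := by
  -- The factor p^{n-1} absorbs the denominator n, since v_p(n) ≤ n - 1. What remains is (πc)^{n-1},
  -- which tends to 0.
  have hco (n : ℕ) (hn : n ≠ 0) : (-1) ^ (n + 1) * ((p : K) * ((ζ - 1) * c)) ^ (n - 1) / (n : K) =
      ((ζ - 1) * c) ^ (n - 1) * ((-1) ^ (n + 1) * ((p : K) ^ (n - 1) / (n : K))) := by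
    rw [mul_pow]; ring
  have hm (n : ℕ) (hn : n ≠ 0) :
      (-1) ^ (n + 1) * ((p : K) ^ (n - 1) / (n : K)) ∈ baseRing p ζ :=
    mul_mem (pow_mem (neg_mem (one_mem _)) _) (prime_pow_div_natCast_mem hs hζ hn)
  refine mem_Rst_powerSeries.2 ⟨mem_intS_powerSeries.2 fun n => ?_, ?_⟩
  · rw [logSeries, PowerSeries.coeff_mk]
    split_ifs with hn
    · exact zero_mem _
    · rw [hco n hn]
      exact mul_mem (pow_mem (mul_mem pi_mem hc) _) (hm n hn)
  · intro a ha ha0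
    obtain ⟨N, hN⟩ := exists_forall_pow_eq_mul hs hζ ha ha0 hc
    refine ⟨N + 1, fun n hn => ?_⟩
    obtain ⟨y, hy, h⟩ := hN (n - 1) (by omega)
    have hn0 : n ≠ 0 := by omega
    refine ⟨y * _, mul_mem hy (hm n hn0), ?_⟩
    rw [logSeries, PowerSeries.coeff_mk, if_neg hn0, hco n hn0, h, mul_assoc]

/-- A series whose `p`-th power is a polynomial modulo `π` is a polynomial modulo `π`. -/
theorem mem_polyMod_pi_of_pow (hs : 1 ≤ s) (hζ : IsPrimitiveRoot ζ (p ^ s)) {g : MvPowerSeries σ K}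
    (hg : g ∈ intS (baseRing p ζ) σ) (h : g ^ p ∈ polyMod (unif p ζ)) :
    g ∈ polyMod (unif p ζ) := by
  obtain ⟨G, rfl⟩ := hg
  let I := Ideal.span {unif p ζ}
  let q := Ideal.Quotient.mk I
  have hqp : (p : baseRing p ζ ⧸ I) = 0 := by
    obtain ⟨y, hy, h⟩ := exists_natCast_prime_eq_pi_mul hs hζ
    rw [← map_natCast q, Ideal.Quotient.eq_zero_iff_mem, Ideal.mem_span_singleton]
    exact ⟨⟨y, hy⟩, by ext; simpa [coe_unif] using h⟩
  have hunit (x : baseRing p ζ) : q x = 0 ∨ IsUnit (q x) := by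
    rcases mem_pi_or_inv_mem hs hζ x.2 with ⟨y, hy, h⟩ | ⟨h, h'⟩
    · left
      rw [Ideal.Quotient.eq_zero_iff_mem, Ideal.mem_span_singleton]
      exact ⟨⟨y, hy⟩, by ext; simpa [coe_unif] using h⟩
    · right
      exact (IsUnit.of_mul_eq_one ⟨(x : K)⁻¹, h'⟩ (by ext; simp [h])).map q
  have hnt : Nontrivial (baseRing p ζ ⧸ I) := by
    rw [Ideal.Quotient.nontrivial_iff, Ne, Ideal.span_singleton_eq_top]
    intro hu
    obtain ⟨v, hv⟩ := hu.exists_right_inv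
    exact pi_mul_ne_one hs hζ v.2 (congrArg (baseRing p ζ).subtype hv)
  have hchar : CharP (baseRing p ζ ⧸ I) p := ringChar.of_eq (CharP.ringChar_of_prime_eq_zero hp.out hqp)
  have : ExpChar (baseRing p ζ ⧸ I) p := ExpChar.prime hp.out
  have hq0 (x : baseRing p ζ) : q x = 0 ↔ ∃ y ∈ baseRing p ζ, (x : K) = (ζ - 1) * y := by
    rw [Ideal.Quotient.eq_zero_iff_mem, Ideal.mem_span_singleton]
    constructor
    · rintro ⟨y, rfl⟩; exact ⟨y, y.2, by simp [coe_unif]⟩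
    · rintro ⟨y, hy, h⟩; exact ⟨⟨y, hy⟩, by ext; simpa [coe_unif] using h⟩
  rw [mem_polyMod_iff] at h ⊢
  refine ⟨⟨G, rfl⟩, ?_⟩
  have hinj : Function.Injective fun m : σ →₀ ℕ => p • m := fun m n hmn => by
    ext i
    have := DFunLike.congr_fun hmn i
    simpa [hp.out.ne_zero] using this
  refine (h.2.preimage hinj.injOn).subset fun m hm hcon => hm ?_
  rw [← map_pow, MvPowerSeries.coeff_map] at hcon
  rw [MvPowerSeries.coeff_map]
  refine (hq0 _).1 ?_
  have h1 := (hq0 _).2 hcon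
  have h2 : q (MvPowerSeries.coeff (p • m) (G ^ p)) =
      MvPowerSeries.coeff (p • m) (MvPowerSeries.map q G ^ p) := by
    rw [← map_pow, MvPowerSeries.coeff_map]
  -- In characteristic p the coefficient of g^p at pm is the p-th power of the coefficient of g at
  -- m. Modulo π every scalar is zero or a unit, so if the former vanishes the latter does too.
  rw [h2, ← MvPowerSeries.map_frobenius_expand p hp.out.ne_zero, MvPowerSeries.coeff_map,
    MvPowerSeries.coeff_expand_smul, MvPowerSeries.coeff_map, frobenius_def] at h1
  rcases hunit (MvPowerSeries.coeff m G) with h3 | h3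
  · exact h3
  · exact absurd h1 (h3.pow p).ne_zero

/-- If `V^p` is a polynomial modulo `pλ`, then `V` is a polynomial modulo `λ`. -/
theorem mem_polyMod_lam_of_pow (hs : 1 ≤ s) (hζ : IsPrimitiveRoot ζ (p ^ s))
    {V : MvPowerSeries σ K} (hV : V ∈ intS (baseRing p ζ) σ)
    (h : V ^ p ∈ polyMod (p * ⟨lam p s ζ, lam_mem s⟩ : baseRing p ζ)) :
    V ∈ polyMod (⟨lam p s ζ, lam_mem s⟩ : baseRing p ζ) := by
  set R := baseRing p ζ
  obtain ⟨e, u, hu, hu0, hu', he⟩ := exists_eq_pi_pow_mul hs hζ (lam_mem (p := p) s)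
    (lam_ne_zero hs hζ)
  obtain ⟨w, hw, hpw, -⟩ := exists_natCast_prime_eq hs hζ
  have hπ0 := pi_ne_zero hs hζ
  have hunif0 : unif p ζ ≠ 0 := fun h => hπ0 (congrArg R.subtype h)
  -- Here λ is π^e times a unit, and precision is gained one power of π at a time. From V = f + π^j
  -- g one gets V^p = f^p + π^{jp} g^p plus a multiple of pπ^j; this cross term and pλ are divisible
  -- by π^{jp+1}. So g^p is a polynomial modulo π, hence g is, and its polynomial corrects f.
  suffices hj : ∀ j ≤ e, V ∈ polyMod (unif p ζ ^ j) by
    obtain ⟨q, hq⟩ := hj e le_rfl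
    refine ⟨q, ?_⟩
    have h1 : ((unif p ζ ^ e : R) : K) = lam p s ζ * u⁻¹ := by
      rw [he, mul_inv_cancel_right₀ hu0]; rfl
    rw [h1] at hq
    exact hq.of_mul hu'
  intro j
  induction j with
  | zero => intro _; rw [pow_zero]; exact ⟨0, V, hV, by simp⟩
  | succ j ih =>
    intro hj
    obtain ⟨f, g, hg, hVf⟩ := ih (by omega)
    have hcu : ((unif p ζ ^ j : R) : K) = (ζ - 1) ^ j := rfl
    rw [hcu] at hVf
    obtain ⟨r, hr, hVp⟩ := add_pow_prime (p := p) (intS R σ) (polyHom_mem f)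
      (mul_mem (C_mem_intS (pow_mem (pi_mem (p := p) (ζ := ζ)) j)) hg)
    rw [← hVf] at hVp
    have hdiv : ∃ t ∈ R, (p : K) * (ζ - 1) ^ j = (ζ - 1) ^ (j * p) * (ζ - 1) * t := by
      have h1 : lam p s ζ = (ζ - 1) ^ (j + 1) * ((ζ - 1) ^ (e - (j + 1)) * u) := by
        rw [← mul_assoc, ← pow_add, he]; congr 2; omega
      -- As j + 1 ≤ e, p is divisible by π^{(j+1)(p-1)}, and (j+1)(p-1) + j = jp + 1 + (p-2).
      obtain ⟨m, hm⟩ : ∃ m, p = m + 2 := ⟨p - 2, by have := hp.out.two_le; omega⟩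
      refine ⟨(ζ - 1) ^ m * ((ζ - 1) ^ (e - (j + 1)) * u) ^ (p - 1) * w, mul_mem (mul_mem
        (pow_mem pi_mem _) (pow_mem (mul_mem (pow_mem pi_mem _) hu) _)) hw, ?_⟩
      rw [hpw, h1, mul_pow, ← pow_mul]
      have h2 : (ζ - 1) ^ ((j + 1) * (p - 1)) * (ζ - 1) ^ j =
          (ζ - 1) ^ (j * p) * (ζ - 1) * (ζ - 1) ^ m := by
        rw [← pow_add, ← pow_succ, ← pow_add]; congr 1
        rw [hm]; simp; ring
      linear_combination (((ζ - 1) ^ (e - (j + 1)) * u) ^ (p - 1) * w) * h2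
    obtain ⟨t, ht, hpt⟩ := hdiv
    have hpow : ((unif p ζ ^ (j * p) : R) : K) = (ζ - 1) ^ (j * p) := rfl
    have key : MvPowerSeries.C ((unif p ζ ^ (j * p) : R) : K) * g ^ p ∈
        polyMod (unif p ζ ^ (j * p) * unif p ζ) := by
      have h1 : Cg R ((unif p ζ ^ (j * p) * unif p ζ : R) : K)
          (MvPowerSeries.C ((unif p ζ ^ (j * p) : R) : K) * g ^ p) (V ^ p - polyHom R σ (f ^ p)) := by
        refine ⟨-(MvPowerSeries.C t * polyHom R σ f * g * r), neg_mem (mul_mem (mul_mem (mul_mem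
          (C_mem_intS ht) (polyHom_mem f)) hg) hr), ?_⟩
        have h3 : (p : MvPowerSeries σ K) * MvPowerSeries.C ((ζ - 1) ^ j) =
            MvPowerSeries.C ((ζ - 1) ^ (j * p) * (ζ - 1)) * MvPowerSeries.C t := by
          rw [natCast_mul_C g, ← map_mul, hpt, map_mul]
        have h4 : ((unif p ζ ^ (j * p) * unif p ζ : R) : K) = (ζ - 1) ^ (j * p) * (ζ - 1) := rfl
        have h5 : (MvPowerSeries.C ((ζ - 1) ^ j) : MvPowerSeries σ K) ^ p =
              MvPowerSeries.C ((ζ - 1) ^ (j * p)) := by rw [← map_pow, ← pow_mul]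
        rw [h4, hpow, hVp, map_pow (polyHom R σ), mul_pow, h5]
        linear_combination (-polyHom R σ f * g * r) * h3
      refine polyMod_of_cg h1 (sub_mem ?_ (polyHom_mem_polyMod _ _))
      obtain ⟨q, hq⟩ := h
      refine ⟨q, ?_⟩
      have h5 : (((p : R) * ⟨lam p s ζ, lam_mem s⟩ : R) : K) =
          ((unif p ζ ^ (j * p) * unif p ζ : R) : K) * (t * ((ζ - 1) ^ (e - j) * u)) := by
        have h6 : ((unif p ζ ^ (j * p) * unif p ζ : R) : K) = (ζ - 1) ^ (j * p) * (ζ - 1) := rfl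
        have h7 : lam p s ζ = (ζ - 1) ^ j * ((ζ - 1) ^ (e - j) * u) := by
          rw [← mul_assoc, ← pow_add, he]; congr 2; omega
        rw [h6]
        change (p : K) * lam p s ζ = _
        rw [h7]
        linear_combination ((ζ - 1) ^ (e - j) * u) * hpt
      rw [h5] at hq
      exact hq.of_mul (mul_mem ht (mul_mem (pow_mem pi_mem _) hu))
    have hgp := mem_polyMod_of_C_mul_mem (pow_ne_zero _ hunif0) (pow_mem hg p) key
    obtain ⟨q, g', hg', hgq⟩ := mem_polyMod_pi_of_pow hs hζ hg hgp
    refine ⟨f + MvPolynomial.C (unif p ζ ^ j) * q, g', hg', ?_⟩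
    rw [hVf, hgq, map_add, map_mul, polyHom_C, pow_succ]
    simp only [Subring.coe_mul, map_mul, hcu]
    ring

end BaseSeries

/-! ### Integrality of power series by Dwork's criterion. -/

section Dwork

variable {p : ℕ} [hp : Fact p.Prime]

/-- Dwork's integrality criterion. -/
theorem exists_padicInt_coeff_eq {f e : PowerSeries ℚ_[p]} (hf0 : PowerSeries.constantCoeff f = 1)
    (he0 : PowerSeries.constantCoeff e = 1)
    (he : ∀ n, n ≠ 0 → ∃ y : ℤ_[p], PowerSeries.coeff n e = p * y)
    (h : f ^ p = PowerSeries.expand p hp.out.ne_zero f * e) (n : ℕ) :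
    ∃ y : ℤ_[p], PowerSeries.coeff n f = y := by
  induction n using Nat.strong_induction_on with
  | _ n ih =>
  rcases eq_or_ne n 0 with rfl | hn
  · exact ⟨1, by simpa using hf0⟩
  have hp0 := hp.out.ne_zero
  have hpQ : (p : ℚ_[p]) ≠ 0 := Nat.cast_ne_zero.2 hp0
  choose! a ha using ih
  let φ : ℤ_[p] →+* ℚ_[p] := PadicInt.Coe.ringHom
  have hφ (y : ℤ_[p]) : φ y = y := rfl
  -- Induction on the degree: g is the part of f of degree less than n, already integral. Comparing
  -- coefficients of degree n in f^p = f(t^p)e will isolate p times the coefficient sought.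
  set g : Polynomial ℤ_[p] := ∑ i ∈ Finset.range n, Polynomial.monomial i (a i) with hg
  have hgc (i : ℕ) : g.coeff i = if i < n then a i else 0 := by
    simp [hg, Polynomial.finsetSum_coeff, Polynomial.coeff_monomial]
  set G : PowerSeries ℚ_[p] := ((g.map φ : Polynomial ℚ_[p]) : PowerSeries ℚ_[p]) with hG
  have hGc (i : ℕ) (hi : i < n) : PowerSeries.coeff i G = PowerSeries.coeff i f := by
    rw [hG, Polynomial.coeff_coe, Polynomial.coeff_map, hgc, if_pos hi, hφ, ha i hi]
  obtain ⟨w, hw⟩ : PowerSeries.X ^ n ∣ f - G := by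
    rw [PowerSeries.X_pow_dvd_iff]
    intro m hm
    rw [map_sub, hGc m hm, sub_self]
  have hf : f = G + PowerSeries.X ^ n * w := by rw [← hw]; ring
  have hGn : PowerSeries.coeff n G = 0 := by
    rw [hG, Polynomial.coeff_coe, Polynomial.coeff_map, hgc, if_neg (lt_irrefl n), map_zero]
  have hwn : PowerSeries.constantCoeff w = PowerSeries.coeff n f := by
    rw [hf, map_add, hGn, PowerSeries.coeff_X_pow_mul']; simp
  have hG0 : PowerSeries.constantCoeff G = 1 := by
    rw [← hf0, ← PowerSeries.coeff_zero_eq_constantCoeff_apply,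
      ← PowerSeries.coeff_zero_eq_constantCoeff_apply, hGc 0 (Nat.pos_of_ne_zero hn)]
  have hL : PowerSeries.coeff n (f ^ p) =
      PowerSeries.coeff n (G ^ p) + p * PowerSeries.coeff n f := by
    obtain ⟨k, hk⟩ := Polynomial.powAddExpansion G (PowerSeries.X ^ n * w) p
    have h1 : f ^ p = G ^ p + PowerSeries.X ^ n * (PowerSeries.C (p : ℚ_[p]) * G ^ (p - 1) * w +
        PowerSeries.X ^ n * k * w ^ 2) := by
      rw [hf, hk, map_natCast]; ring
    have h2 : PowerSeries.constantCoeff (PowerSeries.X ^ n : PowerSeries ℚ_[p]) = 0 := by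
      simp [hn]
    rw [h1, map_add, PowerSeries.coeff_X_pow_mul', if_pos le_rfl, Nat.sub_self,
      PowerSeries.coeff_zero_eq_constantCoeff_apply]
    simp only [map_add, map_mul, map_pow, hG0, hwn, h2]
    simp
  -- In degree n the series f(t^p) sees only coefficients of index at most n/p < n, so f may be
  -- replaced by g; and g(t^p) ≡ g^p mod p by Frobenius over the residue field.
  have hexp : ∃ y : ℤ_[p], PowerSeries.coeff n (PowerSeries.expand p hp0 f) -
      PowerSeries.coeff n (G ^ p) = p * y := by
    have h1 : PowerSeries.coeff n (PowerSeries.expand p hp0 f) = φ ((Polynomial.expand _ p g).coeff n) := by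
      rw [PowerSeries.coeff_expand, Polynomial.coeff_expand hp.out.pos]
      split_ifs with hd
      · have hlt : n / p < n := Nat.div_lt_self (Nat.pos_of_ne_zero hn) hp.out.one_lt
        rw [hgc, if_pos hlt, hφ, ha _ hlt]
      · simp
    have h2 : PowerSeries.coeff n (G ^ p) = φ ((g ^ p).coeff n) := by
      rw [← Polynomial.coeff_map, ← Polynomial.coeff_coe]; simp [hG]
    have h3 : (Polynomial.expand _ p g - g ^ p).map (PadicInt.toZMod (p := p)) = 0 := by
      rw [Polynomial.map_sub, Polynomial.map_pow, Polynomial.map_expand, ZMod.expand_card, sub_self]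
    have h4 := congrArg (fun q => Polynomial.coeff q n) h3
    simp only [Polynomial.coeff_map, Polynomial.coeff_zero] at h4
    rw [← RingHom.mem_ker, PadicInt.ker_toZMod, PadicInt.maximalIdeal_eq_span_p,
      Ideal.mem_span_singleton] at h4
    obtain ⟨y, hy⟩ := h4
    refine ⟨y, ?_⟩
    rw [h1, h2, ← map_sub, ← Polynomial.coeff_sub, hy, map_mul, map_natCast, hφ]
  have hR : ∃ y : ℤ_[p], PowerSeries.coeff n (PowerSeries.expand p hp0 f * e) -
      PowerSeries.coeff n (PowerSeries.expand p hp0 f) = p * y := by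
    rw [PowerSeries.coeff_mul, Finset.Nat.sum_antidiagonal_eq_sum_range_succ_mk,
      Finset.sum_range_succ, Nat.sub_self, PowerSeries.coeff_zero_eq_constantCoeff_apply, he0,
      mul_one, add_sub_cancel_right]
    have h1 (i) (hi : i ∈ Finset.range n) : ∃ y : ℤ_[p],
        PowerSeries.coeff i (PowerSeries.expand p hp0 f) * PowerSeries.coeff (n - i) e = p * y := by
      rw [Finset.mem_range] at hi
      obtain ⟨y, hy⟩ := he (n - i) (by omega)
      rw [hy, PowerSeries.coeff_expand]
      split_ifs with hd
      · rw [ha _ (lt_of_le_of_lt (Nat.div_le_self _ _) hi)]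
        exact ⟨a (i / p) * y, by push_cast; ring⟩
      · exact ⟨0, by simp⟩
    choose! y hy using h1
    exact ⟨∑ i ∈ Finset.range n, y i, by
      rw [PadicInt.coe_sum, Finset.mul_sum, Finset.sum_congr rfl hy]⟩
  obtain ⟨y, hy⟩ := hexp
  obtain ⟨z, hz⟩ := hR
  rw [← h, hL] at hz
  refine ⟨y + z, mul_left_cancel₀ hpQ ?_⟩
  push_cast
  linear_combination hy + hz

end Dwork

/-! ### Series supported on powers of p, and the Artin-Hasse exponential. -/

section PSer

variable {B : Type*} [CommRing B] {p : ℕ} [hp : Fact p.Prime]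

variable (p) in
/-- The series `∑ u_i t^{p^i}`. -/
def pser (u : ℕ → B) : PowerSeries B :=
  PowerSeries.mk fun n => if p ^ Nat.log p n = n then u (Nat.log p n) else 0

theorem coeff_pser (u : ℕ → B) (n : ℕ) : PowerSeries.coeff n (pser p u) =
    if p ^ Nat.log p n = n then u (Nat.log p n) else 0 := PowerSeries.coeff_mk _ _

theorem constantCoeff_pser (u : ℕ → B) : PowerSeries.constantCoeff (pser p u) = 0 := by
  rw [← PowerSeries.coeff_zero_eq_constantCoeff_apply, coeff_pser]; simp

theorem constantCoeff_pser' (u : ℕ → B) : MvPowerSeries.constantCoeff (pser p u) = 0 :=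
  constantCoeff_pser u

theorem pser_add (u v : ℕ → B) : pser p (u + v) = pser p u + pser p v := by
  ext n; rw [map_add]; simp only [coeff_pser]; split_ifs <;> simp

theorem pser_C_mul (b : B) (u : ℕ → B) :
    pser p (fun i => b * u i) = PowerSeries.C b * pser p u := by
  ext n; rw [PowerSeries.coeff_C_mul]; simp only [coeff_pser]; split_ifs <;> simp

theorem rescale_pser (b : B) (u : ℕ → B) :
    PowerSeries.rescale b (pser p u) = pser p (fun i => b ^ p ^ i * u i) := by
  ext n; rw [PowerSeries.coeff_rescale]; simp only [coeff_pser]; split_ifs with h <;> simp [h]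

theorem map_pser {B' : Type*} [CommRing B'] (f : B →+* B') (u : ℕ → B) :
    PowerSeries.map f (pser p u) = pser p (fun i => f (u i)) := by
  ext n; rw [PowerSeries.coeff_map]; simp only [coeff_pser]; split_ifs <;> simp

theorem sum_C_mul_X_pow_eq_pser (m : ℕ) (u : ℕ → B) :
    (∑ i ∈ Finset.range m, PowerSeries.C (u i) * PowerSeries.X ^ p ^ i : PowerSeries B) =
      pser p (fun i => if i < m then u i else 0) := by
  ext n
  rw [map_sum, coeff_pser]
  simp only [PowerSeries.coeff_C_mul, PowerSeries.coeff_X_pow]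
  split_ifs with h1 h2
  · rw [Finset.sum_eq_single_of_mem (Nat.log p n) (Finset.mem_range.2 h2), if_pos h1.symm, mul_one]
    intro i _ hi
    rw [if_neg, mul_zero]
    rintro rfl
    exact hi (Nat.log_pow hp.out.one_lt i).symm
  · refine Finset.sum_eq_zero fun i hi => ?_
    rw [if_neg, mul_zero]
    rintro rfl
    rw [Nat.log_pow hp.out.one_lt] at h2
    exact h2 (Finset.mem_range.1 hi)
  · refine Finset.sum_eq_zero fun i hi => ?_
    rw [if_neg, mul_zero]
    rintro rfl
    rw [Nat.log_pow hp.out.one_lt] at h1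
    exact h1 rfl

theorem expand_pser (u : ℕ → B) : PowerSeries.expand p hp.out.ne_zero (pser p u) =
    pser p (fun i => if i = 0 then 0 else u (i - 1)) := by
  ext n
  rw [PowerSeries.coeff_expand]
  simp only [coeff_pser]
  by_cases hd : p ∣ n
  · obtain ⟨m, rfl⟩ := hd
    rw [if_pos ⟨m, rfl⟩, Nat.mul_div_cancel_left _ hp.out.pos]
    rcases eq_or_ne m 0 with rfl | hm
    · simp
    · rw [mul_comm, Nat.log_mul_base hp.out.one_lt hm, pow_succ]
      simp [hp.out.ne_zero]
  · rw [if_neg hd]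
    split_ifs with h1 h2
    · rfl
    · exact absurd (h1 ▸ dvd_pow_self p h2) hd
    · rfl

variable [Algebra ℚ B]

theorem map_ex {B' : Type*} [CommRing B'] [Algebra ℚ B'] (f : B →+* B') {σ : Type*}
    {g : MvPowerSeries σ B} (hg : g.constantCoeff = 0) :
    MvPowerSeries.map f (ex g) = ex (MvPowerSeries.map f g) := by
  rw [ex, PowerSeries.map_subst (hasSubst_of_constantCoeff hg), PowerSeries.map_exp, ex]

theorem constantCoeff_ex_pser (u : ℕ → B) :
    PowerSeries.constantCoeff (ex (pser p u)) = 1 := constantCoeff_ex (constantCoeff_pser' u)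

theorem ex_pser_add (u v : ℕ → B) : ex (pser p (u + v)) = ex (pser p u) * ex (pser p v) := by
  rw [pser_add]; exact ex_add (constantCoeff_pser' _) (constantCoeff_pser' _)

theorem map_ex_pser {B' : Type*} [CommRing B'] [Algebra ℚ B'] (f : B →+* B') (u : ℕ → B) :
    PowerSeries.map f (ex (pser p u)) = ex (pser p fun i => f (u i)) := by
  rw [← map_pser]; exact map_ex f (constantCoeff_pser' u)

theorem rescale_ex_pser (b : B) (u : ℕ → B) :
    PowerSeries.rescale b (ex (pser p u)) = ex (pser p fun i => b ^ p ^ i * u i) := by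
  rw [← rescale_pser, PowerSeries.rescale_eq_subst, PowerSeries.rescale_eq_subst]
  refine subst_ex' ?_ (constantCoeff_pser' u)
  rw [MvPowerSeries.smul_eq_C_mul, map_mul]
  exact mul_eq_zero_of_right _ PowerSeries.constantCoeff_X

theorem expand_ex_pser (u : ℕ → B) : PowerSeries.expand p hp.out.ne_zero (ex (pser p u)) =
    ex (pser p fun i => if i = 0 then 0 else u (i - 1)) := by
  rw [← expand_pser, PowerSeries.expand_apply, PowerSeries.expand_apply]
  refine subst_ex' ?_ (constantCoeff_pser' u)
  rw [map_pow]
  exact (congrArg (· ^ p) PowerSeries.constantCoeff_X).trans (zero_pow hp.out.ne_zero)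

variable (B p) in
/-- The Artin-Hasse exponential `exp (∑ t^{p^i} / p^i)`. -/
def artinHasse : PowerSeries B := ex (pser p fun i => algebraMap ℚ B (1 / (p : ℚ) ^ i))

theorem map_artinHasse {B' : Type*} [CommRing B'] [Algebra ℚ B'] (f : B →+* B') :
    PowerSeries.map f (artinHasse B p) = artinHasse B' p := by
  rw [artinHasse, map_ex_pser, artinHasse]
  congr 2
  ext i
  exact congrFun (congrArg DFunLike.coe (RingHom.ext_rat (f.comp (algebraMap ℚ B))
    (algebraMap ℚ B'))) _

/-- On logarithms: p ∑ t^{p^i}/p^i - ∑ t^{p^{i+1}}/p^i telescopes to pt. This is the functional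
equation fed into Dwork's criterion. -/
theorem artinHasse_pow : artinHasse B p ^ p =
    PowerSeries.expand p hp.out.ne_zero (artinHasse B p) *
      PowerSeries.rescale (p : B) (PowerSeries.exp B) := by
  have h1 : PowerSeries.rescale (p : B) (PowerSeries.exp B) =
      ex (pser p fun i => if i = 0 then (p : B) else 0) := by
    have h2 : pser p (fun i => if i = 0 then (p : B) else 0) = (p : B) • PowerSeries.X := by
      have := sum_C_mul_X_pow_eq_pser (p := p) 1 (fun i => (p : B))
      simp only [Nat.lt_one_iff] at this
      rw [← this, PowerSeries.smul_eq_C_mul]; simp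
    rw [h2, PowerSeries.rescale_eq_subst, ex]
  rw [artinHasse, expand_ex_pser, h1, ← ex_pser_add]
  have h3 := ex_pow (constantCoeff_pser' (p := p) fun i => algebraMap ℚ B (1 / (p : ℚ) ^ i)) p
  refine h3.trans ?_
  congr 1
  have h4 := pser_C_mul (p := p) (p : B) fun i => algebraMap ℚ B (1 / (p : ℚ) ^ i)
  rw [map_natCast] at h4
  refine h4.symm.trans ?_
  congr 1
  ext i
  simp only [Pi.add_apply]
  rw [← map_natCast (algebraMap ℚ B), ← map_mul]
  rcases i with _ | i
  · simp
  · have : (p : ℚ) ≠ 0 := Nat.cast_ne_zero.2 hp.out.ne_zero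
    simp only [Nat.add_eq_zero_iff, one_ne_zero, and_false, if_false, add_zero, Nat.add_sub_cancel]
    congr 1; field_simp; ring

/-- Dwork's criterion applies over ℚ_p with e = exp(pt), whose coefficients p^n/n! with n ≥ 1 are
divisible by p. The coefficients being rational, p-adic integrality says that their denominators are
prime to p. -/
theorem not_dvd_den_coeff_artinHasse (n : ℕ) :
    ¬ p ∣ (PowerSeries.coeff n (artinHasse ℚ p)).den := by
  set q := PowerSeries.coeff n (artinHasse ℚ p) with hq
  have h1 : ∃ y : ℤ_[p], PowerSeries.coeff n (artinHasse ℚ_[p] p) = y := by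
    refine exists_padicInt_coeff_eq (constantCoeff_ex_pser _) ?_ ?_ artinHasse_pow n
    · rw [← PowerSeries.coeff_zero_eq_constantCoeff_apply, PowerSeries.coeff_rescale]; simp
    · intro n hn
      rw [PowerSeries.coeff_rescale, PowerSeries.coeff_exp]
      have hp0 : (p : ℚ) ≠ 0 := Nat.cast_ne_zero.2 hp.out.ne_zero
      set r : ℚ := (p : ℚ) ^ (n - 1) / n.factorial with hr
      have hr0 : r ≠ 0 := div_ne_zero (pow_ne_zero _ hp0) (Nat.cast_ne_zero.2 (Nat.factorial_ne_zero _))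
      have hrn : ‖(r : ℚ_[p])‖ ≤ 1 := by
        rw [Padic.eq_padicNorm, padicNorm.eq_zpow_of_nonzero hr0]
        have h2 : 0 ≤ padicValRat p r := by
          rw [hr, padicValRat.div (pow_ne_zero _ hp0) (Nat.cast_ne_zero.2 (Nat.factorial_ne_zero _)),
            padicValRat.pow, padicValRat.self hp.out.one_lt, padicValRat.of_nat]
          -- Legendre's formula: (p-1) v_p(n!) is n minus the digit sum, which is positive for n ≠
          -- 0, so v_p(n!) ≤ n - 1.
          have h := sub_one_mul_padicValNat_factorial (p := p) n
          have hd : 0 < (p.digits n).sum := by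
            rw [Nat.pos_iff_ne_zero]
            intro h0
            rw [h0, Nat.sub_zero] at h
            exact absurd h (sub_one_mul_padicValNat_factorial_lt_of_ne_zero p hn).ne
          have : padicValNat p n.factorial ≤ n - 1 := by
            have h1 : 1 ≤ p - 1 := by have := hp.out.two_le; omega
            calc padicValNat p n.factorial ≤ (p - 1) * padicValNat p n.factorial :=
                  Nat.le_mul_of_pos_left _ h1
              _ ≤ n - 1 := by rw [h]; omega
          have h5 : ((n - 1 : ℕ) : ℤ) = (n : ℤ) - 1 := by omega
          omega
        have h3 : (p : ℚ) ^ (-padicValRat p r) ≤ 1 :=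
          zpow_le_one_of_nonpos₀ (by exact_mod_cast hp.out.one_lt.le) (by omega)
        exact_mod_cast h3
      refine ⟨⟨r, hrn⟩, ?_⟩
      have : (p : ℚ) ^ n = p * p ^ (n - 1) := by
        rw [← pow_succ']; congr 1; omega
      change _ = (p : ℚ_[p]) * (r : ℚ_[p])
      rw [eq_ratCast, hr]
      have h6 : ((p : ℚ) ^ n * (1 / (n.factorial : ℚ)) : ℚ) = p * (p ^ (n - 1) / n.factorial) := by
        rw [this]; ring
      exact_mod_cast congrArg (Rat.cast (K := ℚ_[p])) h6
  obtain ⟨y, hy⟩ := h1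
  rw [← map_artinHasse (algebraMap ℚ ℚ_[p]), PowerSeries.coeff_map, ← hq, eq_ratCast] at hy
  have h2 : ‖(q : ℚ_[p])‖ ≤ 1 := by rw [hy]; exact y.2
  have h3 := PadicInt.isUnit_den q h2
  rw [PadicInt.isUnit_iff] at h3
  intro hd
  rw [← PadicInt.norm_natCast_lt_one_iff, h3] at hd
  exact lt_irrefl _ hd

theorem coeff_artinHasse_mem {K : Type*} [Field K] [CharZero K] (ζ : K) (n : ℕ) :
    PowerSeries.coeff n (artinHasse K p) ∈ baseRing p ζ := by
  rw [← map_artinHasse (algebraMap ℚ K), PowerSeries.coeff_map, eq_ratCast, Rat.cast_def,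
    div_eq_mul_inv]
  exact mul_mem (intCast_mem _ _) (inv_natCast_mem (not_dvd_den_coeff_artinHasse n))

end PSer

/-! ### Power series depending polynomially on a parameter. -/

section ParamCoeff

variable {K : Type*} [Field K]

/-- The coefficient of the `k`-th power of the parameter. -/
def paramCoeff (k : ℕ) : PowerSeries (Polynomial K) →+ PowerSeries K where
  toFun f := PowerSeries.mk fun n => (PowerSeries.coeff n f).coeff k
  map_zero' := by ext; simp
  map_add' f g := by ext; simp

theorem coeff_paramCoeff (k n : ℕ) (f : PowerSeries (Polynomial K)) :
    PowerSeries.coeff n (paramCoeff k f) = (PowerSeries.coeff n f).coeff k := by simp [paramCoeff]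

theorem paramCoeff_mul (k : ℕ) (f g : PowerSeries (Polynomial K)) :
    paramCoeff k (f * g) = ∑ i ∈ Finset.HasAntidiagonal.antidiagonal k, paramCoeff i.1 f * paramCoeff i.2 g := by
  ext n
  rw [coeff_paramCoeff, PowerSeries.coeff_mul, Polynomial.finsetSum_coeff, map_sum]
  simp_rw [Polynomial.coeff_mul, PowerSeries.coeff_mul, coeff_paramCoeff]
  exact Finset.sum_comm

theorem paramCoeff_pow_eq_zero {g : PowerSeries (Polynomial K)} (hg : paramCoeff 0 g = 0)
    {k d : ℕ} (hkd : k < d) : paramCoeff k (g ^ d) = 0 := by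
  induction d generalizing k with
  | zero => omega
  | succ d ih =>
    rw [pow_succ, paramCoeff_mul]
    refine Finset.sum_eq_zero fun i hi => ?_
    rw [Finset.HasAntidiagonal.mem_antidiagonal] at hi
    rcases Nat.eq_zero_or_pos i.2 with h | h
    · rw [h, hg, mul_zero]
    · rw [ih (by omega), zero_mul]

theorem paramCoeff_pow_mem {S : Subring (PowerSeries K)} {g : PowerSeries (Polynomial K)}
    (hg : ∀ k, paramCoeff k g ∈ S) (d k : ℕ) : paramCoeff k (g ^ d) ∈ S := by
  induction d generalizing k with
  | zero =>
    have : paramCoeff k (g ^ 0) = if k = 0 then 1 else 0 := by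
      ext n
      rw [pow_zero, coeff_paramCoeff, PowerSeries.coeff_one]
      split_ifs with h1 h2 h2 <;> simp [PowerSeries.coeff_one, Polynomial.coeff_one, h1, h2]
    rw [this]; split_ifs
    · exact one_mem _
    · exact zero_mem _
  | succ d ih =>
    rw [pow_succ, paramCoeff_mul]
    exact sum_mem fun i _ => mul_mem (ih _) (hg _)

variable [CharZero K]

/-- Since g is divisible by the parameter, only its powers of exponent d ≤ k reach the k-th power of
the parameter. The coefficient is thus a finite polynomial expression in those of g, so it stays in
any subring containing them and the constants. -/
theorem paramCoeff_ex {g : PowerSeries (Polynomial K)} (hg0 : PowerSeries.constantCoeff g = 0)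
    (hg : paramCoeff 0 g = 0) (k : ℕ) : paramCoeff k (ex g) =
      ∑ d ∈ Finset.range (k + 1), PowerSeries.C (1 / (d.factorial : K)) * paramCoeff k (g ^ d) := by
  ext n
  have hX : PowerSeries.X ∣ g := PowerSeries.X_dvd_iff.2 hg0
  have hs : PowerSeries.HasSubst g := PowerSeries.HasSubst.of_constantCoeff_zero' hg0
  have h1 : PowerSeries.coeff n (ex g) = ∑ᶠ d : ℕ, PowerSeries.coeff d
      (PowerSeries.exp (Polynomial K)) • PowerSeries.coeff n (g ^ d) := PowerSeries.coeff_subst' hs _ _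
  -- The range is chosen to contain both the exponents d ≤ n, beyond which g^d has no term of degree
  -- n, and the exponents d ≤ k of the claim.
  have h2 : (Function.support fun d : ℕ => PowerSeries.coeff d
      (PowerSeries.exp (Polynomial K)) • PowerSeries.coeff n (g ^ d)) ⊆
        (Finset.range (n + 1 + (k + 1)) : Finset ℕ) := by
    intro d hd
    rw [Finset.coe_range, Set.mem_Iio]
    by_contra hcon
    refine hd ?_
    change _ • PowerSeries.coeff n (g ^ d) = 0
    rw [PowerSeries.X_pow_dvd_iff.1 (pow_dvd_pow_of_dvd hX d) n (by omega), smul_zero]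
  rw [coeff_paramCoeff, h1, finsum_eq_sum_of_support_subset _ h2, Polynomial.finsetSum_coeff, map_sum]
  have h3 (d : ℕ) : (PowerSeries.coeff d (PowerSeries.exp (Polynomial K)) •
      PowerSeries.coeff n (g ^ d)).coeff k =
      PowerSeries.coeff n (PowerSeries.C (1 / (d.factorial : K)) * paramCoeff k (g ^ d)) := by
    rw [PowerSeries.coeff_exp, PowerSeries.coeff_C_mul, coeff_paramCoeff, smul_eq_mul,
      Polynomial.algebraMap_apply, Polynomial.coeff_C_mul]
    simp
  simp_rw [h3]
  symm
  refine Finset.sum_subset (Finset.range_mono (by omega)) fun d _ hd => ?_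
  rw [paramCoeff_pow_eq_zero hg (by simpa using hd), mul_zero, map_zero]

theorem paramCoeff_ex_mem {S : Subring (PowerSeries K)} (hS : ∀ a : K, PowerSeries.C a ∈ S)
    {g : PowerSeries (Polynomial K)} (hg0 : PowerSeries.constantCoeff g = 0)
    (hg : paramCoeff 0 g = 0) (hgS : ∀ k, paramCoeff k g ∈ S) (k : ℕ) :
    paramCoeff k (ex g) ∈ S := by
  rw [paramCoeff_ex hg0 hg]
  exact sum_mem fun d _ => mul_mem (hS _) (paramCoeff_pow_mem hgS d k)

end ParamCoeff

/-! ### Integrality in the presence of the parameter. -/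

section IntParam

variable {K : Type*} [Field K]

/-- The power series whose coefficients are polynomials over the subring `R`. -/
def intP (R : Subring K) : Subring (PowerSeries (Polynomial K)) :=
  (PowerSeries.map (Polynomial.mapRingHom R.subtype)).range

variable {R : Subring K}

theorem mem_of_mul_mem_intP {f g : PowerSeries (Polynomial K)} (hg : g ∈ intP R)
    (hg1 : PowerSeries.constantCoeff g = 1) (h : f * g ∈ intP R) : f ∈ intP R := by
  obtain ⟨g', rfl⟩ := hg
  obtain ⟨h', hh⟩ := h
  have hinj : Function.Injective (Polynomial.mapRingHom R.subtype) :=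
    Polynomial.map_injective _ Subtype.val_injective
  have h0 : PowerSeries.constantCoeff g' = ((1 : (Polynomial R)ˣ) : Polynomial R) := by
    apply hinj
    rw [← PowerSeries.coeff_zero_eq_constantCoeff_apply, PowerSeries.coeff_map,
      PowerSeries.coeff_zero_eq_constantCoeff_apply] at hg1
    rw [hg1]; simp
  refine ⟨h' * PowerSeries.invOfUnit g' 1, ?_⟩
  rw [map_mul, hh, mul_assoc, ← map_mul, PowerSeries.mul_invOfUnit g' 1 h0, map_one, mul_one]

theorem map_C_mem_intP {f : PowerSeries K} (hf : f ∈ intS R Unit) :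
    PowerSeries.map Polynomial.C f ∈ intP R := by
  rw [mem_intS_powerSeries] at hf
  refine ⟨PowerSeries.mk fun n => Polynomial.C ⟨_, hf n⟩, ?_⟩
  ext n : 1
  simp

theorem rescale_mem_intP {f : PowerSeries (Polynomial K)} (hf : f ∈ intP R) (b : Polynomial R) :
    PowerSeries.rescale (b.map R.subtype) f ∈ intP R := by
  obtain ⟨g, rfl⟩ := hf
  refine ⟨PowerSeries.rescale b g, ?_⟩
  ext n : 1
  simp [PowerSeries.coeff_rescale]

theorem paramCoeff_mem_intS {f : PowerSeries (Polynomial K)} (hf : f ∈ intP R) (k : ℕ) :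
    paramCoeff k f ∈ intS R Unit := by
  obtain ⟨g, rfl⟩ := hf
  refine mem_intS_powerSeries.2 fun n => ?_
  rw [coeff_paramCoeff, PowerSeries.coeff_map, Polynomial.coe_mapRingHom, Polynomial.coeff_map]
  exact SetLike.coe_mem _

end IntParam

/-! ### Restricted series up to denominators. -/

section RestrictedFrac

variable {K : Type*} [Field K] (R : Subring K) (σ : Type*)

/-- The power series with a nonzero multiple in the ring of restricted series. -/
def RstFrac : Subring (MvPowerSeries σ K) where
  carrier := {f | ∃ a ∈ R, a ≠ 0 ∧ MvPowerSeries.C a * f ∈ Rst R σ}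
  mul_mem' := by
    rintro f g ⟨a, ha, ha0, hf⟩ ⟨b, hb, hb0, hg⟩
    refine ⟨a * b, mul_mem ha hb, mul_ne_zero ha0 hb0, ?_⟩
    convert mul_mem hf hg using 1
    rw [map_mul]; ring
  one_mem' := ⟨1, one_mem _, one_ne_zero, by simp⟩
  zero_mem' := ⟨1, one_mem _, one_ne_zero, by simp⟩
  add_mem' := by
    rintro f g ⟨a, ha, ha0, hf⟩ ⟨b, hb, hb0, hg⟩
    refine ⟨a * b, mul_mem ha hb, mul_ne_zero ha0 hb0, ?_⟩
    convert add_mem (mul_mem (C_mem_Rst hb) hf) (mul_mem (C_mem_Rst ha) hg) using 1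
    rw [map_mul]; ring
  neg_mem' := by
    rintro f ⟨a, ha, ha0, hf⟩
    exact ⟨a, ha, ha0, by rw [mul_neg]; exact neg_mem hf⟩

variable {R σ}

theorem mem_Rst_of_mem_RstFrac {f : MvPowerSeries σ K} (hf : f ∈ RstFrac R σ)
    (hf' : f ∈ intS R σ) : f ∈ Rst R σ := by
  obtain ⟨a, ha, ha0, h⟩ := hf
  exact mem_Rst_of_C_mul_mem (a := ⟨a, ha⟩) (by simpa using ha0) hf' h

end RestrictedFrac

/-! ### The deformed exponentials and the restrictedness of E_m(t)^p / E_{m-1}(t). -/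

section DeformedExp

variable {K : Type*} [Field K] [CharZero K] {p s : ℕ} [hp : Fact p.Prime] {ζ : K}

/-- The logarithmic coefficients of the universal quotient `E(x, t)^p / E(x^p, t)`, where
`E(x, t)` is the quotient of the Artin-Hasse series in `x t` and `t`. -/
def univLog (p : ℕ) (i : ℕ) : Polynomial K :=
  Polynomial.C (1 / (p : K) ^ i) *
    ((p : Polynomial K) * ((Polynomial.X + 1) ^ p ^ i - 1) - ((Polynomial.X + 1) ^ p ^ (i + 1) - 1))

theorem coeff_zero_univLog (i : ℕ) : (univLog (K := K) p i).coeff 0 = 0 := by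
  rw [Polynomial.coeff_zero_eq_eval_zero, univLog]
  simp

/-- For k ≥ 1 one has k! binom(n,k) = n Q(n) with Q integral. Both terms have the same leading
factor p·p^i = p^{i+1}, so their difference contains Q(p^i) - Q(p^{i+1}), which is divisible by p^i
- p^{i+1}. This extra p^i is what makes the coefficients decay. -/
theorem exists_factorial_mul_coeff_univLog (i k : ℕ) :
    ∃ z : ℤ, (k.factorial : K) * (univLog (K := K) p i).coeff k = (p : K) ^ i * z := by
  rcases k with _ | k
  · exact ⟨0, by simp [coeff_zero_univLog]⟩
  set Q : Polynomial ℤ := (descPochhammer ℤ k).comp (Polynomial.X - 1)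
  have h1 (n : ℕ) : ((k + 1).factorial : K) * ((n.choose (k + 1) : ℕ) : K) = n * ((Q.eval (n : ℤ) : ℤ) : K) := by
    have h2 := descPochhammer_eval_eq_descFactorial ℤ n (k + 1)
    rw [descPochhammer_succ_left, Polynomial.eval_mul, Polynomial.eval_X,
      Nat.descFactorial_eq_factorial_mul_choose] at h2
    exact_mod_cast (congrArg (Int.cast (R := K)) h2).symm
  have hp0 : (p : K) ≠ 0 := Nat.cast_ne_zero.2 hp.out.ne_zero
  obtain ⟨z, hz⟩ := Polynomial.sub_dvd_eval_sub ((p ^ i : ℕ) : ℤ) ((p ^ (i + 1) : ℕ) : ℤ) Q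
  have hz' := congrArg (Int.cast (R := K)) hz
  push_cast at hz'
  have h2 : (univLog (K := K) p i).coeff (k + 1) =
      1 / (p : K) ^ i * (p * ((p ^ i).choose (k + 1) : ℕ) - ((p ^ (i + 1)).choose (k + 1) : ℕ)) := by
    rw [univLog, Polynomial.coeff_C_mul, Polynomial.coeff_sub, ← map_natCast Polynomial.C p,
      Polynomial.coeff_C_mul, Polynomial.coeff_sub, Polynomial.coeff_sub,
      Polynomial.coeff_X_add_one_pow, Polynomial.coeff_X_add_one_pow]
    simp [Polynomial.coeff_one]
  refine ⟨p * ((1 - p) * z), ?_⟩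
  have h3 := h1 (p ^ i)
  have h4 := h1 (p ^ (i + 1))
  push_cast at h3 h4
  rw [h2]
  push_cast
  field_simp
  linear_combination (p : K) * h3 - h4 + (p : K) ^ (i + 1) * hz'

variable (K p) in
/-- The universal quotient `E(x, t)^p / E(x^p, t)`. -/
def univG : PowerSeries (Polynomial K) := ex (pser p (univLog p))

/-- With x = X + 1, the product of the universal quotient with AH(t)^p AH(x^p t) is AH(xt)^p AH(t).
All these Artin-Hasse factors are integral with constant term 1, so the quotient is integral too. -/
theorem univG_mem_intP : univG K p ∈ intP (baseRing p ζ) := by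
  set A : PowerSeries (Polynomial K) := PowerSeries.map Polynomial.C (artinHasse K p) with hA
  have hAi : A ∈ intP (baseRing p ζ) := map_C_mem_intP (mem_intS_powerSeries.2
    (coeff_artinHasse_mem ζ))
  have hr (m : ℕ) : PowerSeries.rescale ((Polynomial.X + 1) ^ m) A ∈ intP (baseRing p ζ) := by
    convert rescale_mem_intP hAi ((Polynomial.X + 1) ^ m) using 2
    simp
  have hA1 : A = ex (pser p fun i => Polynomial.C (1 / (p : K) ^ i)) := by
    rw [hA, artinHasse, map_ex_pser]; congr 2; ext i : 1; simp
  have hc (b : Polynomial K) : PowerSeries.constantCoeff (PowerSeries.rescale b A) = 1 := by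
    rw [hA1, rescale_ex_pser]; exact constantCoeff_ex_pser _
  have hp' (u : ℕ → Polynomial K) : ex (pser p u) ^ p = ex (pser p fun i => (p : Polynomial K) * u i) := by
    rw [ex_pow (constantCoeff_pser' _), pser_C_mul, map_natCast]
  refine mem_of_mul_mem_intP (g := A ^ p * PowerSeries.rescale ((Polynomial.X + 1) ^ p) A)
    (mul_mem (pow_mem hAi _) (hr p)) ?_ ?_
  · have h := hc 1
    rw [PowerSeries.rescale_one, RingHom.id_apply] at h
    rw [map_mul, map_pow, h, hc, one_pow, one_mul]
  · have h2 : univG K p * (A ^ p * PowerSeries.rescale ((Polynomial.X + 1) ^ p) A) =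
        PowerSeries.rescale ((Polynomial.X + 1) ^ 1) A ^ p * A := by
      rw [hA1, rescale_ex_pser, rescale_ex_pser, hp', hp', univG, ← ex_pser_add, ← ex_pser_add,
        ← ex_pser_add]
      congr 2
      ext i : 1
      simp only [Pi.add_apply, univLog]
      rw [pow_one, ← pow_mul, ← pow_succ']
      ring
    rw [h2]
    exact mul_mem (pow_mem (hr 1) _) hAi

variable [IsCyclotomicExtension {p ^ s} ℚ K]

theorem pser_mem_Rst (hs : 1 ≤ s) (hζ : IsPrimitiveRoot ζ (p ^ s)) {u : ℕ → K}
    (hu : ∀ i, ∃ y ∈ baseRing p ζ, u i = (p : K) ^ i * y) : pser p u ∈ Rst (baseRing p ζ) Unit := by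
  choose y hy hu using hu
  refine mem_Rst_powerSeries.2 ⟨mem_intS_powerSeries.2 fun n => ?_, fun a ha ha0 => ?_⟩
  · rw [coeff_pser]; split_ifs
    · rw [hu]; exact mul_mem (pow_mem (natCast_mem _ _) _) (hy _)
    · exact zero_mem _
  · obtain ⟨c, hc, hpc⟩ := exists_natCast_prime_eq_pi_mul hs hζ
    obtain ⟨N, hN⟩ := exists_forall_pow_eq_mul hs hζ ha ha0 hc
    refine ⟨p ^ N, fun n hn => ?_⟩
    rw [coeff_pser]; split_ifs
    · obtain ⟨z, hz, h⟩ := hN (Nat.log p n) (Nat.le_log_of_pow_le hp.out.one_lt hn)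
      exact ⟨z * y _, mul_mem hz (hy _), by rw [hu, ← mul_assoc, ← h, ← hpc]⟩
    · exact ⟨0, zero_mem _, by simp⟩

theorem C_mem_RstFrac (hζ : IsPrimitiveRoot ζ (p ^ s)) (σ : Type*) (a : K) :
    MvPowerSeries.C a ∈ RstFrac (baseRing p ζ) σ := by
  obtain ⟨n, hn, hna⟩ := exists_natCast_mul_mem hζ a
  exact ⟨n, natCast_mem _ _, Nat.cast_ne_zero.2 hn, by rw [← map_mul]; exact C_mem_Rst hna⟩

/-- Two partial facts combine: the decay of the logarithmic coefficients, up to k!, gives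
restrictedness up to a denominator, and the integrality of the Artin-Hasse series removes the
denominator. -/
theorem paramCoeff_univG_mem (hs : 1 ≤ s) (hζ : IsPrimitiveRoot ζ (p ^ s)) (k : ℕ) :
    paramCoeff k (univG K p) ∈ Rst (baseRing p ζ) Unit := by
  refine mem_Rst_of_mem_RstFrac ?_ (paramCoeff_mem_intS univG_mem_intP k)
  have h1 (k : ℕ) : paramCoeff k (pser p (univLog (K := K) p)) =
      pser p fun i => (univLog p i).coeff k := by
    ext n
    rw [coeff_paramCoeff, coeff_pser, coeff_pser]; split_ifs <;> simp
  refine paramCoeff_ex_mem (C_mem_RstFrac hζ Unit) (constantCoeff_pser _) ?_ (fun k => ?_) k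
  · rw [h1]; ext n; simp [coeff_pser, coeff_zero_univLog]
  · refine ⟨k.factorial, natCast_mem _ _, Nat.cast_ne_zero.2 (Nat.factorial_ne_zero k), ?_⟩
    rw [h1]
    have h2 := pser_C_mul (p := p) (k.factorial : K) fun i => (univLog (K := K) p i).coeff k
    refine h2 ▸ pser_mem_Rst hs hζ fun i => ?_
    obtain ⟨z, hz⟩ := exists_factorial_mul_coeff_univLog (K := K) (p := p) i k
    exact ⟨z, intCast_mem _ _, hz⟩

/-- Specialization of the parameter to a multiple of `π`. -/
theorem map_eval_mem_Rst (hs : 1 ≤ s) (hζ : IsPrimitiveRoot ζ (p ^ s))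
    {f : PowerSeries (Polynomial K)} (hf : ∀ k, paramCoeff k f ∈ Rst (baseRing p ζ) Unit) {c : K}
    (hc : c ∈ baseRing p ζ) :
    PowerSeries.map (Polynomial.evalRingHom ((ζ - 1) * c)) f ∈ Rst (baseRing p ζ) Unit := by
  have hco (n k : ℕ) : (PowerSeries.coeff n f).coeff k ∈ baseRing p ζ := by
    have := mem_intS_powerSeries.1 (Rst_le_intS (hf k)) n
    rwa [coeff_paramCoeff] at this
  have hcm := mul_mem (pi_mem (p := p) (ζ := ζ)) hc
  have hev (n : ℕ) : PowerSeries.coeff n (PowerSeries.map (Polynomial.evalRingHom ((ζ - 1) * c)) f) =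
      ∑ k ∈ (PowerSeries.coeff n f).support, (PowerSeries.coeff n f).coeff k * ((ζ - 1) * c) ^ k := by
    rw [PowerSeries.coeff_map, Polynomial.coe_evalRingHom, Polynomial.eval_eq_sum, Polynomial.sum]
  refine mem_Rst_powerSeries.2 ⟨mem_intS_powerSeries.2 fun n => ?_, fun a ha ha0 => ?_⟩
  · rw [hev]
    exact sum_mem fun k _ => mul_mem (hco n k) (pow_mem hcm k)
  · obtain ⟨N, hN⟩ := exists_forall_pow_eq_mul hs hζ ha ha0 hc
    have h1 (k : ℕ) := (mem_Rst_powerSeries.1 (hf k)).2 a ha ha0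
    choose M hM using h1
    -- For k ≥ N the power (πc)^k is already divisible by a. For the finitely many k < N the
    -- restrictedness of the k-th coefficient series applies, and the sum of the thresholds
    -- dominates each of them.
    refine ⟨∑ k ∈ Finset.range N, M k, fun n hn => ?_⟩
    have h2 (k : ℕ) : ∃ y ∈ baseRing p ζ,
        (PowerSeries.coeff n f).coeff k * ((ζ - 1) * c) ^ k = a * y := by
      rcases lt_or_ge k N with hk | hk
      · obtain ⟨y, hy, h⟩ := hM k n ((Finset.single_le_sum (f := M) (fun _ _ => Nat.zero_le _)
          (Finset.mem_range.2 hk)).trans hn)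
        rw [coeff_paramCoeff] at h
        exact ⟨y * ((ζ - 1) * c) ^ k, mul_mem hy (pow_mem hcm k), by rw [h, mul_assoc]⟩
      · obtain ⟨y, hy, h⟩ := hN k hk
        exact ⟨(PowerSeries.coeff n f).coeff k * y, mul_mem (hco n k) hy, by rw [h]; ring⟩
    choose y hy h2 using h2
    refine ⟨∑ k ∈ (PowerSeries.coeff n f).support, y k, sum_mem fun k _ => hy k, ?_⟩
    rw [hev, Finset.mul_sum]
    exact Finset.sum_congr rfl fun k _ => h2 k

theorem zetaPow_pow (hζ : IsPrimitiveRoot ζ (p ^ s)) {m : ℕ} (hm : m ≤ s) (i : ℕ) :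
    zetaPow p s ζ m ^ p ^ i = zetaPow p s ζ (m - i) := by
  rcases le_or_gt i m with h | h
  · rw [zetaPow, zetaPow, ← pow_mul, ← pow_add]; congr 2; omega
  · rw [show m - i = 0 by omega, zetaPow_zero hζ]
    obtain ⟨k, rfl⟩ := Nat.exists_eq_add_of_le h.le
    rw [pow_add, pow_mul, (zetaPow_isPrimitiveRoot hζ hm).pow_eq_one, one_pow]

variable (p s ζ) in
/-- The series `E_{m,p}(t)^p / E_{m-1,p}(t)`. -/
def gexp (m : ℕ) : PowerSeries K := ex (pser p fun i =>
  (p * (zetaPow p s ζ (m - i) - 1) - (zetaPow p s ζ (m - 1 - i) - 1)) / (p : K) ^ i)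

/-- The sum can be extended over all i: for i ≥ m the truncated difference m - i is 0 and ζ_1 - 1 =
0. In this form E_m is visibly AH(ζ_{p^m} t) / AH(t). -/
theorem dexp_eq (hζ : IsPrimitiveRoot ζ (p ^ s)) (m : ℕ) :
    dexp p s ζ m = ex (pser p fun i => (zetaPow p s ζ (m - i) - 1) / (p : K) ^ i) := by
  rw [dexp, sum_C_mul_X_pow_eq_pser m fun i => (zetaPow p s ζ (m - i) - 1) / (p : K) ^ i, ex]
  congr 2
  ext i
  split_ifs with h
  · rfl
  · rw [show m - i = 0 by omega, zetaPow_zero hζ, sub_self, zero_div]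

theorem constantCoeff_dexp (hζ : IsPrimitiveRoot ζ (p ^ s)) (m : ℕ) :
    PowerSeries.constantCoeff (dexp p s ζ m) = 1 := by
  rw [dexp_eq hζ]; exact constantCoeff_ex_pser _

theorem gexp_mul_dexp (hζ : IsPrimitiveRoot ζ (p ^ s)) (m : ℕ) :
    gexp p s ζ m * dexp p s ζ (m - 1) = dexp p s ζ m ^ p := by
  rw [dexp_eq hζ, dexp_eq hζ, gexp, ← ex_pser_add, ex_pow (constantCoeff_pser' _)]
  have := pser_C_mul (p := p) (p : K) fun i => (zetaPow p s ζ (m - i) - 1) / (p : K) ^ i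
  rw [map_natCast] at this
  refine Eq.trans ?_ (congrArg ex this)
  congr 2
  ext i
  simp only [Pi.add_apply]
  ring

theorem constantCoeff_gexp (m : ℕ) : PowerSeries.constantCoeff (gexp p s ζ m) = 1 :=
  constantCoeff_ex_pser _

/-- The series `E_{m,p}(t)^p / E_{m-1,p}(t)` is restricted. -/
theorem gexp_mem_Rst (hs : 1 ≤ s) (hζ : IsPrimitiveRoot ζ (p ^ s)) {m : ℕ} (hm : m ≤ s) :
    gexp p s ζ m ∈ Rst (baseRing p ζ) Unit := by
  obtain ⟨c, hc, h⟩ := exists_zetaPow_sub_one_eq (p := p) (s := s) (ζ := ζ) m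
  -- The parameter is X = x - 1, so x becomes ζ_{p^m} when X is specialised to ζ_{p^m} - 1 = πc.
  have h1 := map_eval_mem_Rst hs hζ (paramCoeff_univG_mem hs hζ) hc
  rw [univG, map_ex_pser] at h1
  convert h1 using 1
  rw [gexp]
  congr 2
  ext i
  simp only [univLog, Polynomial.coe_evalRingHom]
  have h2 : (ζ - 1) * c + 1 = zetaPow p s ζ m := by rw [← h]; ring
  simp only [Polynomial.eval_mul, Polynomial.eval_C, Polynomial.eval_sub, Polynomial.eval_pow,
    Polynomial.eval_add, Polynomial.eval_X, Polynomial.eval_one, Polynomial.eval_natCast]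
  rw [h2, zetaPow_pow hζ hm, zetaPow_pow hζ hm, show m - 1 - i = m - (i + 1) by omega]
  ring

/-- E_m(t) = AH(ζ_{p^m} t) / AH(t) with AH integral and ζ_{p^m} ≡ 1 modulo π. -/
theorem dexp_cg (hs : 1 ≤ s) (hζ : IsPrimitiveRoot ζ (p ^ s)) {m : ℕ} (hm : m ≤ s) :
    Cg (baseRing p ζ) (ζ - 1) (dexp p s ζ m) 1 := by
  set A := artinHasse K p with hA
  have hA1 : A = ex (pser p fun i => 1 / (p : K) ^ i) := by
    rw [hA, artinHasse]; congr 2; ext i; simp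
  have hAi : A ∈ intS (baseRing p ζ) Unit := mem_intS_powerSeries.2 (coeff_artinHasse_mem ζ)
  have hA0 : MvPowerSeries.constantCoeff A = 1 := by
    rw [hA1]; exact constantCoeff_ex_pser _
  have h1 : dexp p s ζ m * A = PowerSeries.rescale (zetaPow p s ζ m) A := by
    rw [dexp_eq hζ, hA1, rescale_ex_pser, ← ex_pser_add]
    congr 2
    ext i
    simp only [Pi.add_apply]
    rw [zetaPow_pow hζ hm]
    ring
  have h2 : Cg (baseRing p ζ) (ζ - 1) (PowerSeries.rescale (zetaPow p s ζ m) A) A := by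
    refine cg_powerSeries.2 fun n => ?_
    obtain ⟨y, hy, h⟩ := exists_zetaPow_sub_one_eq (p := p) (s := s) (ζ := ζ) m
    rw [PowerSeries.coeff_rescale]
    refine ⟨y * (∑ i ∈ Finset.range n, zetaPow p s ζ m ^ i) * PowerSeries.coeff n A,
      mul_mem (mul_mem hy (sum_mem fun i _ => pow_mem (zetaPow_mem s m) i))
        (coeff_artinHasse_mem ζ n), ?_⟩
    have h3 := mul_geom_sum (zetaPow p s ζ m) n
    rw [h] at h3
    linear_combination (-PowerSeries.coeff n A) * h3
  have h3 := inv_mem_intS hAi hA0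
  have h4 : A * A⁻¹ = 1 := MvPowerSeries.mul_inv_cancel A (by rw [hA0]; exact one_ne_zero)
  have h5 : PowerSeries.rescale (zetaPow p s ζ m) A * A⁻¹ = dexp p s ζ m := by
    rw [← h1, mul_assoc, h4, mul_one]
  rw [← h5, ← h4]
  exact h2.mul (Cg.refl _ _) hAi h3

theorem gexp_cg (hs : 1 ≤ s) (hζ : IsPrimitiveRoot ζ (p ^ s)) {m : ℕ} (hm : m ≤ s) :
    Cg (baseRing p ζ) (ζ - 1) (gexp p s ζ m) 1 := by
  set D := dexp p s ζ (m - 1)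
  have hD := dexp_cg hs hζ (m := m - 1) (by omega)
  have hDi : D ∈ intS (baseRing p ζ) Unit := hD.mem pi_mem (one_mem _)
  have hD0 : MvPowerSeries.constantCoeff D = 1 := constantCoeff_dexp hζ _
  have h4 : D * D⁻¹ = 1 := MvPowerSeries.mul_inv_cancel D (by rw [hD0]; exact one_ne_zero)
  have h5 : dexp p s ζ m ^ p * D⁻¹ = gexp p s ζ m := by
    rw [← gexp_mul_dexp hζ, mul_assoc, h4, mul_one]
  rw [← h5, ← h4]
  have h6 := (dexp_cg hs hζ hm).pow pi_mem (one_mem _) p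
  rw [one_pow] at h6
  exact (h6.trans hD.symm).mul (Cg.refl _ _) hDi (inv_mem_intS hDi hD0)

end DeformedExp

/-! ### The exponentials E and G on Witt vectors. -/

section WittExp

variable {K : Type*} [Field K] [CharZero K] {p s : ℕ} [hp : Fact p.Prime] {ζ : K}

/-- The components of the Witt vector have no constant term. -/
def ZeroConst (a : WittVector p (MvPowerSeries (Fin s) K)) : Prop :=
  ∀ i, (a.coeff i).constantCoeff = 0

theorem ZeroConst.natCast_mul {a : WittVector p (MvPowerSeries (Fin s) K)} (ha : ZeroConst a)
    (n : ℕ) : ZeroConst ((n : WittVector p (MvPowerSeries (Fin s) K)) * a) := by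
  have h1 : WittVector.map (MvPowerSeries.constantCoeff (σ := Fin s) (R := K)) a = 0 := by
    ext i; rw [WittVector.map_coeff, ha i, WittVector.zero_coeff]
  intro i
  rw [← WittVector.map_coeff, map_mul, h1, mul_zero, WittVector.zero_coeff]

theorem constantCoeff_pow_eq_zero {σ : Type*} {f : MvPowerSeries σ K} (hf : f.constantCoeff = 0)
    (k : ℕ) : (f ^ p ^ k).constantCoeff = 0 := by
  rw [map_pow, hf, zero_pow (pow_pos hp.out.pos k).ne']

theorem dexp_subst {σ : Type*} {f : MvPowerSeries σ K} (hf : f.constantCoeff = 0) (m : ℕ) :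
    (dexp p s ζ m).subst f =
      ex (∑ i ∈ Finset.range m, MvPowerSeries.C ((zetaPow p s ζ (m - i) - 1) / (p : K) ^ i) *
        f ^ p ^ i) := by
  have hs := hasSubst_of_constantCoeff hf
  have h0 : MvPowerSeries.constantCoeff (∑ i ∈ Finset.range m,
      PowerSeries.C ((zetaPow p s ζ (m - i) - 1) / (p : K) ^ i) * PowerSeries.X ^ p ^ i :
        PowerSeries K) = 0 := by
    rw [sum_C_mul_X_pow_eq_pser m fun i => (zetaPow p s ζ (m - i) - 1) / (p : K) ^ i]
    exact constantCoeff_pser' _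
  rw [dexp]
  refine (subst_ex' hf h0).trans ?_
  congr 1
  rw [← PowerSeries.coe_substAlgHom hs, map_sum]
  refine Finset.sum_congr rfl fun i _ => ?_
  rw [map_mul, map_pow, PowerSeries.coe_substAlgHom hs, PowerSeries.subst_X hs,
    PowerSeries.subst_C]

theorem ghostComponent_eq (a : WittVector p (MvPowerSeries (Fin s) K)) (k : ℕ) :
    WittVector.ghostComponent k a =
      ∑ i ∈ Finset.range (k + 1), MvPowerSeries.C ((p : K) ^ i) * a.coeff i ^ p ^ (k - i) := by
  rw [WittVector.ghostComponent_apply, wittPolynomial_eq_sum_C_mul_X_pow, map_sum]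
  refine Finset.sum_congr rfl fun i _ => ?_
  simp

theorem constantCoeff_ghostComponent {a : WittVector p (MvPowerSeries (Fin s) K)}
    (ha : ZeroConst a) (k : ℕ) : (WittVector.ghostComponent k a).constantCoeff = 0 := by
  rw [ghostComponent_eq, map_sum]
  refine Finset.sum_eq_zero fun i _ => ?_
  rw [map_mul, constantCoeff_pow_eq_zero (ha i), mul_zero]

/-- Collecting the terms a_i^{p^j}/p^j with i + j = k gives the k-th ghost component divided by p^k,
and the root of unity depends only on m - k. As ghost components are additive, E is multiplicative
on Witt vectors. -/
theorem EW_eq (m : ℕ) {a : WittVector p (MvPowerSeries (Fin s) K)} (ha : ZeroConst a) :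
    EW p s ζ m a = ex (∑ k ∈ Finset.range m,
      MvPowerSeries.C ((zetaPow p s ζ (m - k) - 1) / (p : K) ^ k) *
        WittVector.ghostComponent k a) := by
  rw [EW, Finset.prod_congr rfl fun i _ => dexp_subst (ha i) (m - i), ← ex_sum]
  · congr 1
    have h1 (i) (hi : i ∈ Finset.range m) :
        ∑ j ∈ Finset.range (m - i), MvPowerSeries.C ((zetaPow p s ζ (m - i - j) - 1) / (p : K) ^ j) *
          a.coeff i ^ p ^ j =
        ∑ k ∈ Finset.Ico i m, MvPowerSeries.C ((zetaPow p s ζ (m - k) - 1) / (p : K) ^ (k - i)) *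
          a.coeff i ^ p ^ (k - i) := by
      rw [Finset.sum_Ico_eq_sum_range]
      refine Finset.sum_congr rfl fun j _ => ?_
      rw [Nat.add_sub_cancel_left, Nat.sub_sub]
    rw [Finset.sum_congr rfl h1, Finset.sum_comm' (t' := Finset.range m)
      (s' := fun k => Finset.range (k + 1)) (by
        intro i k; simp only [Finset.mem_range, Finset.mem_Ico]; omega)]
    refine Finset.sum_congr rfl fun k _ => ?_
    rw [ghostComponent_eq, Finset.mul_sum]
    refine Finset.sum_congr rfl fun i hi => ?_
    rw [← mul_assoc, ← map_mul]
    congr 2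
    have hp0 : (p : K) ≠ 0 := Nat.cast_ne_zero.2 hp.out.ne_zero
    obtain ⟨j, rfl⟩ := Nat.exists_eq_add_of_le (Nat.lt_succ_iff.1 (Finset.mem_range.1 hi))
    rw [Nat.add_sub_cancel_left, pow_add]
    field_simp
  · intro i _
    rw [map_sum]
    refine Finset.sum_eq_zero fun j _ => ?_
    rw [map_mul, constantCoeff_pow_eq_zero (ha i), mul_zero]

theorem EW_natCast_mul (m : ℕ) {a : WittVector p (MvPowerSeries (Fin s) K)} (ha : ZeroConst a) :
    EW p s ζ m (p * a) = EW p s ζ m a ^ p := by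
  rw [EW_eq m (ha.natCast_mul p), EW_eq m ha, ex_pow]
  · congr 1
    rw [Finset.mul_sum]
    refine Finset.sum_congr rfl fun k _ => ?_
    rw [map_mul, map_natCast]; ring
  · rw [map_sum]
    refine Finset.sum_eq_zero fun k _ => ?_
    rw [map_mul, constantCoeff_ghostComponent ha, mul_zero]

theorem dexp_zero : dexp p s ζ 0 = 1 := by
  rw [dexp, Finset.range_zero, Finset.sum_empty]; exact ex_zero

theorem subst_one {σ : Type*} {f : MvPowerSeries σ K} (hf : f.constantCoeff = 0) :
    (1 : PowerSeries K).subst f = 1 := by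
  rw [← PowerSeries.coe_substAlgHom (hasSubst_of_constantCoeff hf), map_one]

variable [IsCyclotomicExtension {p ^ s} ℚ K]

theorem constantCoeff_EW (hζ : IsPrimitiveRoot ζ (p ^ s)) (m : ℕ)
    {a : WittVector p (MvPowerSeries (Fin s) K)} (ha : ZeroConst a) :
    (EW p s ζ m a).constantCoeff = 1 := by
  rw [EW, map_prod]
  exact Finset.prod_eq_one fun i _ => by
    rw [constantCoeff_subst_eq (ha i), constantCoeff_dexp hζ]

theorem GW_mul (hζ : IsPrimitiveRoot ζ (p ^ s)) (m : ℕ)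
    {a : WittVector p (MvPowerSeries (Fin s) K)} (ha : ZeroConst a) :
    GW p s ζ m a * EW p s ζ (m - 1) a = EW p s ζ m a ^ p := by
  rw [GW, EW_natCast_mul m ha, mul_assoc, MvPowerSeries.inv_mul_cancel _ (by
    rw [constantCoeff_EW hζ _ ha]; exact one_ne_zero), mul_one]

/-- Since E(pa) = E(a)^p, the multiplication in the Witt vectors disappears and G splits as a
product over the components, to which the one-variable restrictedness applies. -/
theorem GW_eq (hζ : IsPrimitiveRoot ζ (p ^ s)) (n : ℕ)
    {a : WittVector p (MvPowerSeries (Fin s) K)} (ha : ZeroConst a) :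
    GW p s ζ (n + 1) a = ∏ i ∈ Finset.range (n + 1), (gexp p s ζ (n + 1 - i)).subst (a.coeff i) := by
  have h0 : EW p s ζ n a ≠ 0 := by
    intro h
    have := constantCoeff_EW hζ n ha
    rw [h, map_zero] at this
    exact zero_ne_one this
  refine mul_right_cancel₀ h0 ?_
  have h1 := GW_mul hζ (n + 1) ha
  rw [Nat.add_sub_cancel] at h1
  rw [h1]
  -- The additional factor i = n is the exponential of level 0, which is 1; with it both products
  -- have the same index set.
  have h2 : EW p s ζ n a = ∏ i ∈ Finset.range (n + 1), (dexp p s ζ (n + 1 - i - 1)).subst (a.coeff i) := by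
    rw [Finset.prod_range_succ, Nat.add_sub_cancel_left, Nat.sub_self, dexp_zero,
      subst_one (ha n), mul_one, EW]
    refine Finset.prod_congr rfl fun i hi => ?_
    congr 2
    have := Finset.mem_range.1 hi
    omega
  rw [h2, ← Finset.prod_mul_distrib, EW, ← Finset.prod_pow]
  refine Finset.prod_congr rfl fun i _ => ?_
  have hs := hasSubst_of_constantCoeff (ha i)
  rw [← PowerSeries.subst_mul hs, gexp_mul_dexp hζ, ← PowerSeries.coe_substAlgHom hs, map_pow]

theorem constantCoeff_GW (hζ : IsPrimitiveRoot ζ (p ^ s)) (n : ℕ)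
    {a : WittVector p (MvPowerSeries (Fin s) K)} (ha : ZeroConst a) :
    (GW p s ζ (n + 1) a).constantCoeff = 1 := by
  rw [GW_eq hζ n ha, map_prod]
  exact Finset.prod_eq_one fun i _ => by
    rw [constantCoeff_subst_eq (ha i), constantCoeff_gexp]

theorem cg_subst_one {σ : Type*} {f : MvPowerSeries σ K} (hf : f.constantCoeff = 0)
    (hf' : f ∈ intS (baseRing p ζ) σ) {g : PowerSeries K} (hg : Cg (baseRing p ζ) (ζ - 1) g 1) :
    Cg (baseRing p ζ) (ζ - 1) (g.subst f) 1 := by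
  have h := hg.subst (a := fun _ : Unit => f) (fun _ => hf) (fun _ => hf')
  rwa [show MvPowerSeries.subst (fun _ : Unit => f) (1 : MvPowerSeries Unit K) = 1 from
    subst_one hf] at h

theorem EW_cg (hs : 1 ≤ s) (hζ : IsPrimitiveRoot ζ (p ^ s)) {m : ℕ} (hm : m ≤ s)
    {a : WittVector p (MvPowerSeries (Fin s) K)} (ha : ZeroConst a)
    (ha' : ∀ i, a.coeff i ∈ intS (baseRing p ζ) (Fin s)) :
    Cg (baseRing p ζ) (ζ - 1) (EW p s ζ m a) 1 := by
  have h := Cg.prod (R := baseRing p ζ) pi_mem (Finset.range m)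
    (f := fun i => (dexp p s ζ (m - i)).subst (a.coeff i)) (g := fun _ => 1)
    (fun i _ => cg_subst_one (ha i) (ha' i) (dexp_cg hs hζ (by omega))) (fun _ _ => one_mem _)
  rwa [Finset.prod_const_one] at h

theorem GW_cg (hs : 1 ≤ s) (hζ : IsPrimitiveRoot ζ (p ^ s)) {n : ℕ} (hm : n + 1 ≤ s)
    {a : WittVector p (MvPowerSeries (Fin s) K)} (ha : ZeroConst a)
    (ha' : ∀ i, a.coeff i ∈ intS (baseRing p ζ) (Fin s)) :
    Cg (baseRing p ζ) (ζ - 1) (GW p s ζ (n + 1) a) 1 := by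
  have h := Cg.prod (R := baseRing p ζ) pi_mem (Finset.range (n + 1))
    (f := fun i => (gexp p s ζ (n + 1 - i)).subst (a.coeff i)) (g := fun _ => 1)
    (fun i _ => cg_subst_one (ha i) (ha' i) (gexp_cg hs hζ (by omega))) (fun _ _ => one_mem _)
  rw [Finset.prod_const_one] at h
  rwa [GW_eq hζ n ha]

theorem GW_mem_Rst (hs : 1 ≤ s) (hζ : IsPrimitiveRoot ζ (p ^ s)) {n : ℕ} (hm : n + 1 ≤ s)
    {a : WittVector p (MvPowerSeries (Fin s) K)} (ha : ZeroConst a)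
    (ha' : ∀ i, a.coeff i ∈ Rst (baseRing p ζ) (Fin s)) :
    GW p s ζ (n + 1) a ∈ Rst (baseRing p ζ) (Fin s) := by
  rw [GW_eq hζ n ha]
  exact prod_mem fun i _ => subst_mem_Rst (fun _ => ha i) (fun _ => ha' i)
    (gexp_mem_Rst hs hζ (by omega))

theorem dexp_one_subst (hs : 1 ≤ s) (hζ : IsPrimitiveRoot ζ (p ^ s)) {σ : Type*}
    {f : MvPowerSeries σ K} (hf : f.constantCoeff = 0) :
    (dexp p s ζ 1).subst f = ex (MvPowerSeries.C (lam p s ζ) * f) := by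
  rw [dexp_subst hf]; simp [lam]

/-- Changing the last component of the Witt vector from `0`. -/
theorem EW_update (hs : 1 ≤ s) (hζ : IsPrimitiveRoot ζ (p ^ s)) (n : ℕ)
    {a b : WittVector p (MvPowerSeries (Fin s) K)} (ha : ZeroConst a) (hb : ZeroConst b)
    (h0 : a.coeff n = 0) (h : ∀ i < n, b.coeff i = a.coeff i) :
    EW p s ζ (n + 1) b =
      ex (MvPowerSeries.C (lam p s ζ) * b.coeff n) * EW p s ζ (n + 1) a := by
  rw [EW, EW, Finset.prod_range_succ, Finset.prod_range_succ, Nat.add_sub_cancel_left,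
    dexp_one_subst hs hζ (hb n), dexp_one_subst hs hζ (ha n), h0, mul_zero, ex_zero, mul_one,
    mul_comm]
  congr 1
  exact Finset.prod_congr rfl fun i hi => by rw [h i (Finset.mem_range.1 hi)]

end WittExp

/-! ### Series in the first n variables. -/

section VarsBelow

variable {K : Type*} [Field K] [CharZero K] {s : ℕ}

variable (K s) in
/-- The power series in the variables with numbers less than `n`. -/
def varsBelow (n : ℕ) : Subring (MvPowerSeries (Fin s) K) where
  carrier := {f | ∀ m, MvPowerSeries.coeff m f ≠ 0 → ∀ k : Fin s, n ≤ k → m k = 0}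
  zero_mem' := by simp
  one_mem' := by
    classical
    intro m hm k hk
    rw [MvPowerSeries.coeff_one] at hm
    have : m = 0 := by by_contra h; exact hm (if_neg h)
    simp [this]
  add_mem' := by
    intro f g hf hg m hm k hk
    by_contra h
    refine hm ?_
    rw [map_add, not_not.1 fun h1 => h (hf m h1 k hk), not_not.1 fun h1 => h (hg m h1 k hk),
      add_zero]
  neg_mem' := by
    intro f hf m hm k hk
    exact hf m (by simpa using hm) k hk
  mul_mem' := by
    classical
    intro f g hf hg m hm k hk
    rw [MvPowerSeries.coeff_mul] at hm
    obtain ⟨⟨a, b⟩, hab, h⟩ := Finset.exists_ne_zero_of_sum_ne_zero hm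
    rw [Finset.HasAntidiagonal.mem_antidiagonal] at hab
    have h1 := hf a (left_ne_zero_of_mul h) k hk
    have h2 := hg b (right_ne_zero_of_mul h) k hk
    rw [← hab]
    simp [h1, h2]

theorem varsBelow_mono {m n : ℕ} (h : m ≤ n) : varsBelow K s m ≤ varsBelow K s n :=
  fun _ hf d hd k hk => hf d hd k (h.trans hk)

theorem C_mem_varsBelow (n : ℕ) (a : K) : MvPowerSeries.C a ∈ varsBelow K s n := by
  classical
  intro m hm k hk
  rw [MvPowerSeries.coeff_C] at hm
  have : m = 0 := by by_contra h; exact hm (if_neg h)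
  simp [this]

theorem var_mem_varsBelow (n : ℕ) : var s n ∈ varsBelow K s (n + 1) := by
  classical
  rw [var]
  split_ifs with h
  · intro m hm k hk
    rw [MvPowerSeries.coeff_X] at hm
    have : m = Finsupp.single ⟨n, h⟩ 1 := by by_contra h; exact hm (if_neg h)
    rw [this, Finsupp.single_apply, if_neg]
    rintro rfl
    simp at hk
  · exact zero_mem _

theorem subst_mem_varsBelow {n : ℕ} {f : MvPowerSeries (Fin s) K} (hf : f ∈ varsBelow K s n)
    (hf0 : f.constantCoeff = 0) (g : PowerSeries K) : g.subst f ∈ varsBelow K s n := by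
  intro m hm k hk
  rw [PowerSeries.coeff_subst (hasSubst_of_constantCoeff hf0)] at hm
  by_contra h
  refine hm (finsum_eq_zero_of_forall_eq_zero fun d => ?_)
  rw [not_not.1 fun h1 => h (pow_mem hf d m h1 k hk), smul_zero]

theorem inv_mem_varsBelow {n : ℕ} {f : MvPowerSeries (Fin s) K} (hf : f ∈ varsBelow K s n)
    (hf0 : f.constantCoeff = 1) : f⁻¹ ∈ varsBelow K s n := by
  have h0 : (f - 1).constantCoeff = 0 := by simp [hf0]
  have h1 : ((PowerSeries.log K).subst (f - 1)).constantCoeff = 0 := by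
    rw [constantCoeff_subst_eq h0, PowerSeries.constantCoeff_log]
  -- Writing the inverse as a one-variable series in log f reduces the claim to stability under
  -- substitution.
  have h2 : f⁻¹ = ex (-(PowerSeries.log K).subst (f - 1)) := by
    rw [MvPowerSeries.inv_eq_iff_mul_eq_one (by rw [hf0]; exact one_ne_zero)]
    nth_rw 2 [← ex_log_subst hf0]
    exact ex_neg_mul h1
  rw [h2]
  exact subst_mem_varsBelow (neg_mem (subst_mem_varsBelow (sub_mem hf (one_mem _)) h0 _))
    (by rw [map_neg, h1, neg_zero]) _

theorem coeff_keepTerms (P : K → Prop) [DecidablePred P] (f : MvPowerSeries (Fin s) K) (m) :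
    MvPowerSeries.coeff m (keepTerms P f) =
      if P (MvPowerSeries.coeff m f) then MvPowerSeries.coeff m f else 0 := by
  rw [MvPowerSeries.coeff_apply (keepTerms P f)]
  simp only [keepTerms]
  congr

theorem keepTerms_mem_varsBelow {n : ℕ} {f : MvPowerSeries (Fin s) K} (hf : f ∈ varsBelow K s n)
    (P : K → Prop) : keepTerms P f ∈ varsBelow K s n := by
  classical
  intro m hm k hk
  rw [coeff_keepTerms] at hm
  refine hf m (fun h => hm ?_) k hk
  rw [h]; split_ifs <;> rfl

/-- The substitution depends only on the values at the variables which occur. -/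
theorem subst_congr_of_mem_varsBelow {τ : Type*} {n : ℕ} {f : MvPowerSeries (Fin s) K}
    (hf : f ∈ varsBelow K s n) {a b : Fin s → MvPowerSeries τ K}
    (ha : ∀ i, (a i).constantCoeff = 0) (hb : ∀ i, (b i).constantCoeff = 0)
    (h : ∀ i : Fin s, (i : ℕ) < n → a i = b i) :
    MvPowerSeries.subst a f = MvPowerSeries.subst b f := by
  ext e
  rw [MvPowerSeries.coeff_subst (MvPowerSeries.hasSubst_of_constantCoeff_zero ha),
    MvPowerSeries.coeff_subst (MvPowerSeries.hasSubst_of_constantCoeff_zero hb)]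
  refine finsum_congr fun d => ?_
  by_cases hd : MvPowerSeries.coeff d f = 0
  · rw [hd, zero_smul, zero_smul]
  · congr 2
    refine Finsupp.prod_congr fun i hi => ?_
    rw [h i]
    by_contra hcon
    exact (Finsupp.mem_support_iff.1 hi) (hf d hd i (not_lt.1 hcon))

end VarsBelow

/-! ### Truncation by divisibility. -/

section KeepTerms

variable {K : Type*} [Field K] [CharZero K] {s : ℕ} {R : Subring K}

/-- The dropped terms are the multiples of a. The condition on P excludes the coefficient 0, for
which keeping and dropping coincide, so the conventional value of the valuation at 0 is harmless. -/
theorem keepTerms_cg {f : MvPowerSeries (Fin s) K} (hf : f ∈ intS R (Fin s)) {a : R}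
    {P : K → Prop} (hP : ∀ c ∈ R, c ≠ 0 → (P c ↔ ¬ ∃ y ∈ R, c = a * y)) :
    Cg R (a : K) f (keepTerms P f) := by
  classical
  refine cg_iff.2 fun m => ?_
  rw [coeff_keepTerms]
  split_ifs with h
  · exact ⟨0, zero_mem _, by simp⟩
  · rcases eq_or_ne (MvPowerSeries.coeff m f) 0 with h0 | h0
    · exact ⟨0, zero_mem _, by simp [h0]⟩
    · rw [hP _ (mem_intS.1 hf m) h0, not_not] at h
      simpa using h

theorem exists_polyHom_eq_keepTerms {f : MvPowerSeries (Fin s) K} {a : R} (hf : f ∈ polyMod a)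
    {P : K → Prop} (hP : ∀ c ∈ R, c ≠ 0 → (P c ↔ ¬ ∃ y ∈ R, c = a * y)) :
    ∃ q, polyHom R (Fin s) q = keepTerms P f := by
  classical
  rw [mem_polyMod_iff] at hf
  refine exists_polyHom_eq_of_finite (mem_intS.2 fun m => ?_) (hf.2.subset fun m hm => ?_)
  · rw [coeff_keepTerms]; split_ifs
    · exact mem_intS.1 hf.1 m
    · exact zero_mem _
  · rw [Set.mem_ofPred_eq, coeff_keepTerms] at hm
    split_ifs at hm with h
    · exact (hP _ (mem_intS.1 hf.1 m) hm).1 h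
    · exact absurd rfl hm

end KeepTerms

/-! ### The parallel recursions for X' and Y'. -/

section Recursion

variable {K : Type*} [Field K] [CharZero K] {p s : ℕ} [hp : Fact p.Prime] {ζ : K}

theorem constantCoeff_C_inv_mul_ln {f : MvPowerSeries (Fin s) K} (hf : f.constantCoeff = 1) (c : K) :
    (MvPowerSeries.C c⁻¹ * ln s f).constantCoeff = 0 := by
  rw [map_mul, ln, constantCoeff_subst_eq (by simp [hf]), PowerSeries.constantCoeff_log, mul_zero]

theorem ex_C_mul_ln {f : MvPowerSeries (Fin s) K} (hf : f.constantCoeff = 1) {c : K} (hc : c ≠ 0) :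
    ex (MvPowerSeries.C c * (MvPowerSeries.C c⁻¹ * ln s f)) = f := by
  rw [← mul_assoc, ← map_mul, mul_inv_cancel₀ hc, map_one, one_mul, ln, ex_log_subst hf]

variable (p s ζ) in
/-- The series `X_n'`. -/
def compX (n : ℕ) : MvPowerSeries (Fin s) K := MvPowerSeries.C ((p : K) * lam p s ζ)⁻¹ *
  ln s ((seriesG p s ζ n + MvPowerSeries.C ((p : K) * lam p s ζ) * var s n) *
    (GW p s ζ (n + 1) (wittX p s ζ n))⁻¹)

variable (p s ζ) in
/-- The series `Y_n'`. -/
def compY (n : ℕ) : MvPowerSeries (Fin s) K := MvPowerSeries.C (lam p s ζ)⁻¹ *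
  ln s ((seriesE p s ζ n + MvPowerSeries.C (lam p s ζ) * var s n) *
    (EW p s ζ (n + 1) (wittY p s ζ n))⁻¹)

theorem wittX_coeff (n j : ℕ) : (wittX p s ζ n).coeff j = if j < n then compX p s ζ j else 0 := by
  induction n with
  | zero => rfl
  | succ n ih =>
    change Function.update (wittX p s ζ n).coeff n (compX p s ζ n) j = _
    rcases eq_or_ne j n with rfl | h
    · simp
    · rw [Function.update_of_ne h, ih]
      congr 1
      simp only [eq_iff_iff]; omega

theorem wittY_coeff (n j : ℕ) : (wittY p s ζ n).coeff j = if j < n then compY p s ζ j else 0 := by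
  induction n with
  | zero => rfl
  | succ n ih =>
    change Function.update (wittY p s ζ n).coeff n (compY p s ζ n) j = _
    rcases eq_or_ne j n with rfl | h
    · simp
    · rw [Function.update_of_ne h, ih]
      congr 1
      simp only [eq_iff_iff]; omega

theorem constantCoeff_var (n : ℕ) : (var s n : MvPowerSeries (Fin s) K).constantCoeff = 0 := by
  rw [var]; split_ifs <;> simp

variable [IsCyclotomicExtension {p ^ s} ℚ K]

/-- The cut-off is ν(pλ) = 1 + 1/(p-1), terms of exactly this valuation being kept. As the valuation
is discrete, a strictly larger value means divisibility by pλπ. -/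
theorem nu_le_iff (hs : 1 ≤ s) (hζ : IsPrimitiveRoot ζ (p ^ s)) {c : K} (hc : c ∈ baseRing p ζ)
    (hc0 : c ≠ 0) : nu p c ≤ (p : ℚ) / (p - 1) ↔
      ¬ ∃ y ∈ baseRing p ζ, c = (p * lam p s ζ * (ζ - 1)) * y := by
  have hp0 : (p : K) ≠ 0 := Nat.cast_ne_zero.2 hp.out.ne_zero
  have hp1 : (1 : ℚ) < p := by exact_mod_cast hp.out.one_lt
  have hl0 := lam_ne_zero hs hζ
  have hπ0 := pi_ne_zero hs hζ
  have h1 : nu p ((p : K) * lam p s ζ) = (p : ℚ) / (p - 1) := by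
    rw [nu_mul hζ hp0 hl0, nu_prime hζ, nu_lam hs hζ]
    have : (p : ℚ) - 1 ≠ 0 := by linarith
    field_simp; ring
  rw [← h1]
  constructor
  · intro h2 h3
    rw [exists_mul_iff_nu_le hs hζ (mul_ne_zero (mul_ne_zero hp0 hl0) hπ0) hc0,
      nu_mul hζ (mul_ne_zero hp0 hl0) hπ0] at h3
    have := nu_pi_pos hs hζ
    linarith
  · intro h2
    by_contra h3
    rw [not_le] at h3
    obtain ⟨y, hy, hcy⟩ := (exists_mul_iff_nu_le hs hζ (mul_ne_zero hp0 hl0) hc0).2 h3.le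
    rcases mem_pi_or_inv_mem hs hζ hy with ⟨z, hz, hyz⟩ | ⟨hy0, hy'⟩
    · exact h2 ⟨z, hz, by rw [hcy, hyz, ← mul_assoc]⟩
    · rw [hcy, nu_mul hζ (mul_ne_zero hp0 hl0) hy0, nu_eq_zero_of_mem_of_inv_mem hζ hy hy0 hy'] at h3
      linarith

theorem nu_lt_iff (hs : 1 ≤ s) (hζ : IsPrimitiveRoot ζ (p ^ s)) {c : K} (hc : c ∈ baseRing p ζ)
    (hc0 : c ≠ 0) : nu p c < 1 / ((p : ℚ) - 1) ↔ ¬ ∃ y ∈ baseRing p ζ, c = lam p s ζ * y := by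
  rw [exists_mul_iff_nu_le hs hζ (lam_ne_zero hs hζ) hc0, nu_lam hs hζ, not_le]

theorem p_mul_lam_mem : (p : K) * lam p s ζ ∈ baseRing p ζ :=
  mul_mem (natCast_mem _ _) (lam_mem s)

theorem p_mul_lam_ne_zero (hs : 1 ≤ s) (hζ : IsPrimitiveRoot ζ (p ^ s)) : (p : K) * lam p s ζ ≠ 0 :=
  mul_ne_zero (Nat.cast_ne_zero.2 hp.out.ne_zero) (lam_ne_zero hs hζ)

variable (ζ) in
/-- The conditions on the components of the Witt vectors in the recursion. -/
structure GoodWitt (n : ℕ) (a : WittVector p (MvPowerSeries (Fin s) K)) : Prop where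
  zeroConst : ZeroConst a
  mem_Rst : ∀ i, a.coeff i ∈ Rst (baseRing p ζ) (Fin s)
  mem_varsBelow : ∀ i, a.coeff i ∈ varsBelow K s n

theorem GW_mem_varsBelow (hζ : IsPrimitiveRoot ζ (p ^ s)) {n : ℕ}
    {a : WittVector p (MvPowerSeries (Fin s) K)} (ha : GoodWitt ζ n a) (m : ℕ) :
    GW p s ζ (m + 1) a ∈ varsBelow K s n := by
  rw [GW_eq hζ m ha.zeroConst]
  exact prod_mem fun i _ => subst_mem_varsBelow (ha.mem_varsBelow i) (ha.zeroConst i) _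

theorem EW_mem_varsBelow {n : ℕ}
    {a : WittVector p (MvPowerSeries (Fin s) K)} (ha : GoodWitt ζ n a) (m : ℕ) :
    EW p s ζ m a ∈ varsBelow K s n :=
  prod_mem fun i _ => subst_mem_varsBelow (ha.mem_varsBelow i) (ha.zeroConst i) _

theorem constantCoeff_keepTerms {P : K → Prop} (hP : P 1) {f : MvPowerSeries (Fin s) K}
    (hf : f.constantCoeff = 1) : (keepTerms P f).constantCoeff = 1 := by
  classical
  rw [← MvPowerSeries.coeff_zero_eq_constantCoeff_apply] at hf ⊢
  rw [coeff_keepTerms, hf, if_pos hP]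

/-- The properties of `G_{n+1}`. -/
theorem seriesG_spec (hs : 1 ≤ s) (hζ : IsPrimitiveRoot ζ (p ^ s)) {n : ℕ} (hn : n < s)
    (h : GoodWitt ζ n (wittX p s ζ n)) :
    (∃ q, polyHom (baseRing p ζ) (Fin s) q = seriesG p s ζ n) ∧
      seriesG p s ζ n ∈ varsBelow K s n ∧ (seriesG p s ζ n).constantCoeff = 1 ∧
      Cg (baseRing p ζ) (ζ - 1) (seriesG p s ζ n) 1 ∧
      Cg (baseRing p ζ) (p * lam p s ζ * (ζ - 1)) (GW p s ζ (n + 1) (wittX p s ζ n))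
        (seriesG p s ζ n) := by
  let a : baseRing p ζ := ⟨p * lam p s ζ * (ζ - 1), mul_mem p_mul_lam_mem pi_mem⟩
  have hU := GW_mem_Rst hs hζ (n := n) hn h.zeroConst h.mem_Rst
  have hP : ∀ c ∈ baseRing p ζ, c ≠ 0 →
      (nu p c ≤ (p : ℚ) / (p - 1) ↔ ¬ ∃ y ∈ baseRing p ζ, c = a * y) :=
    fun c hc hc0 => nu_le_iff hs hζ hc hc0
  have hcg := keepTerms_cg (Rst_le_intS hU) hP
  have ha0 : a ≠ 0 := fun h => (mul_ne_zero (p_mul_lam_ne_zero hs hζ) (pi_ne_zero hs hζ))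
    (congrArg (baseRing p ζ).subtype h)
  have hdef : seriesG p s ζ n = keepTerms (fun c => nu p c ≤ (p : ℚ) / (p - 1))
      (GW p s ζ (n + 1) (wittX p s ζ n)) := rfl
  rw [hdef]
  refine ⟨exists_polyHom_eq_keepTerms (mem_Rst.1 hU a ha0) hP,
    keepTerms_mem_varsBelow (GW_mem_varsBelow hζ h n) _,
    constantCoeff_keepTerms ?_ (constantCoeff_GW hζ n h.zeroConst), ?_, hcg⟩
  · rw [nu_one hζ]
    have hp1 : (1 : ℚ) < p := by exact_mod_cast hp.out.one_lt
    exact div_nonneg (by linarith) (by linarith)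
  · have h1 : Cg (baseRing p ζ) ((ζ - 1) * (p * lam p s ζ)) (GW p s ζ (n + 1) (wittX p s ζ n))
        (seriesG p s ζ n) := by rw [mul_comm, hdef]; exact hcg
    exact (h1.of_mul p_mul_lam_mem).symm.trans
      (GW_cg hs hζ hn h.zeroConst fun i => Rst_le_intS (h.mem_Rst i))

theorem constantCoeff_u {n : ℕ} (h : (seriesG p s ζ n).constantCoeff = 1) :
    (seriesG p s ζ n + MvPowerSeries.C ((p : K) * lam p s ζ) * var s n).constantCoeff = 1 := by
  rw [map_add, map_mul, constantCoeff_var, mul_zero, add_zero, h]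

theorem constantCoeff_mul_inv {σ : Type*} {f g : MvPowerSeries σ K} (hf : f.constantCoeff = 1)
    (hg : g.constantCoeff = 1) : (f * g⁻¹).constantCoeff = 1 := by
  rw [map_mul, MvPowerSeries.constantCoeff_inv, hf, hg]; simp

theorem var_mem_Rst (R : Subring K) (n : ℕ) : var s n ∈ Rst R (Fin s) := by
  rw [var]; split_ifs
  · exact X_mem_Rst _
  · exact zero_mem _

/-- The truncation G is congruent modulo pλ to the full series U, so u_n/U = 1 + pλt with t
restricted, and the new component is the restricted series log(1 + pλt)/(pλ) evaluated there.
Exponentiating recovers u_n. -/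
theorem compX_spec (hs : 1 ≤ s) (hζ : IsPrimitiveRoot ζ (p ^ s)) {n : ℕ} (hn : n < s)
    (h : GoodWitt ζ n (wittX p s ζ n)) :
    (compX p s ζ n).constantCoeff = 0 ∧ compX p s ζ n ∈ Rst (baseRing p ζ) (Fin s) ∧
      compX p s ζ n ∈ varsBelow K s (n + 1) ∧
      ex (MvPowerSeries.C (p * lam p s ζ) * compX p s ζ n) * GW p s ζ (n + 1) (wittX p s ζ n) =
        seriesG p s ζ n + MvPowerSeries.C (p * lam p s ζ) * var s n := by
  obtain ⟨⟨q, hq⟩, hGv, hG0, hGπ, hUG⟩ := seriesG_spec hs hζ hn h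
  set U := GW p s ζ (n + 1) (wittX p s ζ n) with hUdef
  set G := seriesG p s ζ n
  set v := G + MvPowerSeries.C ((p : K) * lam p s ζ) * var s n with hv
  have hU0 : U.constantCoeff = 1 := constantCoeff_GW hζ n h.zeroConst
  have hU := GW_mem_Rst hs hζ (n := n) hn h.zeroConst h.mem_Rst
  rw [← hUdef] at hU
  have hUi : U⁻¹ ∈ Rst (baseRing p ζ) (Fin s) := inv_mem_Rst hs hζ hU hU0
    (GW_cg hs hζ hn h.zeroConst fun i => Rst_le_intS (h.mem_Rst i))
  have hUU : U * U⁻¹ = 1 := MvPowerSeries.mul_inv_cancel U (by rw [hU0]; exact one_ne_zero)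
  have hv0 : v.constantCoeff = 1 := constantCoeff_u hG0
  have hr0 := constantCoeff_mul_inv hv0 hU0
  have hpl := p_mul_lam_ne_zero hs hζ
  have hGR : G ∈ Rst (baseRing p ζ) (Fin s) := hq ▸ polyHom_mem_Rst q
  have hUv : U ∈ varsBelow K s n := GW_mem_varsBelow hζ h n
  have hvv : v ∈ varsBelow K s (n + 1) := add_mem (varsBelow_mono (Nat.le_succ n) hGv)
    (mul_mem (C_mem_varsBelow _ _) (var_mem_varsBelow n))
  refine ⟨constantCoeff_C_inv_mul_ln hr0 _, ?_, ?_, ?_⟩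
  · obtain ⟨w, hw, hUw⟩ := hUG.of_mul pi_mem
    have hwR : w ∈ Rst (baseRing p ζ) (Fin s) := by
      refine mem_Rst_of_C_mul_mem (a := ⟨p * lam p s ζ, p_mul_lam_mem⟩)
        (fun h => hpl (congrArg (baseRing p ζ).subtype h)) hw ?_
      have : MvPowerSeries.C ((p : K) * lam p s ζ) * w = U - G := by rw [hUw]; ring
      change MvPowerSeries.C ((p : K) * lam p s ζ) * w ∈ _
      rw [this]; exact sub_mem hU hGR
    set t := (var s n - w) * U⁻¹ with ht
    have htR : t ∈ Rst (baseRing p ζ) (Fin s) := mul_mem (sub_mem (var_mem_Rst _ n) hwR) hUi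
    have hvt : v * U⁻¹ - 1 = MvPowerSeries.C ((p : K) * lam p s ζ) * t := by
      rw [ht, hv]
      linear_combination (-U⁻¹) * hUw + hUU
    have ht0 : t.constantCoeff = 0 := by
      have := congrArg MvPowerSeries.constantCoeff hvt
      rw [map_sub, hr0, map_one, sub_self, map_mul, MvPowerSeries.constantCoeff_C] at this
      exact (mul_eq_zero.1 this.symm).resolve_left hpl
    obtain ⟨c, hc, hlc⟩ := exists_lam_eq (K := K) (p := p) (s := s) (ζ := ζ)
    have h1 : compX p s ζ n = (logSeries ((p : K) * lam p s ζ)).subst t := by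
      change MvPowerSeries.C ((p : K) * lam p s ζ)⁻¹ * ln s (v * U⁻¹) = _
      rw [ln, hvt, log_subst_C_mul _ ht0, ← mul_assoc, ← map_mul, inv_mul_cancel₀ hpl, map_one,
        one_mul]
    rw [h1, hlc]
    exact subst_mem_Rst (fun _ => ht0) (fun _ => htR) (logSeries_mem_Rst hs hζ hc)
  · refine mul_mem (C_mem_varsBelow _ _) (subst_mem_varsBelow (sub_mem (mul_mem hvv
      (varsBelow_mono (Nat.le_succ n) (inv_mem_varsBelow hUv hU0))) (one_mem _)) ?_ _)
    rw [map_sub, hr0, map_one, sub_self]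
  · have h1 : ex (MvPowerSeries.C (p * lam p s ζ) * compX p s ζ n) = v * U⁻¹ := ex_C_mul_ln hr0 hpl
    rw [h1, mul_assoc, mul_comm U⁻¹, hUU, mul_one]

theorem goodWitt_zero {a : WittVector p (MvPowerSeries (Fin s) K)} (h : ∀ i, a.coeff i = 0) (n : ℕ) :
    GoodWitt ζ n a where
  zeroConst i := by rw [h, map_zero]
  mem_Rst i := by rw [h]; exact zero_mem _
  mem_varsBelow i := by rw [h]; exact zero_mem _

theorem goodWitt_succ {n : ℕ} {a b : WittVector p (MvPowerSeries (Fin s) K)} {f : MvPowerSeries (Fin s) K}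
    (ha : GoodWitt ζ n a) (hb : ∀ i, b.coeff i = if i = n then f else a.coeff i)
    (h0 : f.constantCoeff = 0) (hR : f ∈ Rst (baseRing p ζ) (Fin s))
    (hv : f ∈ varsBelow K s (n + 1)) : GoodWitt ζ (n + 1) b where
  zeroConst i := by
    rw [hb]; split_ifs
    · exact h0
    · exact ha.zeroConst i
  mem_Rst i := by
    rw [hb]; split_ifs
    · exact hR
    · exact ha.mem_Rst i
  mem_varsBelow i := by
    rw [hb]; split_ifs
    · exact hv
    · exact varsBelow_mono (Nat.le_succ n) (ha.mem_varsBelow i)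

theorem wittX_coeff_succ (n i : ℕ) : (wittX p s ζ (n + 1)).coeff i =
    if i = n then compX p s ζ n else (wittX p s ζ n).coeff i := by
  rw [wittX_coeff, wittX_coeff]
  by_cases h : i = n
  · simp [h]
  · rw [if_neg h]; congr 1; simp only [eq_iff_iff]; omega

theorem wittY_coeff_succ (n i : ℕ) : (wittY p s ζ (n + 1)).coeff i =
    if i = n then compY p s ζ n else (wittY p s ζ n).coeff i := by
  rw [wittY_coeff, wittY_coeff]
  by_cases h : i = n
  · simp [h]
  · rw [if_neg h]; congr 1; simp only [eq_iff_iff]; omega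

theorem goodWitt_wittX (hs : 1 ≤ s) (hζ : IsPrimitiveRoot ζ (p ^ s)) {n : ℕ} (hn : n ≤ s) :
    GoodWitt ζ n (wittX p s ζ n) := by
  induction n with
  | zero => exact goodWitt_zero (fun i => by rw [wittX_coeff, if_neg (Nat.not_lt_zero i)]) 0
  | succ n ih =>
    have h := ih (by omega)
    obtain ⟨h0, hR, hv, -⟩ := compX_spec hs hζ (by omega) h
    exact goodWitt_succ h (wittX_coeff_succ n) h0 hR hv

variable (p s ζ) in
/-- The series `Z_n = E_{n+1} + λ Y_n`. -/
def serZ (n : ℕ) : MvPowerSeries (Fin s) K :=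
  seriesE p s ζ n + MvPowerSeries.C (lam p s ζ) * var s n

variable (p s ζ) in
/-- The series `Z_{n-1}`, with `Z_{-1} = 1`. -/
def prevZ : ℕ → MvPowerSeries (Fin s) K
  | 0 => 1
  | n + 1 => serZ p s ζ n

variable (p s ζ) in
/-- The variables `X_j`, `j < n`, as power series in the variables `Y_j`. -/
def famX : ℕ → Fin s → MvPowerSeries (Fin s) K
  | 0 => fun _ => 0
  | n + 1 => fun j => if (j : ℕ) = n then
      MvPowerSeries.C ((p : K) * lam p s ζ)⁻¹ * (serZ p s ζ n ^ p * (prevZ p s ζ n)⁻¹ -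
        MvPowerSeries.subst (famX n) (seriesG p s ζ n)) else famX n j

variable (p s ζ) in
/-- The induction hypothesis relating the two recursions. -/
structure GoodFam (n : ℕ) : Prop where
  zeroConst : ∀ i, (famX p s ζ n i).constantCoeff = 0
  mem_Rst : ∀ i, famX p s ζ n i ∈ Rst (baseRing p ζ) (Fin s)
  wittY : GoodWitt ζ n (wittY p s ζ n)
  subst_eq : ∀ i, MvPowerSeries.subst (famX p s ζ n) ((wittX p s ζ n).coeff i) =
    (KASW.wittY p s ζ n).coeff i
  EW_eq : EW p s ζ n (KASW.wittY p s ζ n) = prevZ p s ζ n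
  prevZ_mem : prevZ p s ζ n ∈ Rst (baseRing p ζ) (Fin s)
  constantCoeff_prevZ : (prevZ p s ζ n).constantCoeff = 1
  prevZ_cg : Cg (baseRing p ζ) (ζ - 1) (prevZ p s ζ n) 1

theorem GoodFam.hasSubst {n : ℕ} (h : GoodFam p s ζ n) : MvPowerSeries.HasSubst (famX p s ζ n) :=
  MvPowerSeries.hasSubst_of_constantCoeff_zero h.zeroConst

/-- Apply E_{n+1}^p = G_{n+1} E_n to the vector Y'. Here E_n(Y') is Z_{n-1}, and Y' is X' after
substitution. The point is that the right-hand side is restricted, although the base of the power on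
the left is only known to be integral. -/
theorem EW_pow_eq (hs : 1 ≤ s) (hζ : IsPrimitiveRoot ζ (p ^ s)) {n : ℕ} (hn : n < s)
    (h : GoodFam p s ζ n) : EW p s ζ (n + 1) (wittY p s ζ n) ^ p =
      MvPowerSeries.subst (famX p s ζ n) (GW p s ζ (n + 1) (wittX p s ζ n)) * prevZ p s ζ n := by
  have hX := goodWitt_wittX hs hζ hn.le
  rw [← GW_mul hζ (n + 1) h.wittY.zeroConst, Nat.add_sub_cancel, h.EW_eq]
  congr 1
  rw [GW_eq hζ n h.wittY.zeroConst, GW_eq hζ n hX.zeroConst, ← MvPowerSeries.coe_substAlgHom h.hasSubst,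
    map_prod]
  refine Finset.prod_congr rfl fun i _ => ?_
  rw [MvPowerSeries.coe_substAlgHom, subst_subst h.hasSubst (hX.zeroConst i), h.subst_eq]

/-- The properties of `E_{n+1}`. -/
theorem seriesE_spec (hs : 1 ≤ s) (hζ : IsPrimitiveRoot ζ (p ^ s)) {n : ℕ} (hn : n < s)
    (h : GoodFam p s ζ n) :
    (∃ q, polyHom (baseRing p ζ) (Fin s) q = seriesE p s ζ n) ∧
      seriesE p s ζ n ∈ varsBelow K s n ∧ (seriesE p s ζ n).constantCoeff = 1 ∧
      Cg (baseRing p ζ) (ζ - 1) (seriesE p s ζ n) 1 ∧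
      Cg (baseRing p ζ) (lam p s ζ) (EW p s ζ (n + 1) (wittY p s ζ n)) (seriesE p s ζ n) := by
  have hX := goodWitt_wittX hs hζ hn.le
  let a : baseRing p ζ := ⟨lam p s ζ, lam_mem s⟩
  have hVπ := EW_cg hs hζ (m := n + 1) hn h.wittY.zeroConst fun i => Rst_le_intS (h.wittY.mem_Rst i)
  have hV : EW p s ζ (n + 1) (wittY p s ζ n) ∈ intS (baseRing p ζ) (Fin s) :=
    hVπ.mem pi_mem (one_mem _)
  have hVp : EW p s ζ (n + 1) (wittY p s ζ n) ∈ polyMod a := by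
    -- V itself is not known to be restricted. Its p-th power is, and extracting the p-th root loses
    -- precision only from pλ to λ, exactly the precision of the truncation.
    refine mem_polyMod_lam_of_pow hs hζ hV ?_
    have h1 : EW p s ζ (n + 1) (wittY p s ζ n) ^ p ∈ Rst (baseRing p ζ) (Fin s) := by
      rw [EW_pow_eq hs hζ hn h]
      exact mul_mem (subst_mem_Rst h.zeroConst h.mem_Rst (GW_mem_Rst hs hζ hn hX.zeroConst hX.mem_Rst))
        h.prevZ_mem
    exact mem_Rst.1 h1 _ fun h => p_mul_lam_ne_zero hs hζ (congrArg (baseRing p ζ).subtype h)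
  have hP : ∀ c ∈ baseRing p ζ, c ≠ 0 →
      (nu p c < 1 / ((p : ℚ) - 1) ↔ ¬ ∃ y ∈ baseRing p ζ, c = a * y) :=
    fun c hc hc0 => nu_lt_iff hs hζ hc hc0
  have hcg := keepTerms_cg hV hP
  have hdef : seriesE p s ζ n = keepTerms (fun c => nu p c < 1 / ((p : ℚ) - 1))
      (EW p s ζ (n + 1) (wittY p s ζ n)) := rfl
  rw [hdef]
  refine ⟨exists_polyHom_eq_keepTerms hVp hP,
    keepTerms_mem_varsBelow (EW_mem_varsBelow h.wittY _) _,
    constantCoeff_keepTerms ?_ (constantCoeff_EW hζ _ h.wittY.zeroConst), ?_, hcg⟩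
  · rw [nu_one hζ]
    have hp1 : (1 : ℚ) < p := by exact_mod_cast hp.out.one_lt
    exact div_pos one_pos (by linarith)
  · obtain ⟨c, hc, hlc⟩ := exists_lam_eq (K := K) (p := p) (s := s) (ζ := ζ)
    have h1 : Cg (baseRing p ζ) ((ζ - 1) * c) (EW p s ζ (n + 1) (wittY p s ζ n))
        (seriesE p s ζ n) := by rw [← hlc, hdef]; exact hcg
    exact (h1.of_mul hc).symm.trans hVπ

/-- Congruent series modulo `λ` have congruent `p`-th powers modulo `pλ`. -/
theorem Cg.pow_prime (hs : 1 ≤ s) (hζ : IsPrimitiveRoot ζ (p ^ s)) {σ : Type*} {f g : MvPowerSeries σ K}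
    (h : Cg (baseRing p ζ) (lam p s ζ) f g) (hg : g ∈ intS (baseRing p ζ) σ) :
    Cg (baseRing p ζ) (p * lam p s ζ) (f ^ p) (g ^ p) := by
  obtain ⟨w, hw, rfl⟩ := h
  have hl := lam_mem (p := p) (ζ := ζ) s
  obtain ⟨r, hr, hpow⟩ := add_pow_prime (p := p) (intS (baseRing p ζ) σ) hg
    (mul_mem (C_mem_intS hl) hw)
  obtain ⟨y, hy, hy'⟩ := exists_lam_pow_eq hs hζ
  refine ⟨MvPowerSeries.C (-1 + (ζ - 1) * y) * w ^ p + g * w * r, add_mem (mul_mem (C_mem_intS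
    (add_mem (neg_mem (one_mem _)) (mul_mem pi_mem hy))) (pow_mem hw p)) (mul_mem (mul_mem hg hw) hr), ?_⟩
  rw [hpow, mul_pow, ← map_pow, hy', natCast_mul_C g, map_mul _ (p * lam p s ζ), map_mul]
  ring

/-- Restrictedness of Y_n' cannot be read off here as it was for X_n'; it follows in `GoodFam.succ`
from Y_n' being X_n' after a restricted substitution. -/
theorem compY_spec (hs : 1 ≤ s) (hζ : IsPrimitiveRoot ζ (p ^ s)) {n : ℕ} (hn : n < s)
    (h : GoodFam p s ζ n) :
    (serZ p s ζ n).constantCoeff = 1 ∧ (compY p s ζ n).constantCoeff = 0 ∧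
      compY p s ζ n ∈ varsBelow K s (n + 1) ∧
      ex (MvPowerSeries.C (lam p s ζ) * compY p s ζ n) * EW p s ζ (n + 1) (wittY p s ζ n) =
        serZ p s ζ n := by
  obtain ⟨-, hEv, hE0, -, -⟩ := seriesE_spec hs hζ hn h
  set V := EW p s ζ (n + 1) (wittY p s ζ n) with hVdef
  have hV0 : V.constantCoeff = 1 := constantCoeff_EW hζ _ h.wittY.zeroConst
  have hVV : V * V⁻¹ = 1 := MvPowerSeries.mul_inv_cancel V (by rw [hV0]; exact one_ne_zero)
  have hZ0 : (serZ p s ζ n).constantCoeff = 1 := by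
    rw [serZ, map_add, map_mul, constantCoeff_var, mul_zero, add_zero, hE0]
  have hr0 := constantCoeff_mul_inv hZ0 hV0
  have hVv : V ∈ varsBelow K s n := EW_mem_varsBelow h.wittY _
  have hZv : serZ p s ζ n ∈ varsBelow K s (n + 1) := add_mem (varsBelow_mono (Nat.le_succ n) hEv)
    (mul_mem (C_mem_varsBelow _ _) (var_mem_varsBelow n))
  refine ⟨hZ0, constantCoeff_C_inv_mul_ln hr0 _, ?_, ?_⟩
  · refine mul_mem (C_mem_varsBelow _ _) (subst_mem_varsBelow (sub_mem (mul_mem hZv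
      (varsBelow_mono (Nat.le_succ n) (inv_mem_varsBelow hVv hV0))) (one_mem _)) ?_ _)
    change MvPowerSeries.constantCoeff (serZ p s ζ n * V⁻¹ - 1) = 0
    rw [map_sub, hr0, map_one, sub_self]
  · have h1 : ex (MvPowerSeries.C (lam p s ζ) * compY p s ζ n) = serZ p s ζ n * V⁻¹ :=
      ex_C_mul_ln hr0 (lam_ne_zero hs hζ)
    rw [h1, mul_assoc, mul_comm V⁻¹, hVV, mul_one]

theorem constantCoeff_subst_of_zero {σ τ : Type*} [Finite σ] {a : σ → MvPowerSeries τ K}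
    (ha : ∀ i, (a i).constantCoeff = 0) (f : MvPowerSeries σ K) :
    (MvPowerSeries.subst a f).constantCoeff = f.constantCoeff := by
  have hs := MvPowerSeries.hasSubst_of_constantCoeff_zero ha
  rw [MvPowerSeries.constantCoeff_subst hs, finsum_eq_single _ 0]
  · simp
  · intro d hd
    obtain ⟨i, hi⟩ := Finsupp.ne_iff.1 hd
    rw [map_finsuppProd, Finsupp.prod, Finset.prod_eq_zero (i := i), smul_zero]
    · simpa using hi
    · rw [map_pow, ha i]; exact zero_pow (by simpa using hi)

/-- The properties of the series `X_n`. -/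
theorem famX_spec (hs : 1 ≤ s) (hζ : IsPrimitiveRoot ζ (p ^ s)) {n : ℕ} (hn : n < s)
    (h : GoodFam p s ζ n) :
    (famX p s ζ (n + 1) ⟨n, hn⟩).constantCoeff = 0 ∧
      famX p s ζ (n + 1) ⟨n, hn⟩ ∈ Rst (baseRing p ζ) (Fin s) ∧
      serZ p s ζ n ^ p = prevZ p s ζ n * (MvPowerSeries.subst (famX p s ζ n) (seriesG p s ζ n) +
        MvPowerSeries.C (p * lam p s ζ) * famX p s ζ (n + 1) ⟨n, hn⟩) ∧
      Cg (baseRing p ζ) (p * lam p s ζ) (seriesE p s ζ n ^ p)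
        (prevZ p s ζ n * MvPowerSeries.subst (famX p s ζ n) (seriesG p s ζ n)) := by
  have hX := goodWitt_wittX hs hζ hn.le
  have hG := seriesG_spec hs hζ hn hX
  have hE := seriesE_spec hs hζ hn h
  obtain ⟨hZ0, -, -, -⟩ := compY_spec hs hζ hn h
  set V := EW p s ζ (n + 1) (wittY p s ζ n) with hVdef
  have hVp := EW_pow_eq hs hζ hn h
  rw [← hVdef] at hVp
  set P := prevZ p s ζ n with hPdef
  set g := MvPowerSeries.subst (famX p s ζ n) (seriesG p s ζ n) with hg
  have hpl := p_mul_lam_ne_zero hs hζ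
  have hP0 := h.constantCoeff_prevZ
  have hPP : P * P⁻¹ = 1 := MvPowerSeries.mul_inv_cancel P (by
    rw [hPdef, h.constantCoeff_prevZ]; exact one_ne_zero)
  have hPi : P⁻¹ ∈ Rst (baseRing p ζ) (Fin s) := inv_mem_Rst hs hζ h.prevZ_mem hP0 h.prevZ_cg
  obtain ⟨⟨q, hq⟩, -, hG0, -, hUG⟩ := hG
  obtain ⟨⟨e, he⟩, -, -, -, hVE⟩ := hE
  have hER : seriesE p s ζ n ∈ Rst (baseRing p ζ) (Fin s) := he ▸ polyHom_mem_Rst e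
  have hEi := Rst_le_intS hER
  have hVi : V ∈ intS (baseRing p ζ) (Fin s) := hVE.mem (lam_mem s) hEi
  have hZR : serZ p s ζ n ∈ Rst (baseRing p ζ) (Fin s) :=
    add_mem hER (mul_mem (C_mem_Rst (lam_mem s)) (var_mem_Rst _ n))
  have hgR : g ∈ Rst (baseRing p ζ) (Fin s) := by
    rw [hg, ← hq]; exact subst_mem_Rst h.zeroConst h.mem_Rst (polyHom_mem_Rst q)
  have hVg : Cg (baseRing p ζ) (p * lam p s ζ) (V ^ p) (P * g) := by
    rw [hVp, mul_comm _ P]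
    exact (Cg.refl _ P).mul ((hUG.of_mul pi_mem).subst h.zeroConst fun i => Rst_le_intS (h.mem_Rst i))
      (Rst_le_intS h.prevZ_mem) (subst_mem_intS h.zeroConst (fun i => Rst_le_intS (h.mem_Rst i))
        (Rst_le_intS (GW_mem_Rst hs hζ hn hX.zeroConst hX.mem_Rst)))
  have hZE : Cg (baseRing p ζ) (lam p s ζ) (serZ p s ζ n) (seriesE p s ζ n) :=
    ⟨var s n, Rst_le_intS (var_mem_Rst _ n), rfl⟩
  -- Z_n ≡ E_{n+1} ≡ V modulo λ, hence Z_n^p ≡ V^p ≡ Z_{n-1} G_{n+1} modulo pλ. Dividing the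
  -- difference by pλ and by Z_{n-1} gives an integral X_n.
  have hZV := (hZE.trans hVE.symm).pow_prime hs hζ hVi
  obtain ⟨t, ht, hZt⟩ := hZV.trans hVg
  have hx : famX p s ζ (n + 1) ⟨n, hn⟩ = P⁻¹ * t := by
    have h1 : famX p s ζ (n + 1) ⟨n, hn⟩ = MvPowerSeries.C ((p : K) * lam p s ζ)⁻¹ *
        (serZ p s ζ n ^ p * P⁻¹ - g) := if_pos rfl
    rw [h1, hZt]
    refine C_mul_cancel hpl ?_
    rw [← mul_assoc, ← map_mul, mul_inv_cancel₀ hpl, map_one, one_mul]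
    linear_combination g * hPP
  have hxi : famX p s ζ (n + 1) ⟨n, hn⟩ ∈ intS (baseRing p ζ) (Fin s) := by
    rw [hx]; exact mul_mem (Rst_le_intS hPi) ht
  have heq : serZ p s ζ n ^ p = P * (g + MvPowerSeries.C (p * lam p s ζ) *
      famX p s ζ (n + 1) ⟨n, hn⟩) := by
    rw [hx, hZt]
    linear_combination (-MvPowerSeries.C (p * lam p s ζ) * t) * hPP
  have hCx : MvPowerSeries.C (p * lam p s ζ) * famX p s ζ (n + 1) ⟨n, hn⟩ =
      serZ p s ζ n ^ p * P⁻¹ - g := by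
    linear_combination (-P⁻¹) * heq - (g + MvPowerSeries.C (p * lam p s ζ) *
      famX p s ζ (n + 1) ⟨n, hn⟩) * hPP
  refine ⟨?_, ?_, heq, (hVE.symm.pow_prime hs hζ hVi).trans hVg⟩
  · have h1 := congrArg MvPowerSeries.constantCoeff hCx
    have hg0 : g.constantCoeff = 1 := by rw [hg, constantCoeff_subst_of_zero h.zeroConst, hG0]
    have h2 : (serZ p s ζ n ^ p * P⁻¹).constantCoeff = 1 :=
      constantCoeff_mul_inv (by rw [map_pow, hZ0, one_pow]) hP0
    rw [map_mul MvPowerSeries.constantCoeff, MvPowerSeries.constantCoeff_C, map_sub, h2, hg0,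
      sub_self] at h1
    exact (mul_eq_zero.1 h1).resolve_left hpl
  -- Integrality being known, it suffices that pλX_n = Z_n^p/Z_{n-1} - G_{n+1} is restricted.
  · refine mem_Rst_of_C_mul_mem (a := ⟨p * lam p s ζ, p_mul_lam_mem⟩)
        (fun h => hpl (congrArg (baseRing p ζ).subtype h)) hxi ?_
    change MvPowerSeries.C (p * lam p s ζ) * famX p s ζ (n + 1) ⟨n, hn⟩ ∈ _
    rw [hCx]
    exact sub_mem (mul_mem (pow_mem hZR p) hPi) hgR

/-- The crux is that X_n' becomes Y_n' after substitution. Indeed exp(λY_n')^p = Z_n^p/V^p =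
(Z_{n-1}u_n)/(Z_{n-1}U) = u_n/U, which is exp(pλX_n') after substitution, and the formal exponential
is injective. This also gives the restrictedness of Y_n'. -/
theorem GoodFam.succ (hs : 1 ≤ s) (hζ : IsPrimitiveRoot ζ (p ^ s)) {n : ℕ} (hn : n < s)
    (h : GoodFam p s ζ n) : GoodFam p s ζ (n + 1) := by
  have hX := goodWitt_wittX hs hζ hn.le
  have hX1 := goodWitt_wittX hs hζ (n := n + 1) hn
  obtain ⟨hx0, hxR, hZp, -⟩ := famX_spec hs hζ hn h
  obtain ⟨hcX0, hcXR, hcXv, hcXe⟩ := compX_spec hs hζ hn hX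
  obtain ⟨⟨e, he⟩, hEv, hE0, hEπ, hVE⟩ := seriesE_spec hs hζ hn h
  obtain ⟨hZ0, hY0, hYv, hYe⟩ := compY_spec hs hζ hn h
  obtain ⟨-, hGv, hG0, -, -⟩ := seriesG_spec hs hζ hn hX
  have hfam (i : Fin s) : famX p s ζ (n + 1) i = if (i : ℕ) = n then famX p s ζ (n + 1) ⟨n, hn⟩
      else famX p s ζ n i := by
    split_ifs with hi
    · congr 1; exact Fin.ext hi
    · exact if_neg hi
  have hz : ∀ i, (famX p s ζ (n + 1) i).constantCoeff = 0 := fun i => by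
    rw [hfam]; split_ifs
    · exact hx0
    · exact h.zeroConst i
  have hR : ∀ i, famX p s ζ (n + 1) i ∈ Rst (baseRing p ζ) (Fin s) := fun i => by
    rw [hfam]; split_ifs
    · exact hxR
    · exact h.mem_Rst i
  have hsub := MvPowerSeries.hasSubst_of_constantCoeff_zero hz
  have hcongr {f : MvPowerSeries (Fin s) K} (hf : f ∈ varsBelow K s n) :
      MvPowerSeries.subst (famX p s ζ (n + 1)) f = MvPowerSeries.subst (famX p s ζ n) f :=
    subst_congr_of_mem_varsBelow hf hz h.zeroConst fun i hi => by rw [hfam, if_neg hi.ne]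
  have hpl := p_mul_lam_ne_zero hs hζ
  set V := EW p s ζ (n + 1) (KASW.wittY p s ζ n) with hVdef
  set x := famX p s ζ (n + 1) with hxdef
  set U := GW p s ζ (n + 1) (wittX p s ζ n) with hUdef
  have hV0 : V.constantCoeff = 1 := constantCoeff_EW hζ _ h.wittY.zeroConst
  have hVne : V ≠ 0 := fun h0 => by rw [h0, map_zero] at hV0; exact zero_ne_one hV0
  have hP0 : prevZ p s ζ n ≠ 0 := fun h0 => by
    have := h.constantCoeff_prevZ
    rw [h0, map_zero] at this; exact zero_ne_one this
  have hlX0 : (MvPowerSeries.C ((p : K) * lam p s ζ) * compX p s ζ n).constantCoeff = 0 := by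
    rw [map_mul, hcX0, mul_zero]
  have hlY0 : (MvPowerSeries.C (lam p s ζ) * compY p s ζ n).constantCoeff = 0 := by
    rw [map_mul, hY0, mul_zero]
  have hsX0 : (MvPowerSeries.subst x (compX p s ζ n)).constantCoeff = 0 := by
    rw [constantCoeff_subst_of_zero hz, hcX0]
  -- the last components correspond
  have hlast : MvPowerSeries.subst x (compX p s ζ n) = compY p s ζ n := by
    have h1 := congrArg (MvPowerSeries.subst x) hcXe
    have hvar : MvPowerSeries.subst x (var s n : MvPowerSeries (Fin s) K) = x ⟨n, hn⟩ := by
      rw [var, dif_pos hn, MvPowerSeries.subst_X hsub]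
    rw [MvPowerSeries.subst_mul hsub, subst_ex hsub hlX0, subst_C_mul hsub,
      MvPowerSeries.subst_add hsub, subst_C_mul hsub, hvar, hcongr hGv,
      hcongr (GW_mem_varsBelow hζ hX n)] at h1
    have h2 := EW_pow_eq hs hζ hn h
    rw [← hVdef, ← hUdef] at h2
    have h3 : ex (MvPowerSeries.C ((p : K) * lam p s ζ) * MvPowerSeries.subst x (compX p s ζ n)) =
        ex (MvPowerSeries.C ((p : K) * lam p s ζ) * compY p s ζ n) := by
      refine mul_right_cancel₀ (mul_ne_zero (pow_ne_zero p hVne) (one_ne_zero (α := MvPowerSeries (Fin s) K))) ?_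
      have h4 : ex (MvPowerSeries.C ((p : K) * lam p s ζ) * compY p s ζ n) =
          ex (MvPowerSeries.C (lam p s ζ) * compY p s ζ n) ^ p := by
        rw [ex_pow hlY0, map_mul, map_natCast, mul_assoc]
      rw [h4, mul_one, ← mul_pow, hYe, hZp, ← h1, h2]
      ring
    have h5 := ex_injective (by rw [map_mul, hsX0, mul_zero]) (by rw [map_mul, hY0, mul_zero]) h3
    exact C_mul_cancel hpl h5
  have hYR : compY p s ζ n ∈ Rst (baseRing p ζ) (Fin s) := by
    rw [← hlast]; exact subst_mem_Rst hz hR hcXR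
  have hW : GoodWitt ζ (n + 1) (KASW.wittY p s ζ (n + 1)) :=
    goodWitt_succ h.wittY (wittY_coeff_succ n) hY0 hYR hYv
  have hZeq : prevZ p s ζ (n + 1) = seriesE p s ζ n + MvPowerSeries.C (lam p s ζ) * var s n := rfl
  refine ⟨hz, hR, hW, fun i => ?_, ?_, ?_, hZ0, ?_⟩
  · rw [wittX_coeff_succ, wittY_coeff_succ]
    split_ifs
    · exact hlast
    · rw [hcongr (hX.mem_varsBelow i), h.subst_eq]
  · rw [EW_update hs hζ n h.wittY.zeroConst hW.zeroConst
      (by rw [wittY_coeff, if_neg (lt_irrefl n)]) (fun i hi => by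
        rw [wittY_coeff_succ, if_neg hi.ne]), wittY_coeff_succ, if_pos rfl]
    exact hYe
  · rw [hZeq, ← he]
    exact add_mem (polyHom_mem_Rst e) (mul_mem (C_mem_Rst (lam_mem s)) (var_mem_Rst _ n))
  · obtain ⟨c, hc, hlc⟩ := exists_lam_eq (K := K) (p := p) (s := s) (ζ := ζ)
    rw [hZeq]
    have h1 : Cg (baseRing p ζ) (ζ - 1) (seriesE p s ζ n + MvPowerSeries.C (lam p s ζ) * var s n)
        (seriesE p s ζ n) := ⟨MvPowerSeries.C c * var s n, mul_mem (C_mem_intS hc)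
          (Rst_le_intS (var_mem_Rst _ n)), by rw [hlc, map_mul, mul_assoc]⟩
    exact h1.trans hEπ

theorem goodFam (hs : 1 ≤ s) (hζ : IsPrimitiveRoot ζ (p ^ s)) {n : ℕ} (hn : n ≤ s) :
    GoodFam p s ζ n := by
  induction n with
  | zero =>
    have h0 (i) : (wittY p s ζ 0).coeff i = 0 := by rw [wittY_coeff, if_neg (Nat.not_lt_zero i)]
    refine ⟨fun _ => map_zero _, fun _ => zero_mem _, goodWitt_zero h0 0, fun i => ?_, ?_,
      one_mem _, map_one _, Cg.refl _ _⟩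
    · rw [h0, wittX_coeff, if_neg (Nat.not_lt_zero i), ← MvPowerSeries.coe_substAlgHom
        (a := famX p s ζ 0) (MvPowerSeries.hasSubst_of_constantCoeff_zero fun _ => map_zero _), map_zero]
    · rw [EW, Finset.range_zero, Finset.prod_empty]; rfl
  | succ n ih => exact (ih (by omega)).succ hs hζ (by omega)

end Recursion

/-! ### Summary of the power series computations as statements on polynomials. -/

section Output

variable {K : Type*} [Field K] [CharZero K] {p s : ℕ} [hp : Fact p.Prime] {ζ : K}

theorem vars_lt_of_mem_varsBelow {R : Subring K} {q : MvPolynomial (Fin s) R} {n : ℕ}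
    (h : polyHom R (Fin s) q ∈ varsBelow K s n) : ∀ j ∈ q.vars, (j : ℕ) < n := by
  intro j hj
  rw [MvPolynomial.mem_vars_iff_mem_support] at hj
  obtain ⟨m, hm, hjm⟩ := hj
  by_contra hcon
  refine (Finsupp.mem_support_iff.1 hjm) (h m ?_ j (not_lt.1 hcon))
  rw [coeff_polyHom]
  simpa using MvPolynomial.mem_support_iff.1 hm

theorem algebraMap_mvPowerSeries {R : Subring K} {τ : Type*} (r : R) :
    algebraMap R (MvPowerSeries τ K) r = MvPowerSeries.C (r : K) := by
  rw [MvPowerSeries.algebraMap_apply]; rfl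

theorem aeval_eq_subst_polyHom {R : Subring K} {σ τ : Type*} {a : σ → MvPowerSeries τ K}
    (ha : MvPowerSeries.HasSubst a) (q : MvPolynomial σ R) :
    MvPolynomial.aeval a q = MvPowerSeries.subst a (polyHom R σ q) := by
  rw [subst_polyHom ha, MvPolynomial.aeval_def]
  congr 1
  exact RingHom.ext algebraMap_mvPowerSeries

variable (p s ζ) in
/-- The series `Z_{i-1}`. -/
def powZ (i : Fin (s + 1)) : MvPowerSeries (Fin s) K := prevZ p s ζ i

variable (p s ζ) in
/-- The variables `X_i` as power series in the variables `Y_j`. -/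
def powX : Fin s → MvPowerSeries (Fin s) K := famX p s ζ s

theorem exists_eq_one_add_of_cg {R : Subring K} {σ : Type*} {a : R} {q : MvPolynomial σ R}
    (h : Cg R (a : K) (polyHom R σ q) 1) : ∃ r, q = 1 + MvPolynomial.C a * r := by
  obtain ⟨r, hr⟩ : MvPolynomial.C a ∣ q - 1 := by
    rw [MvPolynomial.C_dvd_iff_dvd_coeff]
    intro m
    obtain ⟨y, hy, hm⟩ := cg_iff.1 h m
    have h1 : polyHom R σ 1 = 1 := map_one _
    rw [← h1, coeff_polyHom, coeff_polyHom] at hm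
    refine ⟨⟨y, hy⟩, ?_⟩
    ext
    rw [MvPolynomial.coeff_sub]
    push_cast
    rw [hm]; ring
  exact ⟨r, by rw [← hr]; ring⟩

theorem famX_eq_of_lt {m n : ℕ} (hmn : m ≤ n) (i : Fin s) (hi : (i : ℕ) < m) :
    famX p s ζ n i = famX p s ζ m i := by
  induction n, hmn using Nat.le_induction with
  | base => rfl
  | succ n hn ih => exact (if_neg (by omega)).trans ih

variable [IsCyclotomicExtension {p ^ s} ℚ K]

/-- The polynomials `G_i` and `E_i`, and the solution in power series of the equations relating
the variables `X_i` and `Y_i`. -/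
theorem exists_polynomials (hs : 1 ≤ s) (hζ : IsPrimitiveRoot ζ (p ^ s)) :
    ∃ G E : Fin s → MvPolynomial (Fin s) (baseRing p ζ),
      (∀ i, IsPolynomialFor (G i) (seriesG p s ζ i) ∧ ∀ j ∈ (G i).vars, j < i) ∧
      (∀ i, IsPolynomialFor (E i) (seriesE p s ζ i) ∧ ∀ j ∈ (E i).vars, j < i) ∧
      (∀ i, ∃ r, G i = 1 + MvPolynomial.C (unif p ζ) * r) ∧
      (∀ i, ∃ r, E i = 1 + MvPolynomial.C (unif p ζ) * r) ∧
      (∀ i, powX p s ζ i ∈ intS (baseRing p ζ) (Fin s)) ∧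
      (∀ i, (powZ p s ζ i).constantCoeff = 1) ∧
      (∀ i : Fin s, powZ p s ζ i.succ = polyHom _ _ (E i) +
        MvPowerSeries.C (lam p s ζ) * MvPowerSeries.X i) ∧
      (∀ i : Fin s, powZ p s ζ i.succ ^ p = powZ p s ζ i.castSucc *
        (MvPolynomial.aeval (powX p s ζ) (G i) +
          MvPowerSeries.C (p * lam p s ζ) * powX p s ζ i)) ∧
      (∀ i : Fin s, Cg (baseRing p ζ) (p * lam p s ζ) (polyHom _ _ (E i) ^ p)
        (powZ p s ζ i.castSucc * MvPolynomial.aeval (powX p s ζ) (G i))) := by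
  have hfin := goodFam hs hζ (le_refl s)
  have hG (i : Fin s) := seriesG_spec hs hζ i.2 (goodWitt_wittX hs hζ i.2.le)
  have hE (i : Fin s) := seriesE_spec hs hζ i.2 (goodFam hs hζ i.2.le)
  have hF (i : Fin s) := famX_spec hs hζ i.2 (goodFam hs hζ i.2.le)
  choose G hGp using fun i => (hG i).1
  choose E hEp using fun i => (hE i).1
  have hx (i : Fin s) : powX p s ζ i = famX p s ζ (i + 1) i :=
    famX_eq_of_lt (m := i + 1) (n := s) i.2 i (Nat.lt_succ_self _)
  have hGx (i : Fin s) : MvPolynomial.aeval (powX p s ζ) (G i) =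
      MvPowerSeries.subst (famX p s ζ i) (seriesG p s ζ i) := by
    rw [aeval_eq_subst_polyHom (a := powX p s ζ) hfin.hasSubst, hGp]
    exact subst_congr_of_mem_varsBelow (hG i).2.1 hfin.zeroConst
      (goodFam hs hζ i.2.le).zeroConst fun j hj => famX_eq_of_lt i.2.le j hj
  refine ⟨G, E, fun i => ⟨hGp i, vars_lt_of_mem_varsBelow (by rw [hGp]; exact (hG i).2.1)⟩,
    fun i => ⟨hEp i, vars_lt_of_mem_varsBelow (by rw [hEp]; exact (hE i).2.1)⟩,
    fun i => exists_eq_one_add_of_cg (by rw [hGp]; exact (hG i).2.2.2.1),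
    fun i => exists_eq_one_add_of_cg (by rw [hEp]; exact (hE i).2.2.2.1),
    fun i => Rst_le_intS (hfin.mem_Rst i), fun i => ?_, fun i => ?_, fun i => ?_, fun i => ?_⟩
  · exact (goodFam hs hζ (Nat.lt_succ_iff.1 i.2)).constantCoeff_prevZ
  · have : var s (i : ℕ) = (MvPowerSeries.X i : MvPowerSeries (Fin s) K) := dif_pos i.2
    rw [hEp, ← this]; rfl
  · rw [hGx, hx]; exact (hF i).2.2.1
  · rw [hGx, hEp]; exact (hF i).2.2.2

end Output

/-! ### Localised polynomial rings inside a field. -/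

section LocalizedPolynomials

variable {R : Type*} [CommRing R] {L : Type*} [Field L] [Algebra R L] {σ : Type*} [Fintype σ]

/-- The subalgebra generated by the elements `t_i` and by the inverses of the elements
`D_i(t)`. -/
def adjoinInv (t : σ → L) (D : σ → MvPolynomial σ R) : Subalgebra R L :=
  Algebra.adjoin R {a | ∃ i, a = t i ∨ a = (MvPolynomial.aeval t (D i))⁻¹}

variable {t : σ → L} {D : σ → MvPolynomial σ R}

theorem mem_adjoinInv (i : σ) : t i ∈ adjoinInv t D := Algebra.subset_adjoin ⟨i, Or.inl rfl⟩

theorem inv_mem_adjoinInv (i : σ) : (MvPolynomial.aeval t (D i))⁻¹ ∈ adjoinInv t D :=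
  Algebra.subset_adjoin ⟨i, Or.inr rfl⟩

theorem aeval_mem_adjoinInv (f : MvPolynomial σ R) : MvPolynomial.aeval t f ∈ adjoinInv t D := by
  rw [MvPolynomial.aeval_def, MvPolynomial.eval₂_eq]
  exact sum_mem fun d _ => mul_mem (Subalgebra.algebraMap_mem _ _)
    (prod_mem fun i _ => pow_mem (mem_adjoinInv i) _)

variable (t D) in
/-- The map from the polynomial ring to its localization `adjoinInv t D`. -/
def toAdjoinInv : MvPolynomial σ R →ₐ[R] adjoinInv t D :=
  (MvPolynomial.aeval t).codRestrict _ aeval_mem_adjoinInv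

theorem exists_mul_pow_eq (hD : ∀ i, MvPolynomial.aeval t (D i) ≠ 0) {a : L}
    (ha : a ∈ adjoinInv t D) : ∃ (n : ℕ) (f : MvPolynomial σ R),
      a * MvPolynomial.aeval t (∏ i, D i) ^ n = MvPolynomial.aeval t f := by
  classical
  induction ha using Algebra.adjoin_induction with
  | mem x hx =>
    obtain ⟨i, rfl | rfl⟩ := hx
    · exact ⟨0, MvPolynomial.X i, by simp⟩
    · refine ⟨1, ∏ j ∈ Finset.univ.erase i, D j, ?_⟩
      rw [pow_one, ← Finset.mul_prod_erase _ _ (Finset.mem_univ i), map_mul,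
        inv_mul_cancel_left₀ (hD i)]
  | algebraMap r => exact ⟨0, MvPolynomial.C r, by simp⟩
  | add x y _ _ hx hy =>
    obtain ⟨m, f, hf⟩ := hx
    obtain ⟨n, g, hg⟩ := hy
    refine ⟨m + n, f * (∏ i, D i) ^ n + g * (∏ i, D i) ^ m, ?_⟩
    rw [map_add, map_mul, map_mul, map_pow, map_pow, ← hf, ← hg]; ring
  | mul x y _ _ hx hy =>
    obtain ⟨m, f, hf⟩ := hx
    obtain ⟨n, g, hg⟩ := hy
    refine ⟨m + n, f * g, ?_⟩
    rw [map_mul, ← hf, ← hg]; ring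

theorem isUnit_toAdjoinInv (hD : ∀ i, MvPolynomial.aeval t (D i) ≠ 0) (i : σ) :
    IsUnit (toAdjoinInv t D (D i)) :=
  IsUnit.of_mul_eq_one ⟨_, inv_mem_adjoinInv i⟩ (Subtype.ext (mul_inv_cancel₀ (hD i)))

theorem isLocalization_adjoinInv (ht : AlgebraicIndependent R t)
    (hD : ∀ i, MvPolynomial.aeval t (D i) ≠ 0) :
    letI := (toAdjoinInv t D).toRingHom.toAlgebra
    IsLocalization.Away (∏ i, D i) (adjoinInv t D) := by
  let _ := (toAdjoinInv t D).toRingHom.toAlgebra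
  refine IsLocalization.Away.mk _ ?_ (fun a => ?_) (fun a b hab => ?_)
  · change IsUnit (toAdjoinInv t D _)
    rw [map_prod]
    exact IsUnit.prod_univ_iff.2 fun i => isUnit_toAdjoinInv hD i
  · obtain ⟨n, f, h⟩ := exists_mul_pow_eq hD a.2
    exact ⟨n, f, Subtype.ext h⟩
  · refine ⟨0, ?_⟩
    have : a = b := ht (congrArg Subtype.val hab)
    rw [this]

theorem smooth_adjoinInv (ht : AlgebraicIndependent R t)
    (hD : ∀ i, MvPolynomial.aeval t (D i) ≠ 0) : Algebra.Smooth R (adjoinInv t D) := by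
  let _ := (toAdjoinInv t D).toRingHom.toAlgebra
  have hloc := isLocalization_adjoinInv ht hD
  have : IsScalarTower R (MvPolynomial σ R) (adjoinInv t D) :=
    IsScalarTower.of_algebraMap_eq fun r => ((toAdjoinInv t D).commutes r).symm
  have : Algebra.Smooth R (MvPolynomial σ R) := ⟨inferInstance, inferInstance⟩
  have := Algebra.Smooth.of_isLocalization_Away (A := adjoinInv t D) (∏ i, D i)
  exact Algebra.Smooth.comp R (MvPolynomial σ R) (adjoinInv t D)

/-- The ring is a localisation of a polynomial ring over a factorial ring, and normality passes to
localisations. -/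
theorem isIntegrallyClosed_adjoinInv [IsDomain R] [UniqueFactorizationMonoid R]
    (ht : AlgebraicIndependent R t) (hD : ∀ i, MvPolynomial.aeval t (D i) ≠ 0) :
    IsIntegrallyClosed (adjoinInv t D) := by
  let _ := (toAdjoinInv t D).toRingHom.toAlgebra
  have hloc := isLocalization_adjoinInv ht hD
  have : IsDomain (MvPolynomial σ R) := inferInstance
  have : UniqueFactorizationMonoid (MvPolynomial σ R) := inferInstance
  refine isIntegrallyClosed_of_isLocalization (R := MvPolynomial σ R) (adjoinInv t D)
    (Submonoid.powers (∏ i, D i)) ?_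
  rw [Submonoid.powers_le, mem_nonZeroDivisors_iff_ne_zero]
  intro h0
  have h1 : MvPolynomial.aeval t (∏ i, D i) = 0 := by rw [h0, map_zero]
  rw [map_prod, Finset.prod_eq_zero_iff] at h1
  obtain ⟨i, -, hi⟩ := h1
  exact hD i hi

/-- An element of the fraction field of an integrally closed subring which is integral over this
subring belongs to it. -/
theorem mem_of_isIntegral_of_mul_mem {S : Subalgebra R L} [IsIntegrallyClosed S] {a b : L}
    (hb : b ∈ S) (hb0 : b ≠ 0) (hab : a * b ∈ S) (ha : IsIntegral S a) : a ∈ S := by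
  let F := FractionRing S
  let f : F →ₐ[S] L := IsFractionRing.liftAlgHom (g := Algebra.ofId S L) Subtype.val_injective
  have hf : Function.Injective f := f.toRingHom.injective
  obtain ⟨y, hy⟩ : ∃ y : F, f y = a := by
    refine ⟨algebraMap S F ⟨a * b, hab⟩ / algebraMap S F ⟨b, hb⟩, ?_⟩
    rw [map_div₀, f.commutes, f.commutes]
    exact mul_div_cancel_right₀ a hb0
  rw [← hy, isIntegral_algHom_iff f hf, IsIntegrallyClosed.isIntegral_iff] at ha
  obtain ⟨z, hz⟩ := ha
  rw [← hy, ← hz, f.commutes]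
  exact z.2

end LocalizedPolynomials

/-! ### Normality and reduction of the coordinate rings. -/

section BaseLocalized

variable {K : Type*} [Field K] [CharZero K] {p s : ℕ} [hp : Fact p.Prime] {ζ : K}
variable [IsCyclotomicExtension {p ^ s} ℚ K] {L : Type*} [Field L] [Algebra K L]

theorem algebraMap_baseRing (r : baseRing p ζ) :
    algebraMap (baseRing p ζ) L r = algebraMap K L r := rfl

theorem algebraicIndependent_baseRing {σ : Type*} {t : σ → L} (ht : AlgebraicIndependent K t) :
    AlgebraicIndependent (baseRing p ζ) t :=
  ht.restrictScalars (K := K) (R := baseRing p ζ) Subtype.val_injective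

theorem ne_zero_of_eq_one_add (hs : 1 ≤ s) (hζ : IsPrimitiveRoot ζ (p ^ s)) {σ : Type*}
    {D r : MvPolynomial σ (baseRing p ζ)} (h : D = 1 + MvPolynomial.C (unif p ζ) * r) : D ≠ 0 := by
  intro h0
  have h1 := congrArg (MvPolynomial.coeff 0) h
  rw [h0, MvPolynomial.coeff_zero, MvPolynomial.coeff_add, MvPolynomial.coeff_C_mul,
    MvPolynomial.coeff_zero_one] at h1
  refine pi_mul_ne_one hs hζ (neg_mem (r.coeff 0).2) ?_
  have h2 := congrArg (baseRing p ζ).subtype h1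
  have h3 : (0 : K) = 1 + (ζ - 1) * (r.coeff 0 : baseRing p ζ) := h2
  linear_combination h3

theorem aeval_ne_zero (hs : 1 ≤ s) (hζ : IsPrimitiveRoot ζ (p ^ s)) {σ : Type*} {t : σ → L}
    (ht : AlgebraicIndependent K t) {D : MvPolynomial σ (baseRing p ζ)}
    (h : ∃ r, D = 1 + MvPolynomial.C (unif p ζ) * r) : MvPolynomial.aeval t D ≠ 0 := by
  obtain ⟨r, hr⟩ := h
  intro h0
  exact ne_zero_of_eq_one_add hs hζ hr ((algebraicIndependent_baseRing ht).eq_zero_of_aeval_eq_zero _ h0)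

/-- The integral elements of `K(t)` over `adjoinInv t D` belong to it. -/
theorem mem_adjoinInv_of_isIntegral (hs : 1 ≤ s) (hζ : IsPrimitiveRoot ζ (p ^ s)) {σ : Type*}
    [Fintype σ] {t : σ → L} (ht : AlgebraicIndependent K t) {D : σ → MvPolynomial σ (baseRing p ζ)}
    (hD : ∀ i, ∃ r, D i = 1 + MvPolynomial.C (unif p ζ) * r) {a : L}
    (ha : a ∈ IntermediateField.adjoin K (Set.range t)) (hint : IsIntegral (adjoinInv t D) a) :
    a ∈ adjoinInv t D := by
  have := isDiscreteValuationRing_baseRing hs hζ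
  have := isIntegrallyClosed_adjoinInv (algebraicIndependent_baseRing ht)
    fun i => aeval_ne_zero hs hζ ht (hD i)
  have hmul (q : MvPolynomial σ K) : ∃ n : ℕ, n ≠ 0 ∧ (n : L) * MvPolynomial.aeval t q ∈ adjoinInv t D := by
    induction q using MvPolynomial.induction_on with
    | C a =>
      obtain ⟨n, hn, h⟩ := exists_natCast_mul_mem hζ a
      refine ⟨n, hn, ?_⟩
      have h1 := (adjoinInv t D).algebraMap_mem ⟨_, h⟩
      rw [algebraMap_baseRing] at h1
      simpa using h1
    | add f g hf hg =>
      obtain ⟨m, hm, hf⟩ := hf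
      obtain ⟨n, hn, hg⟩ := hg
      refine ⟨m * n, mul_ne_zero hm hn, ?_⟩
      convert add_mem (mul_mem (natCast_mem (adjoinInv t D) n) hf)
        (mul_mem (natCast_mem (adjoinInv t D) m) hg) using 1
      push_cast; rw [map_add]; ring
    | mul_X f i hf =>
      obtain ⟨m, hm, hf⟩ := hf
      refine ⟨m, hm, ?_⟩
      rw [map_mul, MvPolynomial.aeval_X, ← mul_assoc]
      exact mul_mem hf (mem_adjoinInv i)
  have hchar : CharZero L := charZero_of_injective_algebraMap (algebraMap K L).injective
  obtain ⟨f, g, rfl⟩ := (IntermediateField.mem_adjoin_range_iff K t a).1 ha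
  rcases eq_or_ne (MvPolynomial.aeval t g) 0 with h0 | h0
  · rw [h0, div_zero]; exact zero_mem _
  obtain ⟨m, hm, hf⟩ := hmul f
  obtain ⟨n, hn, hg⟩ := hmul g
  refine mem_of_isIntegral_of_mul_mem (b := m * (n * MvPolynomial.aeval t g))
    (mul_mem (natCast_mem _ _) hg) (mul_ne_zero (Nat.cast_ne_zero.2 hm)
      (mul_ne_zero (Nat.cast_ne_zero.2 hn) h0)) ?_ hint
  convert mul_mem (natCast_mem (adjoinInv t D) n) hf using 1
  field_simp

/-- The quotient by π is a nonzero ring of characteristic p in which every class is that of a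
natural number, hence it is 𝔽_p. -/
theorem exists_residueHom (hs : 1 ≤ s) (hζ : IsPrimitiveRoot ζ (p ^ s)) :
    ∃ φ : baseRing p ζ →+* ZMod p, φ (unif p ζ) = 0 := by
  let I := Ideal.span {unif p ζ}
  let q := Ideal.Quotient.mk I
  have hqπ : q (unif p ζ) = 0 :=
    Ideal.Quotient.eq_zero_iff_mem.2 (Ideal.mem_span_singleton_self _)
  have hpπ := exists_natCast_prime_eq_pi_mul hs hζ
  have hqp : (p : baseRing p ζ ⧸ I) = 0 := by
    obtain ⟨y, hy, h⟩ := hpπ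
    have h2 : (p : baseRing p ζ) = unif p ζ * ⟨y, hy⟩ := Subtype.ext (by simpa [coe_unif] using h)
    rw [← map_natCast q, h2, map_mul, hqπ, zero_mul]
  have hnt : Nontrivial (baseRing p ζ ⧸ I) := by
    rw [Ideal.Quotient.nontrivial_iff, Ne, Ideal.span_singleton_eq_top]
    intro hu
    obtain ⟨v, hv⟩ := hu.exists_right_inv
    exact pi_mul_ne_one hs hζ v.2 (congrArg (baseRing p ζ).subtype hv)
  have hchar : CharP (baseRing p ζ ⧸ I) p :=
    ringChar.of_eq (CharP.ringChar_of_prime_eq_zero hp.out hqp)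
  let c := ZMod.castHom (dvd_refl p) (baseRing p ζ ⧸ I)
  have hsurj : Function.Surjective c := by
    intro x
    obtain ⟨x, rfl⟩ := Ideal.Quotient.mk_surjective x
    obtain ⟨n, y, hy, h⟩ := exists_natCast_sub_mem hpπ x.2
    have h2 : x = n + unif p ζ * ⟨y, hy⟩ := Subtype.ext (by simpa [coe_unif] using h)
    refine ⟨n, ?_⟩
    change c n = q x
    rw [h2, map_add, map_mul, hqπ, zero_mul, add_zero, map_natCast, map_natCast]
  let e := RingEquiv.ofBijective c ⟨c.injective, hsurj⟩
  exact ⟨(e.symm : baseRing p ζ ⧸ I →+* ZMod p).comp q, by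
    rw [RingHom.comp_apply, hqπ, map_zero]⟩

/-- The inverted polynomials reduce to 1 modulo π, so inverting them does not change the special
fibre. The two inverse maps come from the universal properties of the localisation and of the
polynomial ring. -/
theorem reductionIsPolynomialRing_adjoinInv (hs : 1 ≤ s) (hζ : IsPrimitiveRoot ζ (p ^ s))
    {t : Fin s → L} (ht : AlgebraicIndependent K t) {D : Fin s → MvPolynomial (Fin s) (baseRing p ζ)}
    (hD : ∀ i, ∃ r, D i = 1 + MvPolynomial.C (unif p ζ) * r) :
    ReductionIsPolynomialRing ζ (adjoinInv t D) t := by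
  obtain ⟨φ, hφ⟩ := exists_residueHom (K := K) hs hζ
  have hloc := isLocalization_adjoinInv (algebraicIndependent_baseRing ht)
    fun i => aeval_ne_zero hs hζ ht (hD i)
  set S := adjoinInv t D
  let alg : Algebra (MvPolynomial (Fin s) (baseRing p ζ)) S := (toAdjoinInv t D).toRingHom.toAlgebra
  have hloc : IsLocalization.Away (∏ i, D i) S := hloc
  let π : S := algebraMap (baseRing p ζ) S (unif p ζ)
  let q := Ideal.Quotient.mk (Ideal.span {π})
  have hqπ : q π = 0 := Ideal.Quotient.eq_zero_iff_mem.2 (Ideal.mem_span_singleton_self _)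
  let m := MvPolynomial.map (σ := Fin s) φ
  have hm : IsUnit (m (∏ i, D i)) := by
    have : m (∏ i, D i) = 1 := by
      rw [map_prod]
      refine Finset.prod_eq_one fun i _ => ?_
      obtain ⟨r, hr⟩ := hD i
      rw [hr, map_add, map_one, map_mul, MvPolynomial.map_C, hφ, map_zero, zero_mul, add_zero]
    rw [this]; exact isUnit_one
  let b : S →+* MvPolynomial (Fin s) (ZMod p) := IsLocalization.Away.lift (∏ i, D i) hm
  have hb (f : MvPolynomial (Fin s) (baseRing p ζ)) : b (toAdjoinInv t D f) = m f :=
    IsLocalization.Away.lift_eq _ hm f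
  have hC (r : baseRing p ζ) : toAdjoinInv t D (MvPolynomial.C r) = algebraMap _ S r :=
    (toAdjoinInv t D).commutes r
  have hX (i : Fin s) : toAdjoinInv t D (MvPolynomial.X i) = ⟨t i, mem_adjoinInv i⟩ :=
    Subtype.ext (MvPolynomial.aeval_X t i)
  let b' : S ⧸ Ideal.span {π} →+* MvPolynomial (Fin s) (ZMod p) := Ideal.Quotient.lift _ b (by
    intro a ha
    obtain ⟨c, rfl⟩ := Ideal.mem_span_singleton.1 ha
    have hπ : b π = 0 := by
      rw [show π = _ from (hC _).symm, hb]
      exact (MvPolynomial.map_C φ _).trans (by rw [hφ, map_zero])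
    rw [map_mul, hπ, zero_mul])
  have hb' (a : S) : b' (q a) = b a := rfl
  have hnt : Nontrivial (S ⧸ Ideal.span {π}) := b'.domain_nontrivial
  have hpπ := exists_natCast_prime_eq_pi_mul hs hζ
  have hqR (r : baseRing p ζ) : ∃ n : ℕ, φ r = n ∧ q (algebraMap _ S r) = n := by
    obtain ⟨n, y, hy, h⟩ := exists_natCast_sub_mem hpπ r.2
    have h2 : r = n + unif p ζ * ⟨y, hy⟩ := Subtype.ext (by simpa [coe_unif] using h)
    refine ⟨n, ?_, ?_⟩
    · rw [h2, map_add, map_mul, hφ, zero_mul, add_zero, map_natCast]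
    · rw [h2, map_add, map_mul, map_add, map_mul]
      change _ + q π * _ = _
      rw [hqπ, zero_mul, add_zero, map_natCast, map_natCast]
  have hqp : (p : S ⧸ Ideal.span {π}) = 0 := by
    obtain ⟨y, hy, h⟩ := hpπ
    have h2 : (p : baseRing p ζ) = unif p ζ * ⟨y, hy⟩ := Subtype.ext (by simpa [coe_unif] using h)
    rw [← map_natCast q, ← map_natCast (algebraMap (baseRing p ζ) S), h2, map_mul, map_mul]
    change q π * _ = 0
    rw [hqπ, zero_mul]
  have hchar : CharP (S ⧸ Ideal.span {π}) p :=
    ringChar.of_eq (CharP.ringChar_of_prime_eq_zero hp.out hqp)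
  let e : MvPolynomial (Fin s) (ZMod p) →+* S ⧸ Ideal.span {π} :=
    MvPolynomial.eval₂Hom (ZMod.castHom (dvd_refl p) _) fun i => q ⟨t i, mem_adjoinInv i⟩
  have heX (i : Fin s) : e (MvPolynomial.X i) = q ⟨t i, mem_adjoinInv i⟩ :=
    MvPolynomial.eval₂Hom_X' _ _ _
  have hbe : b'.comp e = RingHom.id _ := by
    refine MvPolynomial.ringHom_ext' (Subsingleton.elim _ _) fun i => ?_
    rw [RingHom.comp_apply, heX, hb', ← hX, hb]
    exact MvPolynomial.map_X _ _
  have heb : e.comp b = q := by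
    refine IsLocalization.ringHom_ext (Submonoid.powers (∏ i, D i)) ?_
    refine MvPolynomial.ringHom_ext (fun r => ?_) (fun i => ?_)
    · change e (b (toAdjoinInv t D _)) = q (toAdjoinInv t D _)
      rw [hb, hC]
      obtain ⟨n, h1, h2⟩ := hqR r
      change e (MvPolynomial.map φ _) = _
      rw [h2, MvPolynomial.map_C, h1, map_natCast, map_natCast]
    · change e (b (toAdjoinInv t D _)) = q (toAdjoinInv t D _)
      rw [hb, hX, ← heX]
      exact congrArg e (MvPolynomial.map_X _ _)
  have hbij : Function.Bijective e := by
    constructor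
    · exact Function.LeftInverse.injective (g := b') fun x => DFunLike.congr_fun hbe x
    · intro x
      obtain ⟨x, rfl⟩ := Ideal.Quotient.mk_surjective x
      exact ⟨b x, DFunLike.congr_fun heb x⟩
  exact ⟨RingEquiv.ofBijective e hbij, fun i => ⟨mem_adjoinInv i, heX i⟩⟩

end BaseLocalized

/-! ### Transfer of divisibility from power series to L. -/

section Graph

variable {K : Type*} [Field K] [CharZero K] {R : Subring K} {L : Type*} [Field L] [Algebra K L] {s : ℕ}

theorem aeval_X_eq_polyHom {σ : Type*} (q : MvPolynomial σ R) :
    MvPolynomial.aeval (MvPowerSeries.X : σ → MvPowerSeries σ K) q = polyHom R σ q := by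
  refine RingHom.congr_fun (f := (MvPolynomial.aeval (R := R)
    (MvPowerSeries.X : σ → MvPowerSeries σ K)).toRingHom) (g := polyHom R σ)
    (MvPolynomial.ringHom_ext (fun r => ?_) fun i => ?_) q
  · change MvPolynomial.aeval _ _ = _
    rw [MvPolynomial.aeval_C, algebraMap_mvPowerSeries, polyHom_C]
  · change MvPolynomial.aeval _ _ = _
    rw [MvPolynomial.aeval_X, polyHom_X]

variable (Y : Fin s → L) (F : Fin s → MvPolynomial (Fin s) R)

/-- The evaluation of a polynomial both at the elements `Y_i` of `L` and at the variables of the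
ring of power series. -/
def evalPair : MvPolynomial (Fin s) R →ₐ[R] L × MvPowerSeries (Fin s) K :=
  (MvPolynomial.aeval Y).prod (MvPolynomial.aeval MvPowerSeries.X)

/-- The inverses of the values of the polynomial `F_i`. -/
def invPair (i : Fin s) : L × MvPowerSeries (Fin s) K :=
  ((MvPolynomial.aeval Y (F i))⁻¹, (polyHom R (Fin s) (F i))⁻¹)

/-- The subalgebra of `L × K[[Y_0, …, Y_{s-1}]]` generated by the first `n` variables and the
inverses of the first `n` polynomials `F_i`. -/
def graph (n : ℕ) : Subalgebra R (L × MvPowerSeries (Fin s) K) :=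
  Algebra.adjoin R {a | ∃ i : Fin s, (i : ℕ) < n ∧
    (a = evalPair (R := R) Y (MvPolynomial.X i) ∨ a = invPair Y F i)}

/-- The subalgebra of `L` generated by the first `n` elements `Y_i` and the inverses of the values
of the first `n` polynomials `F_i`. -/
def adjoinInvBelow (n : ℕ) : Subalgebra R L :=
  Algebra.adjoin R {a | ∃ i : Fin s, (i : ℕ) < n ∧ (a = Y i ∨ a = (MvPolynomial.aeval Y (F i))⁻¹)}

variable {Y F} {n : ℕ}

theorem evalPair_apply (f : MvPolynomial (Fin s) R) :
    evalPair Y f = (MvPolynomial.aeval Y f, polyHom R (Fin s) f) :=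
  Prod.ext rfl (aeval_X_eq_polyHom f)

theorem graph_mono {m n : ℕ} (h : m ≤ n) : graph Y F m ≤ graph Y F n :=
  Algebra.adjoin_mono fun _ ⟨i, hi, ha⟩ => ⟨i, hi.trans_le h, ha⟩

theorem fst_mem_of_mem_graph {a : L × MvPowerSeries (Fin s) K} (ha : a ∈ graph Y F n) :
    a.1 ∈ adjoinInvBelow Y F n := by
  have h : (graph Y F n).map (AlgHom.fst R L (MvPowerSeries (Fin s) K)) ≤
      adjoinInvBelow Y F n := by
    rw [graph, AlgHom.map_adjoin, Algebra.adjoin_le_iff]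
    rintro _ ⟨a, ⟨i, hi, rfl | rfl⟩, rfl⟩
    · exact Algebra.subset_adjoin ⟨i, hi, Or.inl (MvPolynomial.aeval_X Y i)⟩
    · exact Algebra.subset_adjoin ⟨i, hi, Or.inr rfl⟩
  exact h ⟨a, ha, rfl⟩

theorem evalPair_mem_graph {f : MvPolynomial (Fin s) R} (hf : ∀ i ∈ f.vars, (i : ℕ) < n) :
    evalPair Y f ∈ graph Y F n := by
  have h : f ∈ MvPolynomial.supported R {i : Fin s | (i : ℕ) < n} :=
    MvPolynomial.mem_supported.2 fun i hi => hf i hi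
  have h2 : (MvPolynomial.supported R {i : Fin s | (i : ℕ) < n}).map (evalPair Y) ≤
      graph Y F n := by
    rw [MvPolynomial.supported, AlgHom.map_adjoin, Algebra.adjoin_le_iff]
    rintro _ ⟨_, ⟨i, hi, rfl⟩, rfl⟩
    exact Algebra.subset_adjoin ⟨i, hi, Or.inl rfl⟩
  exact h2 ⟨f, h, rfl⟩

theorem invPair_mem_graph {i : Fin s} (hi : (i : ℕ) < n) : invPair Y F i ∈ graph Y F n :=
  Algebra.subset_adjoin ⟨i, hi, Or.inr rfl⟩

theorem evalPair_mul_invPair (h0 : ∀ i, MvPolynomial.aeval Y (F i) ≠ 0)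
    (h1 : ∀ i, (polyHom R (Fin s) (F i)).constantCoeff ≠ 0) (i : Fin s) :
    evalPair Y (F i) * invPair Y F i = 1 := by
  rw [evalPair_apply]
  exact Prod.ext (mul_inv_cancel₀ (h0 i)) (MvPowerSeries.mul_inv_cancel _ (h1 i))

variable (F n) in
/-- The product of the first `n` polynomials `F_i`. -/
def denom : MvPolynomial (Fin s) R := ∏ i ∈ Finset.univ.filter fun i : Fin s => (i : ℕ) < n, F i

theorem exists_mul_denom_pow_eq (h0 : ∀ i, MvPolynomial.aeval Y (F i) ≠ 0)
    (h1 : ∀ i, (polyHom R (Fin s) (F i)).constantCoeff ≠ 0)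
    (hF : ∀ i, ∀ j ∈ (F i).vars, j ≤ i) {a : L × MvPowerSeries (Fin s) K}
    (ha : a ∈ graph Y F n) : ∃ (N : ℕ) (f : MvPolynomial (Fin s) R),
      f ∈ MvPolynomial.supported R {i : Fin s | (i : ℕ) < n} ∧
      a * evalPair Y (denom F n) ^ N = evalPair Y f := by
  have hFs (i : Fin s) (hi : (i : ℕ) < n) :
      F i ∈ MvPolynomial.supported R {i : Fin s | (i : ℕ) < n} :=
    MvPolynomial.mem_supported.2 fun j hj => (Fin.le_def.1 (hF i j hj)).trans_lt hi
  have hDs : denom F n ∈ MvPolynomial.supported R {i : Fin s | (i : ℕ) < n} :=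
    prod_mem fun i hi => hFs i (Finset.mem_filter.1 hi).2
  induction ha using Algebra.adjoin_induction with
  | mem x hx =>
    obtain ⟨i, hi, rfl | rfl⟩ := hx
    · exact ⟨0, MvPolynomial.X i, Algebra.subset_adjoin ⟨i, hi, rfl⟩, by simp⟩
    · have hm : i ∈ Finset.univ.filter fun i : Fin s => (i : ℕ) < n := by simpa using hi
      refine ⟨1, ∏ j ∈ (Finset.univ.filter fun i : Fin s => (i : ℕ) < n).erase i, F j,
        prod_mem fun j hj => hFs j (Finset.mem_filter.1 (Finset.mem_of_mem_erase hj)).2, ?_⟩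
      rw [pow_one, denom, ← Finset.mul_prod_erase _ _ hm, map_mul, ← mul_assoc,
        mul_comm (invPair Y F i), evalPair_mul_invPair h0 h1, one_mul]
  | algebraMap r => exact ⟨0, MvPolynomial.C r, Subalgebra.algebraMap_mem _ r, by
      rw [pow_zero, mul_one]; exact ((evalPair Y).commutes r).symm⟩
  | add x y _ _ hx hy =>
    obtain ⟨k, f, hfs, hf⟩ := hx
    obtain ⟨l, g, hgs, hg⟩ := hy
    refine ⟨k + l, f * denom F n ^ l + g * denom F n ^ k,
      add_mem (mul_mem hfs (pow_mem hDs _)) (mul_mem hgs (pow_mem hDs _)), ?_⟩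
    rw [map_add, map_mul, map_mul, map_pow, map_pow, ← hf, ← hg]; ring
  | mul x y _ _ hx hy =>
    obtain ⟨k, f, hfs, hf⟩ := hx
    obtain ⟨l, g, hgs, hg⟩ := hy
    refine ⟨k + l, f * g, mul_mem hfs hgs, ?_⟩
    rw [map_mul, ← hf, ← hg]; ring

/-- The algebra `graph Y F n` is saturated among the pairs whose second component has coefficients
in `R`. -/
theorem mem_graph_of_mul_mem (h0 : ∀ i, MvPolynomial.aeval Y (F i) ≠ 0)
    (h1 : ∀ i, (polyHom R (Fin s) (F i)).constantCoeff ≠ 0)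
    (hF : ∀ i, ∀ j ∈ (F i).vars, j ≤ i) {c : R} (hc : c ≠ 0) {a : L}
    {b : MvPowerSeries (Fin s) K} (hb : b ∈ intS R (Fin s))
    (h : (algebraMap K L c * a, MvPowerSeries.C (c : K) * b) ∈ graph Y F n) :
    (a, b) ∈ graph Y F n := by
  have hcK : (c : K) ≠ 0 := fun h => hc (Subtype.ext h)
  obtain ⟨N, f, hfs, hf⟩ := exists_mul_denom_pow_eq h0 h1 hF h
  have hfst := congrArg Prod.fst hf
  have hsnd := congrArg Prod.snd hf
  rw [evalPair_apply, evalPair_apply] at hfst hsnd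
  have e1 : algebraMap K L c * a * MvPolynomial.aeval Y (denom F n) ^ N =
    MvPolynomial.aeval Y f := hfst
  have e2 : MvPowerSeries.C (c : K) * b * polyHom R (Fin s) (denom F n) ^ N =
    polyHom R (Fin s) f := hsnd
  -- The power series component decides: there f is c times an integral series, so c divides all
  -- coefficients of f. This is a fact about the polynomial f, so it also divides its value in L,
  -- where independence of the Y_i is not yet available.
  obtain ⟨g, hg⟩ : MvPolynomial.C c ∣ f := by
    rw [MvPolynomial.C_dvd_iff_dvd_coeff]
    intro m
    have h3 := mem_intS.1 (mul_mem hb (pow_mem (polyHom_mem (denom F n)) N)) m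
    refine ⟨⟨_, h3⟩, Subtype.ext ?_⟩
    have h4 := congrArg (MvPowerSeries.coeff m) e2
    rw [mul_assoc, MvPowerSeries.coeff_C_mul, coeff_polyHom] at h4
    exact h4.symm
  have hgs (i : Fin s) (hi : i ∈ g.vars) : (i : ℕ) < n := by
    refine MvPolynomial.mem_supported.1 hfs ?_
    rw [Finset.mem_coe, MvPolynomial.mem_vars_iff_mem_support] at *
    obtain ⟨d, hd, hid⟩ := hi
    refine ⟨d, ?_, hid⟩
    rw [MvPolynomial.mem_support_iff] at hd ⊢
    rw [hg, MvPolynomial.coeff_C_mul]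
    exact mul_ne_zero hc hd
  rw [hg, map_mul] at e1 e2
  have e1' : a * MvPolynomial.aeval Y (denom F n) ^ N = MvPolynomial.aeval Y g := by
    refine mul_left_cancel₀ ((map_ne_zero (algebraMap K L)).2 hcK) ?_
    rw [← mul_assoc, e1, MvPolynomial.aeval_C]; rfl
  have e2' : b * polyHom R (Fin s) (denom F n) ^ N = polyHom R (Fin s) g := by
    refine C_mul_cancel hcK ?_
    rw [← mul_assoc, e2, polyHom_C]
  have hu : evalPair Y (denom F n) * ∏ i ∈ Finset.univ.filter fun i : Fin s => (i : ℕ) < n, invPair Y F i = 1 := by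
    rw [denom, map_prod, ← Finset.prod_mul_distrib]
    exact Finset.prod_eq_one fun i _ => evalPair_mul_invPair h0 h1 i
  have key : (a, b) = evalPair Y g * (∏ i ∈ Finset.univ.filter fun i : Fin s => (i : ℕ) < n, invPair Y F i) ^ N := by
    have : evalPair Y g = (a, b) * evalPair Y (denom F n) ^ N := by
      rw [evalPair_apply, evalPair_apply]
      exact Prod.ext e1'.symm e2'.symm
    rw [this, mul_assoc, ← mul_pow, hu, one_pow, mul_one]
  rw [key]
  refine mul_mem (evalPair_mem_graph hgs) (pow_mem ?_ _)
  exact prod_mem fun i hi => invPair_mem_graph (Finset.mem_filter.1 hi).2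

theorem aeval_mem_of_vars {R A σ : Type*} [CommRing R] [CommRing A] [Algebra R A]
    (S : Subalgebra R A) {t : σ → A} {f : MvPolynomial σ R} (h : ∀ i ∈ f.vars, t i ∈ S) :
    MvPolynomial.aeval t f ∈ S := by
  have h1 : f ∈ MvPolynomial.supported R {i | t i ∈ S} := MvPolynomial.mem_supported.2 h
  have h2 : (MvPolynomial.supported R {i | t i ∈ S}).map (MvPolynomial.aeval t) ≤ S := by
    rw [MvPolynomial.supported, AlgHom.map_adjoin, Algebra.adjoin_le_iff]
    rintro _ ⟨_, ⟨i, hi, rfl⟩, rfl⟩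
    rw [MvPolynomial.aeval_X]; exact hi
  exact h2 ⟨f, h1, rfl⟩

end Graph

/-! ### The elements X_i in terms of the Y_j. -/

section Variables

variable {K : Type*} [Field K] [CharZero K] {p s : ℕ} [hp : Fact p.Prime] {ζ : K}
variable [IsCyclotomicExtension {p ^ s} ℚ K] {L : Type*} [Field L] [Algebra K L]

/-- The polynomial `E_{i+1} + λ Y_i`. -/
def polyZ (E : Fin s → MvPolynomial (Fin s) (baseRing p ζ)) (i : Fin s) :
    MvPolynomial (Fin s) (baseRing p ζ) :=
  E i + MvPolynomial.C ⟨lam p s ζ, lam_mem s⟩ * MvPolynomial.X i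

/-- The polynomial `G_{i+1} + pλ X_i`. -/
def polyU (G : Fin s → MvPolynomial (Fin s) (baseRing p ζ)) (i : Fin s) :
    MvPolynomial (Fin s) (baseRing p ζ) :=
  G i + MvPolynomial.C ⟨p * lam p s ζ, p_mul_lam_mem⟩ * MvPolynomial.X i

variable {G E : Fin s → MvPolynomial (Fin s) (baseRing p ζ)}

theorem aeval_polyZ (Y : Fin s → L) (i : Fin s) : MvPolynomial.aeval Y (polyZ E i) =
    MvPolynomial.aeval Y (E i) + algebraMap K L (lam p s ζ) * Y i := by
  rw [polyZ, map_add, map_mul, MvPolynomial.aeval_C, MvPolynomial.aeval_X]; rfl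

theorem aeval_polyU (x : Fin s → L) (i : Fin s) :
    MvPolynomial.aeval x (polyU G i) = kummerU ζ G x i := by
  rw [polyU, map_add, map_mul, MvPolynomial.aeval_C, MvPolynomial.aeval_X]; rfl

theorem polyHom_polyZ (i : Fin s) : polyHom _ _ (polyZ E i) =
    polyHom _ _ (E i) + MvPowerSeries.C (lam p s ζ) * MvPowerSeries.X i := by
  rw [polyZ, map_add, map_mul, polyHom_C, polyHom_X]

theorem polyZ_eq_one_add (hE : ∀ i, ∃ r, E i = 1 + MvPolynomial.C (unif p ζ) * r) (i : Fin s) :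
    ∃ r, polyZ E i = 1 + MvPolynomial.C (unif p ζ) * r := by
  obtain ⟨r, hr⟩ := hE i
  obtain ⟨y, hy, h⟩ := exists_lam_eq (K := K) (p := p) (s := s) (ζ := ζ)
  have h2 : (⟨lam p s ζ, lam_mem s⟩ : baseRing p ζ) = unif p ζ * ⟨y, hy⟩ :=
    Subtype.ext h
  refine ⟨r + MvPolynomial.C ⟨y, hy⟩ * MvPolynomial.X i, ?_⟩
  rw [polyZ, hr, h2, map_mul]; ring

theorem polyU_eq_one_add (hG : ∀ i, ∃ r, G i = 1 + MvPolynomial.C (unif p ζ) * r) (i : Fin s) :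
    ∃ r, polyU G i = 1 + MvPolynomial.C (unif p ζ) * r := by
  obtain ⟨r, hr⟩ := hG i
  obtain ⟨y, hy, h⟩ := exists_lam_eq (K := K) (p := p) (s := s) (ζ := ζ)
  have h2 : (⟨p * lam p s ζ, p_mul_lam_mem⟩ : baseRing p ζ) = unif p ζ * (p * ⟨y, hy⟩) :=
    Subtype.ext (by
      change (p : K) * lam p s ζ = (ζ - 1) * (((p : baseRing p ζ) : K) * y)
      rw [h, SubringClass.coe_natCast]; ring)
  refine ⟨r + MvPolynomial.C ((p : baseRing p ζ) * ⟨y, hy⟩) * MvPolynomial.X i, ?_⟩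
  rw [polyU, hr, h2, MvPolynomial.C_mul]; ring

theorem vars_polyZ_le (hE : ∀ i, ∀ j ∈ (E i).vars, j < i) (i : Fin s) :
    ∀ j ∈ (polyZ E i).vars, j ≤ i := by
  classical
  intro j hj
  rcases Finset.mem_union.1 (MvPolynomial.vars_add_subset _ _ hj) with h | h
  · exact (hE i j h).le
  · rcases Finset.mem_union.1 (MvPolynomial.vars_mul _ _ h) with h | h
    · simp at h
    · rw [MvPolynomial.vars_X, Finset.mem_singleton] at h
      exact h.le

/-- The elements `X_i`, and the quotients of `E_{i+1}^p - Z_{i-1} G_{i+1}` by `pλ`, belong to the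
algebra generated by the `Y_j` and the inverses of the `Z_j`. -/
theorem mem_adjoinInvBelow_and_exists (hs : 1 ≤ s) (hζ : IsPrimitiveRoot ζ (p ^ s))
    (hGv : ∀ i, ∀ j ∈ (G i).vars, j < i) (hEv : ∀ i, ∀ j ∈ (E i).vars, j < i)
    (hX : ∀ i, powX p s ζ i ∈ intS (baseRing p ζ) (Fin s))
    (hZc : ∀ i, (powZ p s ζ i).constantCoeff = 1)
    (hZE : ∀ i : Fin s, powZ p s ζ i.succ = polyHom _ _ (E i) +
        MvPowerSeries.C (lam p s ζ) * MvPowerSeries.X i)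
    (hZG : ∀ i : Fin s, powZ p s ζ i.succ ^ p = powZ p s ζ i.castSucc *
        (MvPolynomial.aeval (powX p s ζ) (G i) +
          MvPowerSeries.C (p * lam p s ζ) * powX p s ζ i))
    (hEG : ∀ i : Fin s, Cg (baseRing p ζ) (p * lam p s ζ) (polyHom _ _ (E i) ^ p)
        (powZ p s ζ i.castSucc * MvPolynomial.aeval (powX p s ζ) (G i)))
    {x Y : Fin s → L} {Z : Fin (s + 1) → L} (hZ0 : Z 0 = 1) (hZn : ∀ i, Z i ≠ 0)
    (hZ : ∀ i : Fin s, Z i.succ = MvPolynomial.aeval Y (polyZ E i))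
    (hZp : ∀ i : Fin s, Z i.succ ^ p = Z i.castSucc * kummerU ζ G x i) (i : Fin s) :
    x i ∈ adjoinInvBelow Y (polyZ E) (i + 1) ∧
      ∃ c ∈ adjoinInvBelow Y (polyZ E) i, MvPolynomial.aeval Y (E i) ^ p =
        Z i.castSucc * MvPolynomial.aeval x (G i) + algebraMap K L (p * lam p s ζ) * c := by
  have hpl0 : (p : K) * lam p s ζ ≠ 0 := p_mul_lam_ne_zero hs hζ
  have hpl : (⟨p * lam p s ζ, p_mul_lam_mem⟩ : baseRing p ζ) ≠ 0 :=
    fun h => hpl0 (congrArg Subtype.val h)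
  have hplL : algebraMap K L (p * lam p s ζ) ≠ 0 := (map_ne_zero _).2 hpl0
  have hZE' (i : Fin s) : powZ p s ζ i.succ = polyHom _ _ (polyZ E i) := by
    rw [polyHom_polyZ, hZE]
  have h0 (i : Fin s) : MvPolynomial.aeval Y (polyZ E i) ≠ 0 := by rw [← hZ]; exact hZn _
  have h1 (i : Fin s) : (polyHom _ _ (polyZ E i)).constantCoeff ≠ 0 := by
    rw [← hZE', hZc]; exact one_ne_zero
  have hF := vars_polyZ_le hEv
  have hZint (i : Fin (s + 1)) : powZ p s ζ i ∈ intS (baseRing p ζ) (Fin s) := by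
    induction i using Fin.cases with
    | zero => exact one_mem _
    | succ i => rw [hZE']; exact polyHom_mem _
  have hsat {n : ℕ} {a : L} {b : MvPowerSeries (Fin s) K} :=
    mem_graph_of_mul_mem (n := n) (a := a) (b := b) h0 h1 hF (c := ⟨_, p_mul_lam_mem⟩) hpl
  have hZs {n : ℕ} (i : Fin s) (hi : (i : ℕ) < n) :
      (Z i.succ, powZ p s ζ i.succ) ∈ graph Y (polyZ E) n := by
    rw [hZ, hZE', ← evalPair_apply]
    exact evalPair_mem_graph fun j hj => (Fin.le_def.1 (hF i j hj)).trans_lt hi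
  have hZc' {n : ℕ} (i : Fin s) (hi : (i : ℕ) ≤ n) :
      (Z i.castSucc, powZ p s ζ i.castSucc) ∈ graph Y (polyZ E) n := by
    rcases eq_or_ne (i : ℕ) 0 with h | h
    · have h2 : i.castSucc = 0 := Fin.ext h
      rw [h2, hZ0]; exact one_mem _
    · have h2 : i.castSucc = (⟨i - 1, by omega⟩ : Fin s).succ := Fin.ext (by simp; omega)
      rw [h2]; exact hZs _ (by simp; omega)
  have hZi {n : ℕ} (i : Fin s) (hi : (i : ℕ) ≤ n) :
      ((Z i.castSucc)⁻¹, (powZ p s ζ i.castSucc)⁻¹) ∈ graph Y (polyZ E) n := by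
    rcases eq_or_ne (i : ℕ) 0 with h | h
    · have h2 : i.castSucc = 0 := Fin.ext h
      have h3 : powZ p s ζ 0 = 1 := rfl
      have h4 : (1 : MvPowerSeries (Fin s) K)⁻¹ = 1 := by
        rw [← mul_one (1 : MvPowerSeries (Fin s) K)⁻¹]
        exact MvPowerSeries.inv_mul_cancel _ (by simp)
      rw [h2, hZ0, h3, inv_one, h4]; exact one_mem _
    · have h2 : i.castSucc = (⟨i - 1, by omega⟩ : Fin s).succ := Fin.ext (by simp; omega)
      rw [h2, hZ, hZE']; exact invPair_mem_graph (by simp; omega)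
  -- Induction on i, as G_{i+1} involves only earlier X_j. The pair for Z_i^p - Z_{i-1}G_{i+1} =
  -- pλZ_{i-1}X_i lies in the graph; saturation removes pλ, and Z_{i-1} is invertible there.
  have hxm (i : Fin s) : (x i, powX p s ζ i) ∈ graph Y (polyZ E) (i + 1) ∧
      (MvPolynomial.aeval x (G i), MvPolynomial.aeval (powX p s ζ) (G i)) ∈
        graph Y (polyZ E) i := by
    induction i using WellFoundedLT.induction with
    | ind i ih =>
    have hG : (MvPolynomial.aeval x (G i), MvPolynomial.aeval (powX p s ζ) (G i)) ∈
        graph Y (polyZ E) i := by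
      have h2 : (MvPolynomial.aeval x (G i), MvPolynomial.aeval (powX p s ζ) (G i)) =
          MvPolynomial.aeval (fun j => (x j, powX p s ζ j)) (G i) :=
        Prod.ext
          (MvPolynomial.comp_aeval_apply (f := fun j => (x j, powX p s ζ j))
            (AlgHom.fst (baseRing p ζ) L (MvPowerSeries (Fin s) K)) (G i)).symm
          (MvPolynomial.comp_aeval_apply (f := fun j => (x j, powX p s ζ j))
            (AlgHom.snd (baseRing p ζ) L (MvPowerSeries (Fin s) K)) (G i)).symm
      rw [h2]
      exact aeval_mem_of_vars _ fun j hj =>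
        graph_mono (Fin.lt_def.1 (hGv i j hj)) (ih j (hGv i j hj)).1
    refine ⟨?_, hG⟩
    have h2 : (Z i.castSucc * x i, powZ p s ζ i.castSucc * powX p s ζ i) ∈
        graph Y (polyZ E) (i + 1) := by
      refine hsat (mul_mem (hZint _) (hX i)) ?_
      convert sub_mem (pow_mem (hZs i (Nat.lt_succ_self _)) p)
        (mul_mem (hZc' i (Nat.le_succ _)) (graph_mono (Nat.le_succ _) hG)) using 1
      refine Prod.ext ?_ ?_
      · change _ = Z i.succ ^ p - Z i.castSucc * MvPolynomial.aeval x (G i)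
        rw [hZp, kummerU]; ring
      · change _ = powZ p s ζ i.succ ^ p - powZ p s ζ i.castSucc * _
        rw [hZG]; ring
    convert mul_mem (hZi i (Nat.le_succ _)) h2 using 1
    refine Prod.ext ?_ ?_
    · exact (inv_mul_cancel_left₀ (hZn _) _).symm
    · change _ = (powZ p s ζ i.castSucc)⁻¹ * (powZ p s ζ i.castSucc * powX p s ζ i)
      rw [← mul_assoc, MvPowerSeries.inv_mul_cancel _ (by rw [hZc]; exact one_ne_zero), one_mul]
  refine ⟨fst_mem_of_mem_graph (hxm i).1, ?_⟩
  obtain ⟨h, hh, he⟩ := hEG i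
  refine ⟨(MvPolynomial.aeval Y (E i) ^ p - Z i.castSucc * MvPolynomial.aeval x (G i)) /
    algebraMap K L (p * lam p s ζ), ?_, by field_simp; ring⟩
  refine fst_mem_of_mem_graph (a := (_, h)) (hsat hh ?_)
  convert sub_mem (pow_mem (evalPair_mem_graph (F := polyZ E) (Y := Y) (hEv i)) p)
    (mul_mem (hZc' i le_rfl) (hxm i).2) using 1
  rw [evalPair_apply]
  refine Prod.ext ?_ ?_
  · exact mul_div_cancel₀ _ hplL
  · change MvPowerSeries.C _ * h = polyHom _ _ (E i) ^ p - powZ p s ζ i.castSucc * _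
    rw [he]; ring

end Variables

/-! ### A criterion for étale Galois covers. -/

section GaloisCover

variable {A B : Type*} [CommRing A] [CommRing B] [Algebra A B] {G : Type*} [Group G]
  {ρ : G →* (B ≃ₐ[A] B)}

theorem torsorMap_tmul (a b : B) (g : G) : torsorMap ρ (a ⊗ₜ b) g = a * ρ g b := by
  simp [torsorMap, Algebra.TensorProduct.lift_tmul]

/-- For each g ≠ 1, with b moved by a unit, (gb - b)⁻¹(gb ⊗ 1 - 1 ⊗ b) has value 1 at the identity
and 0 at g. The product over all g is the required element. -/
theorem exists_torsorMap_eq_single [Finite G] [DecidableEq G]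
    (hu : ∀ g : G, g ≠ 1 → ∃ b, IsUnit (ρ g b - b)) :
    ∃ e : B ⊗[A] B, torsorMap ρ e = Pi.single 1 1 := by
  have := Fintype.ofFinite G
  have h (g : G) : ∃ t : B ⊗[A] B, torsorMap ρ t 1 = 1 ∧ (g ≠ 1 → torsorMap ρ t g = 0) := by
    by_cases hg : g = 1
    · exact ⟨1, by simp, fun h => (h hg).elim⟩
    · obtain ⟨b, v, hv⟩ := hu g hg
      refine ⟨((v⁻¹ : Bˣ) : B) ⊗ₜ 1 * (ρ g b ⊗ₜ 1 - 1 ⊗ₜ b), ?_, fun _ => ?_⟩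
      · rw [map_mul, map_sub, Pi.mul_apply, Pi.sub_apply, torsorMap_tmul, torsorMap_tmul,
          torsorMap_tmul, map_one (ρ 1)]
        rw [mul_one, mul_one, one_mul, map_one ρ, AlgEquiv.one_apply, ← hv, Units.inv_mul]
      · rw [map_mul, map_sub, Pi.mul_apply, Pi.sub_apply, torsorMap_tmul, torsorMap_tmul,
          torsorMap_tmul]
        simp
  choose t h1 h2 using h
  refine ⟨∏ g, t g, funext fun g => ?_⟩
  rw [map_prod, Finset.prod_apply]
  by_cases hg : g = 1
  · rw [hg, Pi.single_eq_same]
    exact Finset.prod_eq_one fun g _ => h1 g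
  · rw [Pi.single_eq_of_ne hg]
    exact Finset.prod_eq_zero (Finset.mem_univ g) (h2 g hg)

/-- A finite group acting on a domain `B` with ring of invariants `A`, such that every non-trivial
element `g` displaces some element by a unit, makes `Spec B` a Galois cover of `Spec A`. -/
theorem isEtaleGaloisCover_of_isUnit [Finite G] [IsDomain B]
    (hinj : Function.Injective (algebraMap A B))
    (hinv : ∀ b : B, (∀ g, ρ g b = b) → ∃ a, algebraMap A B a = b)
    (hu : ∀ g : G, g ≠ 1 → ∃ b, IsUnit (ρ g b - b)) : IsEtaleGaloisCover A B G := by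
  classical
  have := Fintype.ofFinite G
  obtain ⟨e, he⟩ := exists_torsorMap_eq_single hu
  obtain ⟨S, hS⟩ := TensorProduct.exists_finset e
  -- Writing e = ∑ x_i ⊗ y_i, the relations ∑ x_i g(y_i) = δ_{g,1} make the x_i and the functionals
  -- b ↦ Tr(y_i b) a dual basis, with the trace taking values in A. Finiteness, projectivity and
  -- bijectivity all follow from them.
  have hdual (g : G) : ∑ i ∈ S, i.1 * ρ g i.2 = if g = 1 then 1 else 0 := by
    have h := congrFun he g
    rw [hS, map_sum, Finset.sum_apply, Pi.single_apply] at h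
    rw [← h]
    exact Finset.sum_congr rfl fun i _ => (torsorMap_tmul _ _ _).symm
  have htr (b : B) : ∃ a, algebraMap A B a = ∑ g, ρ g b := by
    refine hinv _ fun g => ?_
    rw [map_sum]
    refine Fintype.sum_equiv (Equiv.mulLeft g) _ _ fun h => ?_
    rw [Equiv.coe_mulLeft, map_mul]; rfl
  choose tr htr using htr
  let T : B →ₗ[A] A :=
    { toFun := tr
      map_add' := fun a b => hinj (by
        rw [map_add, htr, htr, htr, ← Finset.sum_add_distrib]; simp only [map_add])
      map_smul' := fun a b => hinj (by
        rw [RingHom.id_apply, smul_eq_mul, map_mul, htr, htr, Finset.mul_sum]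
        exact Finset.sum_congr rfl fun g _ => by
          rw [Algebra.smul_def, map_mul, AlgEquiv.commutes]) }
  have hT (b : B) : algebraMap A B (T b) = ∑ g, ρ g b := htr b
  have hrep (b : B) : ∑ i ∈ S, T (i.2 * b) • i.1 = b := by
    calc ∑ i ∈ S, T (i.2 * b) • i.1 = ∑ g, ρ g b * ∑ i ∈ S, i.1 * ρ g i.2 := by
          simp only [Algebra.smul_def, hT, Finset.sum_mul, Finset.mul_sum]
          rw [Finset.sum_comm]
          refine Finset.sum_congr rfl fun g _ => Finset.sum_congr rfl fun i _ => ?_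
          rw [map_mul]; ring
      _ = b := by
          simp only [hdual, mul_ite, mul_one, mul_zero]
          rw [Finset.sum_ite_eq' Finset.univ (1 : G), if_pos (Finset.mem_univ _), map_one]; rfl
  have hproj : Module.Projective A B := by
    refine Module.Projective.of_split (M := S → A)
      (LinearMap.pi fun i : S => T.comp (LinearMap.mulLeft A i.1.2))
      (∑ i : S, (LinearMap.proj i).smulRight i.1.1) (LinearMap.ext fun b => ?_)
    rw [LinearMap.comp_apply, LinearMap.sum_apply]
    refine Eq.trans ?_ (hrep b)
    rw [← Finset.sum_coe_sort S]
    rfl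
  have hfin : Module.Finite A B := by
    refine ⟨⟨S.image Prod.fst, eq_top_iff.2 fun b _ => ?_⟩⟩
    rw [← hrep b]
    exact sum_mem fun i hi => Submodule.smul_mem _ _ (Submodule.subset_span
      (Finset.mem_coe.2 (Finset.mem_image_of_mem _ hi)))
  have hleft : Function.Injective (torsorMap ρ) := by
    let Ψ : (G → B) →+ B ⊗[A] B :=
      ∑ g, ∑ i ∈ S, ((TensorProduct.mk A B B).flip i.1).toAddMonoidHom.comp
        ((AddMonoidHom.mulRight (ρ g i.2)).comp (Pi.evalAddMonoidHom _ g))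
    have hΨ (f : G → B) : Ψ f = ∑ g, ∑ i ∈ S, (f g * ρ g i.2) ⊗ₜ i.1 := by
      simp [Ψ]
    refine Function.LeftInverse.injective (g := Ψ) fun w => ?_
    induction w using TensorProduct.induction_on with
    | zero => rw [map_zero, map_zero]
    | add x y hx hy => rw [map_add, map_add, hx, hy]
    | tmul a b =>
      rw [hΨ]
      conv_rhs => rw [← hrep b, TensorProduct.tmul_sum]
      rw [Finset.sum_comm]
      refine Finset.sum_congr rfl fun i _ => ?_
      rw [← TensorProduct.smul_tmul, Algebra.smul_def, hT, Finset.sum_mul,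
        TensorProduct.sum_tmul]
      refine Finset.sum_congr rfl fun g _ => ?_
      rw [torsorMap_tmul, map_mul]; congr 1; ring
  have hsurj : Function.Surjective (torsorMap ρ) := by
    intro f
    -- Applying g⁻¹ to the second factor of e translates the delta function at 1 to the one at g.
    refine ⟨∑ g, ∑ i ∈ S, (f g * i.1) ⊗ₜ ρ g⁻¹ i.2, funext fun h => ?_⟩
    rw [map_sum, Finset.sum_apply]
    have h1 (g : G) : torsorMap ρ (∑ i ∈ S, (f g * i.1) ⊗ₜ ρ g⁻¹ i.2) h =
        if g = h then f g else 0 := by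
      rw [map_sum, Finset.sum_apply]
      have h2 : ∑ i ∈ S, f g * (i.1 * ρ (h * g⁻¹) i.2) = if g = h then f g else 0 := by
        rw [← Finset.mul_sum, hdual, mul_ite, mul_one, mul_zero]
        refine if_congr ?_ rfl rfl
        rw [mul_inv_eq_one]; exact eq_comm
      rw [← h2]
      refine Finset.sum_congr rfl fun i _ => ?_
      rw [torsorMap_tmul, map_mul, mul_assoc]; rfl
    simp only [h1]
    rw [Finset.sum_ite_eq' Finset.univ h, if_pos (Finset.mem_univ _)]
  have hunr : Algebra.FormallyUnramified A B := by
    -- e is a separability idempotent: it is supported on the diagonal component g = 1, where 1 ⊗ b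
    -- - b ⊗ 1 vanishes, and its product is 1.
    refine Algebra.FormallyUnramified.iff_exists_tensorProduct.2 ⟨e, fun b => hleft ?_, ?_⟩
    · rw [map_zero, map_mul, he]
      funext g
      rw [Pi.mul_apply, map_sub, Pi.sub_apply, torsorMap_tmul, torsorMap_tmul]
      by_cases hg : g = 1
      · subst hg; simp
      · rw [Pi.single_eq_of_ne hg, mul_zero]; rfl
    · have h : (Algebra.TensorProduct.lmul' A : B ⊗[A] B →ₐ[A] B) =
          (Pi.evalAlgHom A (fun _ : G => B) 1).comp (torsorMap ρ) := by
        ext b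
        · simp [torsorMap_tmul]
        · simp [torsorMap_tmul]
      rw [h, AlgHom.comp_apply, he]
      simp
  have hfp : Module.FinitePresentation A B := Module.finitePresentation_of_projective A B
  have hfaith : FaithfulSMul A B := (faithfulSMul_iff_algebraMap_injective A B).2 hinj
  exact ⟨Algebra.Etale.of_formallyUnramified_of_flat, hfin, inferInstance, ρ, hleft, hsurj⟩

end GaloisCover

/-! ### Constructing the Z_i and Y_i, and independence by counting. -/

section Towers

variable {L : Type*} [Field L]

theorem isIntegral_of_pow_add_sum_eq_zero {A B : Type*} [CommRing A] [CommRing B] [Algebra A B]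
    {n : ℕ} (c : ℕ → A) {y : B}
    (h : y ^ n + ∑ k ∈ Finset.range n, algebraMap A B (c k) * y ^ k = 0) : IsIntegral A y := by
  nontriviality A
  refine ⟨Polynomial.X ^ n + ∑ k ∈ Finset.range n, Polynomial.C (c k) * Polynomial.X ^ k,
    Polynomial.monic_X_pow_add ?_, ?_⟩
  · refine (Polynomial.degree_lt_iff_coeff_zero _ _).2 fun m hm => ?_
    rw [Polynomial.finsetSum_coeff]
    refine Finset.sum_eq_zero fun k hk => ?_
    rw [Polynomial.coeff_C_mul_X_pow, if_neg]
    have := Finset.mem_range.1 hk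
    omega
  · rw [← h, Polynomial.eval₂_add, Polynomial.eval₂_X_pow, Polynomial.eval₂_finsetSum]
    simp

theorem isIntegral_mono {R : Type*} [CommRing R] [Algebra R L] {S T : Subalgebra R L} (h : S ≤ T)
    {a : L} (ha : IsIntegral S a) : IsIntegral T a := by
  obtain ⟨P, hP, h0⟩ := ha
  refine ⟨P.map (Subalgebra.inclusion h).toRingHom, hP.map _, ?_⟩
  rw [Polynomial.eval₂_map]; exact h0

theorem pow_last_eq {p : ℕ} {s : ℕ} {Z : Fin (s + 1) → L} {u : Fin s → L}
    (h : ∀ i : Fin s, Z i.succ ^ p = Z i.castSucc * u i) :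
    Z (Fin.last s) ^ p ^ s = Z 0 * ∏ i : Fin s, u i ^ p ^ (i : ℕ) := by
  induction s with
  | zero => simp
  | succ s ih =>
    have h1 := ih (Z := fun i => Z i.castSucc) (u := fun i => u i.castSucc)
      fun i => by rw [← h]; rfl
    rw [Fin.prod_univ_castSucc, ← Fin.succ_last, pow_succ', pow_mul, h, mul_pow]
    simp only [Fin.val_castSucc, Fin.val_last]
    rw [h1, Fin.castSucc_zero, mul_assoc]

/-- The elements `Z_i` are obtained by descending recursion from `Z_{s-1}`. -/
theorem exists_tower {p : ℕ} {s : ℕ} {u : Fin s → L} {z : L} (hu : ∀ i, u i ≠ 0)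
    (hz : z ^ p ^ s = ∏ i : Fin s, u i ^ p ^ (i : ℕ)) :
    ∃ Z : Fin (s + 1) → L, Z 0 = 1 ∧ Z (Fin.last s) = z ∧
      ∀ i : Fin s, Z i.succ ^ p = Z i.castSucc * u i := by
  let Z : Fin (s + 1) → L := fun i => Fin.reverseInduction (motive := fun _ => L) z
    (fun i a => a ^ p / u i) i
  have h (i : Fin s) : Z i.succ ^ p = Z i.castSucc * u i := by
    have : Z i.castSucc = Z i.succ ^ p / u i := Fin.reverseInduction_castSucc _
    rw [this, div_mul_cancel₀ _ (hu i)]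
  have hl : Z (Fin.last s) = z := Fin.reverseInduction_last
  refine ⟨Z, ?_, hl, h⟩
  -- The descent ends at a value Z_{-1} with z^{p^s} = Z_{-1} ∏ u_i^{p^i}; the Kummer equation
  -- forces Z_{-1} = 1.
  have h1 := pow_last_eq h
  rw [hl, hz] at h1
  exact (mul_eq_right₀ (Finset.prod_ne_zero_iff.2 fun i _ => pow_ne_zero _ (hu i))).1 h1.symm

/-- The system is triangular, since E_{i+1} involves only the Y_j with j < i, and l is invertible.
-/
theorem exists_eq_aeval_add_mul {R : Type*} [CommRing R] [Algebra R L] {s : ℕ} {l : L} (hl : l ≠ 0)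
    {E : Fin s → MvPolynomial (Fin s) R} (hE : ∀ i, ∀ j ∈ (E i).vars, j < i) (Z : Fin s → L) :
    ∃ Y : Fin s → L, ∀ i, Z i = MvPolynomial.aeval Y (E i) + l * Y i := by
  classical
  have h (n : ℕ) : ∃ Y : Fin s → L, ∀ i : Fin s, (i : ℕ) < n →
      Z i = MvPolynomial.aeval Y (E i) + l * Y i := by
    induction n with
    | zero => exact ⟨0, fun i hi => (Nat.not_lt_zero _ hi).elim⟩
    | succ n ih =>
      obtain ⟨Y, hY⟩ := ih
      by_cases hn : n < s
      · let k : Fin s := ⟨n, hn⟩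
        let Y' := Function.update Y k ((Z k - MvPolynomial.aeval Y (E k)) / l)
        have hc (i : Fin s) (hi : i ≤ k) :
            MvPolynomial.aeval Y' (E i) = MvPolynomial.aeval Y (E i) := by
          refine MvPolynomial.eval₂Hom_congr' rfl (fun j hj _ => ?_) rfl
          exact Function.update_of_ne ((hE i j hj).trans_le hi).ne _ _
        refine ⟨Y', fun i hi => ?_⟩
        rcases (Nat.lt_succ_iff_lt_or_eq.1 hi) with hi | hi
        · have hik : i < k := hi
          rw [hc i hik.le, show Y' i = Y i from Function.update_of_ne hik.ne _ _]
          exact hY i hi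
        · obtain rfl : i = k := Fin.ext hi
          rw [hc _ le_rfl, show Y' k = _ from Function.update_self _ _ _, mul_div_cancel₀ _ hl]
          ring
      · exact ⟨Y, fun i hi => hY i (by omega)⟩
  obtain ⟨Y, hY⟩ := h s
  exact ⟨Y, fun i => hY i i.2⟩

/-- If `L` has transcendence degree at least `s`, then `s` generators are algebraically
independent. -/
theorem algebraicIndependent_of_adjoin_eq_top {K : Type*} [Field K] [Algebra K L] {s : ℕ}
    {x Y : Fin s → L} (hx : AlgebraicIndependent K x)
    (hY : IntermediateField.adjoin K (Set.range Y) = ⊤) : AlgebraicIndependent K Y := by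
  have : Algebra.IsAlgebraic (Algebra.adjoin K (Set.range Y)) L := by
    refine ⟨fun a => ?_⟩
    obtain ⟨r, q, rfl⟩ := (IntermediateField.mem_adjoin_range_iff K Y a).1 (hY ▸ trivial)
    have h (f : MvPolynomial (Fin s) K) :
        IsAlgebraic (Algebra.adjoin K (Set.range Y)) (MvPolynomial.aeval Y f) := by
      have hf : MvPolynomial.aeval Y f ∈ Algebra.adjoin K (Set.range Y) := by
        rw [Algebra.adjoin_range_eq_range_aeval]; exact ⟨f, rfl⟩
      exact isAlgebraic_algebraMap (⟨_, hf⟩ : Algebra.adjoin K (Set.range Y))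
    rw [div_eq_mul_inv]
    exact (h r).mul (h q).inv
  refine (Algebra.IsAlgebraic.isTranscendenceBasis_of_lift_le_trdeg_of_finite K (x := Y) ?_).1
  exact hx.lift_cardinalMk_le_trdeg

end Towers

/-! ### The tower in L and the integral closures. -/

section TowerStructure

variable {K : Type*} [Field K] [CharZero K] {p s : ℕ} [hp : Fact p.Prime] {ζ : K}
variable [IsCyclotomicExtension {p ^ s} ℚ K] {L : Type*} [Field L] [Algebra K L]

/-- The equations relating the elements `X_i`, `Y_i` and `Z_i` of the Kummer extension, and the
integrality properties that come from the power series. -/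
structure IsTower (G E : Fin s → MvPolynomial (Fin s) (baseRing p ζ)) (x Y : Fin s → L)
    (Z : Fin (s + 1) → L) : Prop where
  vars_G : ∀ i, ∀ j ∈ (G i).vars, j < i
  vars_E : ∀ i, ∀ j ∈ (E i).vars, j < i
  G_eq : ∀ i, ∃ r, G i = 1 + MvPolynomial.C (unif p ζ) * r
  E_eq : ∀ i, ∃ r, E i = 1 + MvPolynomial.C (unif p ζ) * r
  algebraicIndependent : AlgebraicIndependent K x
  adjoin_eq_top : IntermediateField.adjoin K (Set.range x ∪ {Z (Fin.last s)}) = ⊤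
  Z_zero : Z 0 = 1
  Z_ne_zero : ∀ i, Z i ≠ 0
  Z_succ : ∀ i : Fin s, Z i.succ = MvPolynomial.aeval Y (polyZ E i)
  Z_pow : ∀ i : Fin s, Z i.succ ^ p = Z i.castSucc * kummerU ζ G x i
  x_mem : ∀ i : Fin s, x i ∈ adjoinInvBelow Y (polyZ E) (i + 1)
  exists_eq : ∀ i : Fin s, ∃ c ∈ adjoinInvBelow Y (polyZ E) i, MvPolynomial.aeval Y (E i) ^ p =
    Z i.castSucc * MvPolynomial.aeval x (G i) + algebraMap K L (p * lam p s ζ) * c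

variable {G E : Fin s → MvPolynomial (Fin s) (baseRing p ζ)} {x Y : Fin s → L}
  {Z : Fin (s + 1) → L}

theorem adjoinInvBelow_le_adjoinInv {F : Fin s → MvPolynomial (Fin s) (baseRing p ζ)} (n : ℕ) :
    adjoinInvBelow Y F n ≤ adjoinInv Y F :=
  Algebra.adjoin_mono fun _ ⟨i, _, ha⟩ => ⟨i, ha⟩

theorem adjoinInv_le_adjoinInvBelow {F : Fin s → MvPolynomial (Fin s) (baseRing p ζ)} :
    adjoinInv Y F ≤ adjoinInvBelow Y F s :=
  Algebra.adjoin_mono fun _ ⟨i, ha⟩ => ⟨i, i.2, ha⟩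

theorem aeval_mem_adjoinInvBelow {F : Fin s → MvPolynomial (Fin s) (baseRing p ζ)} {n : ℕ}
    {f : MvPolynomial (Fin s) (baseRing p ζ)} (hf : ∀ j ∈ f.vars, (j : ℕ) < n) :
    MvPolynomial.aeval Y f ∈ adjoinInvBelow Y F n :=
  aeval_mem_of_vars _ fun j hj => Algebra.subset_adjoin ⟨j, hf j hj, Or.inl rfl⟩

namespace IsTower

theorem coordV_eq (h : IsTower G E x Y Z) : coordV p ζ x (kummerU ζ G x) = adjoinInv x (polyU G) := by
  rw [coordV, adjoinInv]; simp only [aeval_polyU]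

theorem coordW_eq (h : IsTower G E x Y Z) : coordW p ζ Y Z = adjoinInv Y (polyZ E) := by
  rw [coordW, adjoinInv]; simp only [h.Z_succ]

theorem Z_mem (h : IsTower G E x Y Z) {n : ℕ} {i : Fin (s + 1)} (hi : (i : ℕ) ≤ n) :
    Z i ∈ adjoinInvBelow Y (polyZ E) n ∧ (Z i)⁻¹ ∈ adjoinInvBelow Y (polyZ E) n := by
  induction i using Fin.cases with
  | zero => rw [h.Z_zero, inv_one]; exact ⟨one_mem _, one_mem _⟩
  | succ i =>
    have hi' : (i : ℕ) < n := hi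
    rw [h.Z_succ]
    exact ⟨aeval_mem_adjoinInvBelow fun j hj =>
      (Fin.le_def.1 (vars_polyZ_le h.vars_E i j hj)).trans_lt hi',
      Algebra.subset_adjoin ⟨i, hi', Or.inr rfl⟩⟩

theorem kummerU_ne_zero (h : IsTower G E x Y Z) (i : Fin s) : kummerU ζ G x i ≠ 0 := fun h0 =>
  pow_ne_zero p (h.Z_ne_zero i.succ) (by rw [h.Z_pow, h0, mul_zero])

theorem inv_kummerU_mem (h : IsTower G E x Y Z) (i : Fin s) :
    (kummerU ζ G x i)⁻¹ ∈ adjoinInvBelow Y (polyZ E) (i + 1) := by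
  have h1 : (kummerU ζ G x i)⁻¹ = Z i.castSucc * (Z i.succ)⁻¹ ^ p := by
    have := h.kummerU_ne_zero i
    have := h.Z_ne_zero i.castSucc
    rw [inv_pow, h.Z_pow]; field_simp
  rw [h1]
  exact mul_mem (h.Z_mem (i := i.castSucc) (Nat.le_succ (i : ℕ))).1
    (pow_mem (h.Z_mem (i := i.succ) (Fin.val_succ i).le).2 _)

/-- The equation of degree `p` satisfied by `Y_i`. -/
theorem Y_pow_add_sum_eq_zero (h : IsTower G E x Y Z) (hs : 1 ≤ s) (hζ : IsPrimitiveRoot ζ (p ^ s))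
     (i : Fin s) : ∃ w ∈ baseRing p ζ, ∃ c ∈ adjoinInvBelow Y (polyZ E) i,
    Y i ^ p + ∑ k ∈ Finset.range p, (algebraMap K L w * if k = 0 then c - Z i.castSucc * x i else
      (p.choose k / p : ℕ) * algebraMap K L (lam p s ζ) ^ (k - 1) *
        MvPolynomial.aeval Y (E i) ^ (p - k)) * Y i ^ k = 0 := by
  obtain ⟨y, hy, hly⟩ := exists_lam_pow_eq hs hζ
  have hyw : (-1 : K) + (ζ - 1) * y ∈ baseRing p ζ := add_mem (neg_mem (one_mem _))
    (mul_mem pi_mem hy)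
  obtain ⟨hw0, hw⟩ := inv_mem_of_eq_add hs hζ hyw (neg_mem (one_mem _)) (by simp)
    (by simp) hy rfl
  set w := (-1 : K) + (ζ - 1) * y
  obtain ⟨c, hc, hec⟩ := h.exists_eq i
  refine ⟨w⁻¹, hw, c, hc, ?_⟩
  have hl0 : algebraMap K L (lam p s ζ) ≠ 0 := (map_ne_zero _).2 (lam_ne_zero hs hζ)
  have hw0' : algebraMap K L w ≠ 0 := (map_ne_zero _).2 hw0
  have hly' := congrArg (algebraMap K L) hly
  rw [map_pow, map_mul, map_mul, map_natCast] at hly'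
  have hZ := h.Z_pow i
  rw [h.Z_succ, aeval_polyZ, kummerU] at hZ
  rw [map_mul, map_natCast] at hec hZ
  rw [map_inv₀]
  set l := algebraMap K L (lam p s ζ)
  set e := MvPolynomial.aeval Y (E i)
  set w' := algebraMap K L w
  obtain ⟨q, rfl⟩ : ∃ q, p = q + 1 := ⟨p - 1, by have := hp.out.pos; omega⟩
  -- Expand (E + λY)^p = Z_{i-1}(G + pλX), subtract E^p = Z_{i-1}G + pλc, and divide by λ^p = pλw; p
  -- divides the inner binomial coefficients. Modulo π, where w = -1 and E = Z_{i-1} = 1, this is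
  -- the Artin-Schreier equation Y^p - Y = c - X.
  rw [add_comm e, add_pow, Finset.sum_range_succ, Finset.sum_range_succ'] at hZ
  have hk (k : ℕ) (hk : k ∈ Finset.range q) : l ^ (q + 1) * ((w'⁻¹ *
      (((q + 1).choose (k + 1) / (q + 1) : ℕ) * l ^ (k + 1 - 1) * e ^ (q + 1 - (k + 1)))) *
        Y i ^ (k + 1)) =
      (l * Y i) ^ (k + 1) * e ^ (q + 1 - (k + 1)) * ((q + 1).choose (k + 1) : ℕ) := by
    have hd : q + 1 ∣ (q + 1).choose (k + 1) :=
      hp.out.dvd_choose_self (by omega) (by have := Finset.mem_range.1 hk; omega)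
    obtain ⟨m, hm⟩ := hd
    rw [hm, Nat.mul_div_cancel_left _ (Nat.succ_pos q), hly', Nat.add_sub_cancel]
    push_cast
    field_simp
    ring
  refine (mul_eq_zero_iff_left (pow_ne_zero (q + 1) hl0)).1 ?_
  rw [mul_add, Finset.mul_sum, Finset.sum_range_succ']
  simp only [Nat.succ_ne_zero, if_false, if_true]
  rw [Finset.sum_congr rfl hk]
  have h0 : l ^ (q + 1) * (w'⁻¹ * (c - Z i.castSucc * x i) * Y i ^ 0) =
      ((q + 1 : ℕ) : L) * l * (c - Z i.castSucc * x i) := by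
    rw [hly']; field_simp
  rw [h0]
  simp only [Nat.sub_self, Nat.sub_zero, pow_zero, Nat.choose_self, Nat.choose_zero_right,
    Nat.cast_one, mul_one, one_mul] at hZ
  linear_combination hZ - hec

/-- An integrally closed subring containing `X_i` and `1/u_i` and the generators below `i` contains
the generators `Y_i` and `1/Z_i`. -/
theorem adjoinInvBelow_succ_le (h : IsTower G E x Y Z) (hs : 1 ≤ s) (hζ : IsPrimitiveRoot ζ (p ^ s))
     {I : Subalgebra (baseRing p ζ) L}
    (hI : ∀ a, IsIntegral I a → a ∈ I) (i : Fin s) (hle : adjoinInvBelow Y (polyZ E) i ≤ I)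
    (hx : x i ∈ I) (hu : (kummerU ζ G x i)⁻¹ ∈ I) :
    adjoinInvBelow Y (polyZ E) (i + 1) ≤ I := by
  have hK {r : K} (hr : r ∈ baseRing p ζ) : algebraMap K L r ∈ I := I.algebraMap_mem ⟨r, hr⟩
  have hZ : Z i.castSucc ∈ I := hle (h.Z_mem (n := i) (i := i.castSucc) le_rfl).1
  have hZi : (Z i.succ)⁻¹ ∈ I := by
    refine hI _ (IsIntegral.of_pow hp.out.pos ?_)
    have hm : (Z i.succ)⁻¹ ^ p ∈ I := by
      rw [inv_pow, h.Z_pow, mul_inv]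
      exact mul_mem (hle (h.Z_mem (n := i) (i := i.castSucc) le_rfl).2) hu
    exact isIntegral_algebraMap (R := I) (x := ⟨_, hm⟩)
  have hY : Y i ∈ I := by
    obtain ⟨w, hw, c, hc, h0⟩ := h.Y_pow_add_sum_eq_zero hs hζ i
    have hm (k : ℕ) : (algebraMap K L w * if k = 0 then c - Z i.castSucc * x i else
        (p.choose k / p : ℕ) * algebraMap K L (lam p s ζ) ^ (k - 1) *
        MvPolynomial.aeval Y (E i) ^ (p - k)) ∈ I := by
      refine mul_mem (hK hw) ?_
      split_ifs
      · exact sub_mem (hle hc) (mul_mem hZ hx)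
      · exact mul_mem (mul_mem (natCast_mem _ _) (pow_mem (hK (lam_mem s)) _))
          (pow_mem (hle (aeval_mem_adjoinInvBelow fun j hj => h.vars_E i j hj)) _)
    exact hI _ (isIntegral_of_pow_add_sum_eq_zero (A := I) (fun k => ⟨_, hm k⟩) h0)
  refine Algebra.adjoin_le ?_
  rintro _ ⟨j, hj, hja⟩
  rcases Nat.lt_succ_iff_lt_or_eq.1 hj with hj | hj
  · exact hle (Algebra.subset_adjoin ⟨j, hj, hja⟩)
  · obtain rfl : j = i := Fin.ext hj
    rcases hja with rfl | rfl
    · exact hY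
    · rw [← h.Z_succ]; exact hZi

theorem adjoin_Y_eq_top (h : IsTower G E x Y Z) : IntermediateField.adjoin K (Set.range Y) = ⊤ := by
  have hle (n : ℕ) : ∀ a ∈ adjoinInvBelow Y (polyZ E) n,
      a ∈ IntermediateField.adjoin K (Set.range Y) := by
    have hY (i : Fin s) : Y i ∈ IntermediateField.adjoin K (Set.range Y) :=
      IntermediateField.subset_adjoin _ _ ⟨i, rfl⟩
    have hK (f : MvPolynomial (Fin s) (baseRing p ζ)) :
        MvPolynomial.aeval Y f ∈ IntermediateField.adjoin K (Set.range Y) := by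
      rw [MvPolynomial.aeval_def, MvPolynomial.eval₂_eq]
      exact sum_mem fun d _ => mul_mem (IntermediateField.algebraMap_mem _ _)
        (prod_mem fun i _ => pow_mem (hY i) _)
    intro a ha
    induction ha using Algebra.adjoin_induction with
    | mem x hx =>
      obtain ⟨i, -, rfl | rfl⟩ := hx
      · exact hY i
      · exact inv_mem (hK _)
    | algebraMap r => exact IntermediateField.algebraMap_mem _ (r : K)
    | add x y _ _ hx hy => exact add_mem hx hy
    | mul x y _ _ hx hy => exact mul_mem hx hy
  rw [← top_le_iff, ← h.adjoin_eq_top, IntermediateField.adjoin_le_iff]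
  rintro _ (⟨i, rfl⟩ | rfl)
  · exact hle _ _ (h.x_mem i)
  · exact hle _ _ (h.Z_mem (n := s) (i := Fin.last s) le_rfl).1

theorem algebraicIndependent_Y (h : IsTower G E x Y Z) : AlgebraicIndependent K Y :=
  algebraicIndependent_of_adjoin_eq_top h.algebraicIndependent h.adjoin_Y_eq_top

/-- The ring generated by all the `Y_i` and `1/Z_i` is integrally closed in `L`. -/
theorem mem_of_isIntegral (h : IsTower G E x Y Z) (hs : 1 ≤ s) (hζ : IsPrimitiveRoot ζ (p ^ s))
     {a : L} (ha : IsIntegral (adjoinInv Y (polyZ E)) a) :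
    a ∈ adjoinInv Y (polyZ E) :=
  mem_adjoinInv_of_isIntegral hs hζ h.algebraicIndependent_Y (polyZ_eq_one_add h.E_eq)
    (h.adjoin_Y_eq_top ▸ trivial) ha

theorem coordV_le (h : IsTower G E x Y Z) : coordV p ζ x (kummerU ζ G x) ≤ adjoinInv Y (polyZ E) := by
  refine Algebra.adjoin_le ?_
  rintro _ ⟨i, rfl | rfl⟩
  · exact adjoinInvBelow_le_adjoinInv _ (h.x_mem i)
  · exact adjoinInvBelow_le_adjoinInv _ (h.inv_kummerU_mem i)

theorem coordB_le (h : IsTower G E x Y Z) : coordB p ζ x (kummerU ζ G x) Y Z ≤ adjoinInv Y (polyZ E) := by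
  refine Algebra.adjoin_le ?_
  rintro _ (⟨i, -, rfl | rfl⟩ | ⟨i, -, rfl | rfl⟩)
  · exact mem_adjoinInv i
  · rw [h.Z_succ]; exact inv_mem_adjoinInv i
  · exact adjoinInvBelow_le_adjoinInv _ (h.x_mem i)
  · exact adjoinInvBelow_le_adjoinInv _ (h.inv_kummerU_mem i)

theorem mem_restrictScalars_integralClosure {T : Subalgebra (baseRing p ζ) L} {a : L} :
    a ∈ (integralClosure T L).restrictScalars (baseRing p ζ) ↔ IsIntegral T a := Iff.rfl

/-- A sandwich: the closure cannot exceed the normal ring containing T, and it contains the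
generators of that ring by assumption. -/
theorem integralClosure_eq (h : IsTower G E x Y Z) (hs : 1 ≤ s) (hζ : IsPrimitiveRoot ζ (p ^ s))
     {T : Subalgebra (baseRing p ζ) L} (hle : T ≤ adjoinInv Y (polyZ E))
    (hge : adjoinInvBelow Y (polyZ E) s ≤
      (integralClosure T L).restrictScalars (baseRing p ζ)) :
    (integralClosure T L).restrictScalars (baseRing p ζ) = coordW p ζ Y Z := by
  rw [h.coordW_eq]
  refine le_antisymm (fun a ha => ?_) (adjoinInv_le_adjoinInvBelow.trans hge)
  exact h.mem_of_isIntegral hs hζ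
    (isIntegral_mono hle (mem_restrictScalars_integralClosure.1 ha))

theorem mem_integralClosure_of_isIntegral {T : Subalgebra (baseRing p ζ) L} {a : L}
    (ha : IsIntegral ((integralClosure T L).restrictScalars (baseRing p ζ)) a) :
    a ∈ (integralClosure T L).restrictScalars (baseRing p ζ) := by
  have : IsIntegral (integralClosure T L) a := ha
  exact isIntegral_trans (A := integralClosure T L) a this

theorem le_integralClosure (T : Subalgebra (baseRing p ζ) L) :
    T ≤ (integralClosure T L).restrictScalars (baseRing p ζ) := fun a ha =>
  isIntegral_algebraMap (R := T) (x := ⟨a, ha⟩)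

/-- Climb the tower one level at a time, using the monic equation for Y_i and 1/Z_i^p =
1/(Z_{i-1}u_i). For B_{s-1} only the last level remains to be climbed. -/
theorem integralClosure_coordV (h : IsTower G E x Y Z) (hs : 1 ≤ s) (hζ : IsPrimitiveRoot ζ (p ^ s))
     :
    (integralClosure (coordV p ζ x (kummerU ζ G x)) L).restrictScalars (baseRing p ζ) =
      coordW p ζ Y Z := by
  refine h.integralClosure_eq hs hζ h.coordV_le ?_
  have hle (n : ℕ) (hn : n ≤ s) : adjoinInvBelow Y (polyZ E) n ≤
      (integralClosure (coordV p ζ x (kummerU ζ G x)) L).restrictScalars (baseRing p ζ) := by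
    induction n with
    | zero =>
      refine Algebra.adjoin_le ?_
      rintro _ ⟨i, hi, -⟩
      exact (Nat.not_lt_zero _ hi).elim
    | succ n ih =>
      refine h.adjoinInvBelow_succ_le hs hζ (fun _ => mem_integralClosure_of_isIntegral) ⟨n, hn⟩
        (ih (Nat.le_of_succ_le hn)) (le_integralClosure _ ?_) (le_integralClosure _ ?_)
      · exact Algebra.subset_adjoin ⟨_, Or.inl rfl⟩
      · exact Algebra.subset_adjoin ⟨_, Or.inr rfl⟩
  exact hle s le_rfl

theorem integralClosure_coordB (h : IsTower G E x Y Z) (hs : 1 ≤ s) (hζ : IsPrimitiveRoot ζ (p ^ s))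
     :
    (integralClosure (coordB p ζ x (kummerU ζ G x) Y Z) L).restrictScalars (baseRing p ζ) =
      coordW p ζ Y Z := by
  refine h.integralClosure_eq hs hζ h.coordB_le ?_
  obtain ⟨n, rfl⟩ : ∃ n, s = n + 1 := ⟨s - 1, by omega⟩
  refine h.adjoinInvBelow_succ_le hs hζ (fun _ => mem_integralClosure_of_isIntegral) (Fin.last n)
    ?_ (le_integralClosure _ ?_) (le_integralClosure _ ?_)
  · refine le_trans (Algebra.adjoin_mono ?_) (le_integralClosure _)
    rintro _ ⟨i, hi, hia⟩
    rw [← h.Z_succ] at hia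
    exact Or.inl ⟨i, Nat.succ_lt_succ hi, hia⟩
  · exact Algebra.subset_adjoin (Or.inr ⟨_, rfl, Or.inl rfl⟩)
  · exact Algebra.subset_adjoin (Or.inr ⟨_, rfl, Or.inr rfl⟩)

end IsTower

end TowerStructure

/-! ### Cyclicity of the Kummer extension. -/

section Kummer

variable {F L : Type*} [Field F] [CharZero F] [Field L] [Algebra F L] {p s : ℕ} [hp : Fact p.Prime]

open Polynomial in
/-- A criterion for a Kummer extension of exponent `p^s` to have degree `p^s`. -/
theorem isGalois_and_nonempty_mulEquiv {η : F} (hη : IsPrimitiveRoot η (p ^ (s + 1))) {α : L} {a : F}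
    (ha0 : a ≠ 0) (ha : α ^ p ^ (s + 1) = algebraMap F L a) (hα : IntermediateField.adjoin F {α} = ⊤)
    (hn : α ^ p ^ s ∉ Set.range (algebraMap F L)) :
    IsGalois F L ∧ FiniteDimensional F L ∧
      Nonempty (Multiplicative (ZMod (p ^ (s + 1))) ≃* Gal(L/F)) := by
  have hpos : 0 < p ^ (s + 1) := pow_pos hp.out.pos _
  have hα0 : α ≠ 0 := by
    rintro rfl
    exact hn ⟨0, by rw [map_zero, zero_pow (pow_pos hp.out.pos s).ne']⟩
  have hroot : aeval α (X ^ p ^ (s + 1) - C a) = 0 := by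
    rw [map_sub, map_pow, aeval_X, aeval_C, ha, sub_self]
  have hint : IsIntegral F α := ⟨_, monic_X_pow_sub_C a hpos.ne', hroot⟩
  have hsplit : IsSplittingField F L (X ^ p ^ (s + 1) - C a) := by
    constructor
    · rw [Polynomial.map_sub, Polynomial.map_pow, Polynomial.map_C, Polynomial.map_X]
      exact X_pow_sub_C_splits_of_isPrimitiveRoot
        (hη.map_of_injective (algebraMap F L).injective) ha
    · rw [eq_top_iff, ← IntermediateField.top_toSubalgebra, ← hα,
        IntermediateField.adjoin_simple_toSubalgebra_of_isAlgebraic hint.isAlgebraic]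
      apply Algebra.adjoin_mono
      rw [Set.singleton_subset_iff, mem_rootSet_of_ne (X_pow_sub_C_ne_zero hpos a)]
      exact hroot
  have hfin : FiniteDimensional F L := IsSplittingField.finiteDimensional L (X ^ p ^ (s + 1) - C a)
  have hgal : IsGalois F L := IsGalois.of_separable_splitting_field
    (separable_X_pow_sub_C a (Nat.cast_ne_zero.2 hpos.ne') ha0)
  refine ⟨hgal, hfin, ?_⟩
  -- For such σ the root of unity σα/α has order exactly p^{s+1}, so σ has order at least p^{s+1},
  -- which already bounds the degree. Hence σ generates the group.
  obtain ⟨σ, hσ⟩ : ∃ σ : Gal(L/F), σ (α ^ p ^ s) ≠ α ^ p ^ s := by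
    by_contra! h
    exact hn ((IsGalois.mem_range_algebraMap_iff_fixed _).2 h)
  have hξn : (σ α / α) ^ p ^ (s + 1) = 1 := by
    rw [div_pow, ← map_pow, ha, σ.commutes, div_self]
    exact (_root_.map_ne_zero _).2 ha0
  have : NeZero (p ^ (s + 1)) := ⟨hpos.ne'⟩
  obtain ⟨k, -, hk⟩ := (hη.map_of_injective (algebraMap F L).injective).eq_pow_of_pow_eq_one hξn
  rw [← map_pow] at hk
  have hσα : σ α = algebraMap F L (η ^ k) * α := by rw [hk, div_mul_cancel₀ _ hα0]
  have hord : orderOf (η ^ k) = p ^ (s + 1) := by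
    refine orderOf_eq_prime_pow (fun h1 => hσ ?_) ?_
    · rw [map_pow, hσα, mul_pow, ← map_pow, h1, map_one, one_mul]
    · rw [← pow_mul, mul_comm, pow_mul, hη.pow_eq_one, one_pow]
  have hpow (m : ℕ) : (σ ^ m) α = algebraMap F L ((η ^ k) ^ m) * α := by
    induction m with
    | zero => simp
    | succ m ih =>
      rw [pow_succ', AlgEquiv.mul_apply, ih, map_mul, σ.commutes, hσα, ← mul_assoc, ← map_mul,
        ← pow_succ]
  have hdvd : p ^ (s + 1) ∣ orderOf σ := by
    rw [← hord, orderOf_dvd_iff_pow_eq_one]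
    have h1 := hpow (orderOf σ)
    rw [pow_orderOf_eq_one, AlgEquiv.one_apply] at h1
    have h2 := mul_right_cancel₀ hα0 ((one_mul α).trans h1)
    exact (algebraMap F L).injective (by rw [map_one, ← h2])
  have hcard : Nat.card Gal(L/F) ≤ p ^ (s + 1) := by
    rw [IsGalois.card_aut_eq_finrank, ← IntermediateField.finrank_top', ← hα,
      IntermediateField.adjoin.finrank hint, ← natDegree_X_pow_sub_C (n := p ^ (s + 1)) (r := a)]
    exact natDegree_le_of_dvd (minpoly.dvd _ _ hroot) (X_pow_sub_C_ne_zero hpos a)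
  have hle : p ^ (s + 1) ≤ orderOf σ := Nat.le_of_dvd (orderOf_pos σ) hdvd
  have hle' : orderOf σ ≤ Nat.card Gal(L/F) := orderOf_le_card
  have hcyc : IsCyclic Gal(L/F) := isCyclic_of_orderOf_eq_card σ (by omega)
  have hc : Nat.card Gal(L/F) = p ^ (s + 1) := by omega
  rw [← hc]
  exact ⟨zmodCyclicMulEquiv hcyc⟩

end Kummer

/-! ### The Galois action on an integral closure. -/

section Restriction

variable {R : Type*} [CommRing R] {K L : Type*} [Field K] [Field L] [Algebra K L] [Algebra R L]
  (V : Subalgebra R L) (F : IntermediateField K L) (hVF : ∀ v ∈ V, v ∈ F)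

/-- The automorphism of `L` over `V` given by an automorphism of `L` over a field containing
`V`. -/
def autOver (σ : Gal(L/F)) : L ≃ₐ[V] L :=
  AlgEquiv.ofRingEquiv (f := (σ : L ≃+* L)) fun v => σ.commutes ⟨v, hVF v v.2⟩

/-- The action of the Galois group on the integral closure. -/
def galAction : Gal(L/F) →* (integralClosure V L ≃ₐ[V] integralClosure V L) where
  toFun σ := (autOver V F hVF σ).mapIntegralClosure
  map_one' := rfl
  map_mul' _ _ := rfl

end Restriction

/-! ### The Galois group of the tower and the torsor property. -/

section GaloisTower

variable {K : Type*} [Field K] [CharZero K] {p s : ℕ} [hp : Fact p.Prime] {ζ : K}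
variable [IsCyclotomicExtension {p ^ s} ℚ K] {L : Type*} [Field L] [Algebra K L]
variable {G E : Fin s → MvPolynomial (Fin s) (baseRing p ζ)} {x Y : Fin s → L}
  {Z : Fin (s + 1) → L}

namespace IsTower

theorem mem_adjoin_of_mem_coordV {v : L} (hv : v ∈ coordV p ζ x (kummerU ζ G x)) :
    v ∈ IntermediateField.adjoin K (Set.range x) := by
  have hx (i : Fin s) : x i ∈ IntermediateField.adjoin K (Set.range x) :=
    IntermediateField.subset_adjoin _ _ ⟨i, rfl⟩
  have hK (f : MvPolynomial (Fin s) (baseRing p ζ)) :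
      MvPolynomial.aeval x f ∈ IntermediateField.adjoin K (Set.range x) := by
    rw [MvPolynomial.aeval_def, MvPolynomial.eval₂_eq]
    exact sum_mem fun d _ => mul_mem (IntermediateField.algebraMap_mem _ _)
      (prod_mem fun i _ => pow_mem (hx i) _)
  induction hv using Algebra.adjoin_induction with
  | mem a ha =>
    obtain ⟨i, rfl | rfl⟩ := ha
    · exact hx i
    · rw [← aeval_polyU]; exact inv_mem (hK _)
  | algebraMap r => exact IntermediateField.algebraMap_mem _ (r : K)
  | add x y _ _ hx hy => exact add_mem hx hy
  | mul x y _ _ hx hy => exact mul_mem hx hy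

theorem kummerU_mem_adjoin (i : Fin s) :
    kummerU ζ G x i ∈ IntermediateField.adjoin K (Set.range x) := by
  rw [← inv_inv (kummerU ζ G x i)]
  exact inv_mem (mem_adjoin_of_mem_coordV (Algebra.subset_adjoin ⟨i, Or.inr rfl⟩))

theorem mem_coordV_of_isIntegral (h : IsTower G E x Y Z) (hs : 1 ≤ s)
    (hζ : IsPrimitiveRoot ζ (p ^ s)) {a : L} (ha : a ∈ IntermediateField.adjoin K (Set.range x))
    (hint : IsIntegral (coordV p ζ x (kummerU ζ G x)) a) :
    a ∈ coordV p ζ x (kummerU ζ G x) := by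
  rw [h.coordV_eq] at hint ⊢
  exact mem_adjoinInv_of_isIntegral hs hζ h.algebraicIndependent (polyU_eq_one_add h.G_eq) ha hint

/-- The element `u_0`, being of degree one in `X_0`, is not a `p`-th power. -/
theorem pow_ne_kummerU (h : IsTower G E x Y Z) (hs : 1 ≤ s) (hζ : IsPrimitiveRoot ζ (p ^ s)) {y : L}
    (hy : y ∈ IntermediateField.adjoin K (Set.range x)) : y ^ p ≠ kummerU ζ G x ⟨0, hs⟩ := by
  intro he
  set i : Fin s := ⟨0, hs⟩
  have hpl : (⟨p * lam p s ζ, p_mul_lam_mem⟩ : baseRing p ζ) ≠ 0 :=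
    fun h => p_mul_lam_ne_zero hs hζ (congrArg Subtype.val h)
  -- Inverting only 1 leaves the polynomial ring R[X], which is normal, so a p-th root of u_0 in
  -- K(X) would be a polynomial. Its p-th power has degree in X_0 divisible by p, while u_0 has
  -- degree 1.
  let D : Fin s → MvPolynomial (Fin s) (baseRing p ζ) := fun _ => 1
  have hint : IsIntegral (adjoinInv x D) y := by
    refine IsIntegral.of_pow hp.out.pos ?_
    have hm : y ^ p ∈ adjoinInv x D := by
      rw [he, ← aeval_polyU]; exact aeval_mem_adjoinInv _
    exact isIntegral_algebraMap (R := adjoinInv x D) (x := ⟨_, hm⟩)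
  have hy' := mem_adjoinInv_of_isIntegral hs hζ h.algebraicIndependent (D := D)
    (fun _ => ⟨0, by rw [mul_zero, add_zero]⟩) hy hint
  obtain ⟨n, f, hf⟩ := exists_mul_pow_eq (fun i => by
    change MvPolynomial.aeval x (1 : MvPolynomial (Fin s) (baseRing p ζ)) ≠ 0
    rw [map_one]; exact one_ne_zero) hy'
  have hf' : y = MvPolynomial.aeval x f := by simpa [D] using hf
  have hfp : f ^ p = polyU G i := by
    refine algebraicIndependent_baseRing h.algebraicIndependent ?_
    rw [map_pow, ← hf', he, aeval_polyU]
  have hG0 : (G i).degreeOf i = 0 := by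
    rw [MvPolynomial.degreeOf_def, Multiset.count_eq_zero]
    intro hm
    refine (h.vars_G i i ?_).ne rfl
    rw [MvPolynomial.vars_def]; exact Multiset.mem_toFinset.2 hm
  have hX : (MvPolynomial.C ⟨p * lam p s ζ, p_mul_lam_mem⟩ * MvPolynomial.X i :
      MvPolynomial (Fin s) (baseRing p ζ)).degreeOf i = 1 := by
    rw [MvPolynomial.degreeOf_C_mul _ _ (mem_nonZeroDivisors_of_ne_zero hpl),
      MvPolynomial.degreeOf_X_self]
  have hdeg : (polyU G i).degreeOf i = 1 := by
    rw [polyU, add_comm, MvPolynomial.degreeOf_add_eq_of_degreeOf_lt, hX]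
    rw [hX, hG0]; exact Nat.one_pos
  have hf0 : f ≠ 0 := by
    rintro rfl
    rw [← hfp, zero_pow hp.out.ne_zero, MvPolynomial.degreeOf_zero] at hdeg
    exact zero_ne_one hdeg
  rw [← hfp, MvPolynomial.degreeOf_pow_eq _ _ _ hf0] at hdeg
  exact hp.out.one_lt.ne' (Nat.eq_one_of_mul_eq_one_right hdeg)

/-- In the Kummer equation every factor except u_0 is a p-th power, so the right-hand side is u_0
w^p with w in K(X). Dividing by w would give a p-th root of u_0. -/
theorem Z_last_pow_notMem {n : ℕ} [IsCyclotomicExtension {p ^ (n + 1)} ℚ K]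
    {G E : Fin (n + 1) → MvPolynomial (Fin (n + 1)) (baseRing p ζ)} {x Y : Fin (n + 1) → L}
    {Z : Fin (n + 1 + 1) → L} (h : IsTower G E x Y Z) (hζ : IsPrimitiveRoot ζ (p ^ (n + 1))) :
    Z (Fin.last (n + 1)) ^ p ^ n ∉ IntermediateField.adjoin K (Set.range x) := by
  intro hm
  have h1 := pow_last_eq h.Z_pow
  rw [h.Z_zero, one_mul, Fin.prod_univ_succ] at h1
  set w := ∏ i : Fin n, kummerU ζ G x i.succ ^ p ^ (i : ℕ) with hw
  have hw0 : w ≠ 0 := Finset.prod_ne_zero_iff.2 fun i _ => pow_ne_zero _ (h.kummerU_ne_zero _)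
  have hwm : w ∈ IntermediateField.adjoin K (Set.range x) :=
    prod_mem fun i _ => pow_mem (kummerU_mem_adjoin _) _
  refine h.pow_ne_kummerU (Nat.succ_pos n) hζ (div_mem hm hwm) ?_
  have h2 : ∏ i : Fin n, kummerU ζ G x i.succ ^ p ^ ((i.succ : Fin (n + 1)) : ℕ) = w ^ p := by
    rw [hw, ← Finset.prod_pow]
    exact Finset.prod_congr rfl fun i _ => by rw [Fin.val_succ, pow_succ, pow_mul]
  rw [div_pow, ← pow_mul, ← pow_succ, h1, h2, mul_div_cancel_right₀ _ (pow_ne_zero _ hw0),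
    Fin.val_zero, pow_zero, pow_one]
  rfl

theorem adjoin_Z_last_eq_top (h : IsTower G E x Y Z) :
    IntermediateField.adjoin (IntermediateField.adjoin K (Set.range x)) {Z (Fin.last s)} = ⊤ := by
  rw [eq_top_iff]
  intro a _
  have : a ∈ (IntermediateField.adjoin (IntermediateField.adjoin K (Set.range x))
      {Z (Fin.last s)}).restrictScalars K := by
    rw [IntermediateField.adjoin_adjoin_left, h.adjoin_eq_top]; trivial
  exact this

/-- Every non-trivial automorphism displaces one of the `Y_j` by a unit. -/
theorem exists_sub_eq (h : IsTower G E x Y Z) (hs : 1 ≤ s) (hζ : IsPrimitiveRoot ζ (p ^ s))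
    {σ : Gal(L/IntermediateField.adjoin K (Set.range x))} (hσ : σ ≠ 1) :
    ∃ (j : Fin s) (v : (baseRing p ζ)ˣ), σ (Y j) - Y j =
      algebraMap (baseRing p ζ) L v * Z j.succ := by
  have hF {a : L} (ha : a ∈ IntermediateField.adjoin K (Set.range x)) : σ a = a :=
    σ.commutes ⟨a, ha⟩
  have hK (a : K) : σ (algebraMap K L a) = algebraMap K L a :=
    hF (IntermediateField.algebraMap_mem _ a)
  let S : Subalgebra (baseRing p ζ) L :=
    { carrier := {a | σ a = a}
      mul_mem' := fun {a b} ha hb => (map_mul σ a b).trans (congrArg₂ _ ha hb)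
      add_mem' := fun {a b} ha hb => (map_add σ a b).trans (congrArg₂ _ ha hb)
      algebraMap_mem' := fun r => hK r }
  have hSinv {a : L} (ha : a ∈ S) : a⁻¹ ∈ S := (map_inv₀ σ a).trans (congrArg _ ha)
  have hlast : Z (Fin.last s) ∉ S := by
    intro hz
    refine hσ (AlgEquiv.ext fun a => ?_)
    have ha : a ∈ IntermediateField.adjoin (IntermediateField.adjoin K (Set.range x))
      {Z (Fin.last s)} := by rw [h.adjoin_Z_last_eq_top]; trivial
    change a ∈ S
    induction ha using IntermediateField.adjoin_induction with
    | mem b hb => rw [Set.mem_singleton_iff.1 hb]; exact hz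
    | algebraMap b => exact σ.commutes b
    | add a b _ _ ha hb => exact add_mem ha hb
    | inv a _ ha => exact hSinv ha
    | mul a b _ _ ha hb => exact mul_mem ha hb
  have hl0 : algebraMap K L (lam p s ζ) ≠ 0 := (map_ne_zero _).2 (lam_ne_zero hs hζ)
  have hZY (i : Fin s) : Z i.succ = MvPolynomial.aeval Y (E i) +
    algebraMap K L (lam p s ζ) * Y i := by rw [h.Z_succ, aeval_polyZ]
  -- At the first Z_j that σ moves, everything below is fixed, including E_{j+1}, Z_{j-1} and u_j.
  -- So σ multiplies Z_j by a nontrivial p-th root of unity.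
  obtain ⟨j, hjlt, hj⟩ : ∃ j : Fin s, (∀ i < j, Z i.succ ∈ S) ∧ Z j.succ ∉ S := by
    by_contra! hall
    have hZ (i : Fin s) : Z i.succ ∈ S := by
      induction i using WellFoundedLT.induction with
      | ind i ih => exact hall i ih
    obtain ⟨n, rfl⟩ : ∃ n, s = n + 1 := ⟨s - 1, by omega⟩
    exact hlast (hZ (Fin.last n))
  have hY (i : Fin s) (hi : i < j) : Y i ∈ S := by
    induction i using WellFoundedLT.induction with
    | ind i ih =>
    have he : MvPolynomial.aeval Y (E i) ∈ S := aeval_mem_of_vars S fun k hk =>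
      ih k (h.vars_E i k hk) ((h.vars_E i k hk).trans hi)
    have : Y i = (Z i.succ - MvPolynomial.aeval Y (E i)) * (algebraMap K L (lam p s ζ))⁻¹ := by
      rw [hZY]; field_simp; ring
    rw [this]
    exact mul_mem (sub_mem (hjlt i hi) he) (hSinv (hK _))
  have hle : adjoinInvBelow Y (polyZ E) j ≤ S := by
    refine Algebra.adjoin_le ?_
    rintro _ ⟨i, hi, rfl | rfl⟩
    · exact hY i hi
    · rw [← h.Z_succ]; exact hSinv (hjlt i hi)
  have hE : σ (MvPolynomial.aeval Y (E j)) = MvPolynomial.aeval Y (E j) :=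
    hle (aeval_mem_adjoinInvBelow fun k hk => h.vars_E j k hk)
  have hZp : σ (Z j.castSucc) = Z j.castSucc := hle (h.Z_mem (n := j) (i := j.castSucc) le_rfl).1
  have hZ0 := h.Z_ne_zero j.succ
  have hξ : (σ (Z j.succ) / Z j.succ) ^ p = 1 := by
    rw [div_pow, ← map_pow, h.Z_pow, map_mul, hZp, hF (kummerU_mem_adjoin j), div_self]
    exact mul_ne_zero (h.Z_ne_zero _) (h.kummerU_ne_zero j)
  have hμ : IsPrimitiveRoot (zetaPow p s ζ 1) p := by
    have := zetaPow_isPrimitiveRoot hζ hs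
    rwa [pow_one] at this
  have : NeZero p := ⟨hp.out.ne_zero⟩
  obtain ⟨k, hkp, hk⟩ := (hμ.map_of_injective (algebraMap K L).injective).eq_pow_of_pow_eq_one hξ
  rw [← map_pow] at hk
  have hσZ : σ (Z j.succ) = algebraMap K L (zetaPow p s ζ 1 ^ k) * Z j.succ := by
    rw [hk, div_mul_cancel₀ _ hZ0]
  have hcop : k.Coprime p := by
    refine Nat.Coprime.symm ((hp.out.coprime_iff_not_dvd).2 fun hd => hj ?_)
    change σ _ = _
    rw [hσZ, Nat.eq_zero_of_dvd_of_lt hd hkp, pow_zero, map_one, one_mul]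
  let μ : baseRing p ζ := ⟨zetaPow p s ζ 1, zetaPow_mem _ _⟩
  have hμR : IsPrimitiveRoot μ p :=
    IsPrimitiveRoot.of_map_of_injective (f := (baseRing p ζ).subtype) hμ Subtype.val_injective
  -- The cyclotomic unit (ζ_p^k - 1)/(ζ_p - 1): dividing σZ_j - Z_j by λ leaves a unit of R times
  -- Z_j.
  obtain ⟨v, hv⟩ := hμR.associated_sub_one_pow_sub_one_of_coprime hcop
  have hvL : algebraMap K L (lam p s ζ) * algebraMap (baseRing p ζ) L v =
      algebraMap K L (zetaPow p s ζ 1 ^ k) - 1 := by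
    have := congrArg (algebraMap (baseRing p ζ) L) hv
    rw [map_mul, map_sub, map_sub, map_one] at this
    rw [lam, map_sub, map_one]
    exact this
  refine ⟨j, v, mul_left_cancel₀ hl0 ?_⟩
  have h1 := congrArg σ (hZY j)
  rw [map_add, map_mul, hE, hK, hσZ] at h1
  have h2 := hZY j
  linear_combination -h1 + h2 - Z j.succ * hvL

/-- The invariants lie in K(X) and are integral over the normal ring of 𝒱_s, hence belong to it. The
displacement of Y_j by a unit of R times Z_j is invertible because 1/Z_j is in the ring. -/
theorem isEtaleGaloisCover (h : IsTower G E x Y Z) (hs : 1 ≤ s) (hζ : IsPrimitiveRoot ζ (p ^ s)) :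
    IsEtaleGaloisCover (coordV p ζ x (kummerU ζ G x))
      (integralClosure (coordV p ζ x (kummerU ζ G x)) L) (Multiplicative (ZMod (p ^ s))) := by
  set F := IntermediateField.adjoin K (Set.range x) with hF
  set V := coordV p ζ x (kummerU ζ G x) with hV
  have hVF (v : L) (hv : v ∈ V) : v ∈ F := mem_adjoin_of_mem_coordV hv
  have hz : Z (Fin.last s) ^ p ^ s ∈ F := by
    rw [pow_last_eq h.Z_pow, h.Z_zero, one_mul]
    exact prod_mem fun i _ => pow_mem (kummerU_mem_adjoin _) _
  have hgal : IsGalois F L ∧ FiniteDimensional F L ∧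
      Nonempty (Multiplicative (ZMod (p ^ s)) ≃* Gal(L/F)) := by
    obtain ⟨n, rfl⟩ : ∃ n, s = n + 1 := ⟨s - 1, by omega⟩
    refine isGalois_and_nonempty_mulEquiv (hζ.map_of_injective (algebraMap K F).injective)
      (a := ⟨_, hz⟩) (fun h0 => ?_) rfl h.adjoin_Z_last_eq_top ?_
    · exact pow_ne_zero _ (h.Z_ne_zero _) (congrArg Subtype.val h0)
    · rintro ⟨⟨a, ha⟩, hz'⟩
      exact h.Z_last_pow_notMem hζ (hz' ▸ ha)
  obtain ⟨_, _, ⟨e⟩⟩ := hgal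
  have hW {a : L} (ha : a ∈ adjoinInv Y (polyZ E)) : a ∈ integralClosure V L := by
    rw [← h.coordW_eq, ← h.integralClosure_coordV hs hζ] at ha
    exact ha
  refine isEtaleGaloisCover_of_isUnit (ρ := (galAction V F hVF).comp e.toMonoidHom)
    (fun a b hab => by
      have : (algebraMap V (integralClosure V L) a : L) = algebraMap V (integralClosure V L) b :=
        congrArg Subtype.val hab
      exact Subtype.ext this) (fun b hb => ?_) fun g hg => ?_
  · have hfix : (b : L) ∈ Set.range (algebraMap F L) := by
      refine (IsGalois.mem_range_algebraMap_iff_fixed _).2 fun σ => ?_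
      obtain ⟨g, rfl⟩ := e.surjective σ
      exact congrArg Subtype.val (hb g)
    obtain ⟨⟨a, ha⟩, hab⟩ := hfix
    have hab : a = b := hab
    exact ⟨⟨a, h.mem_coordV_of_isIntegral hs hζ ha (hab ▸ b.2)⟩, Subtype.ext hab⟩
  · have hσ : e g ≠ 1 := fun h1 => hg (e.injective (h1.trans (map_one e).symm))
    obtain ⟨j, v, hjv⟩ := h.exists_sub_eq hs hζ hσ
    refine ⟨⟨Y j, hW (mem_adjoinInv j)⟩, ?_⟩
    refine IsUnit.of_mul_eq_one ⟨algebraMap (baseRing p ζ) L (v⁻¹ : (baseRing p ζ)ˣ) *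
      (Z j.succ)⁻¹, hW (mul_mem (Subalgebra.algebraMap_mem _ _) ?_)⟩ (Subtype.ext ?_)
    · rw [h.Z_succ]; exact inv_mem_adjoinInv j
    · change (e g (Y j) - Y j) * _ = 1
      rw [hjv, mul_mul_mul_comm, ← map_mul, Units.mul_inv, map_one,
        mul_inv_cancel₀ (h.Z_ne_zero _), mul_one]

end IsTower

/-- The Kummer extension carries a tower of elements `Z_i` and `Y_i`. -/
theorem exists_isTower (hs : 1 ≤ s) (hζ : IsPrimitiveRoot ζ (p ^ s))
    (hGv : ∀ i, ∀ j ∈ (G i).vars, j < i) (hEv : ∀ i, ∀ j ∈ (E i).vars, j < i)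
    (hG : ∀ i, ∃ r, G i = 1 + MvPolynomial.C (unif p ζ) * r)
    (hE : ∀ i, ∃ r, E i = 1 + MvPolynomial.C (unif p ζ) * r)
    (hX : ∀ i, powX p s ζ i ∈ intS (baseRing p ζ) (Fin s))
    (hZc : ∀ i, (powZ p s ζ i).constantCoeff = 1)
    (hZE : ∀ i : Fin s, powZ p s ζ i.succ = polyHom _ _ (E i) +
        MvPowerSeries.C (lam p s ζ) * MvPowerSeries.X i)
    (hZG : ∀ i : Fin s, powZ p s ζ i.succ ^ p = powZ p s ζ i.castSucc *
        (MvPolynomial.aeval (powX p s ζ) (G i) +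
          MvPowerSeries.C (p * lam p s ζ) * powX p s ζ i))
    (hEG : ∀ i : Fin s, Cg (baseRing p ζ) (p * lam p s ζ) (polyHom _ _ (E i) ^ p)
        (powZ p s ζ i.castSucc * MvPolynomial.aeval (powX p s ζ) (G i)))
    {z : L} (hx : AlgebraicIndependent K x)
    (htop : IntermediateField.adjoin K (Set.range x ∪ {z}) = ⊤)
    (hz : z ^ p ^ s = ∏ i : Fin s, kummerU ζ G x i ^ p ^ (i : ℕ)) :
    ∃ (Z : Fin (s + 1) → L) (Y : Fin s → L), Z (Fin.last s) = z ∧ IsTower G E x Y Z := by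
  have hu (i : Fin s) : kummerU ζ G x i ≠ 0 := by
    rw [← aeval_polyU]
    exact aeval_ne_zero hs hζ hx (polyU_eq_one_add hG i)
  obtain ⟨Z, hZ0, hZl, hZp⟩ := exists_tower hu hz
  obtain ⟨Y, hY⟩ := exists_eq_aeval_add_mul
    ((map_ne_zero (algebraMap K L)).2 (lam_ne_zero hs hζ)) hEv fun i => Z i.succ
  have hZn (i : Fin (s + 1)) : Z i ≠ 0 := by
    induction i using Fin.induction with
    | zero => rw [hZ0]; exact one_ne_zero
    | succ i ih =>
      intro h0
      have := hZp i
      rw [h0, zero_pow hp.out.ne_zero] at this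
      exact mul_ne_zero ih (hu i) this.symm
  have hZs (i : Fin s) : Z i.succ = MvPolynomial.aeval Y (polyZ E i) := by
    rw [aeval_polyZ]; exact hY i
  have hmem := mem_adjoinInvBelow_and_exists hs hζ hGv hEv hX hZc hZE hZG hEG hZ0 hZn hZs hZp
  exact ⟨Z, Y, hZl, ⟨hGv, hEv, hG, hE, hx, hZl ▸ htop, hZ0, hZn, hZs, hZp,
    fun i => (hmem i).1, fun i => (hmem i).2⟩⟩

end GaloisTower

end KASW

end

theorem mainTheorem3 {p : ℕ} [Fact p.Prime] {s : ℕ} (hs : 1 ≤ s)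
    {K : Type*} [Field K] [CharZero K] [IsCyclotomicExtension {p ^ s} ℚ K]
    (ζ : K) (hζ : IsPrimitiveRoot ζ (p ^ s)) :
    ∃ G E : Fin s → MvPolynomial (Fin s) (KASW.baseRing p ζ),
      (∀ i, KASW.IsPolynomialFor (G i) (KASW.seriesG p s ζ i) ∧ ∀ j ∈ (G i).vars, j < i) ∧
      (∀ i, KASW.IsPolynomialFor (E i) (KASW.seriesE p s ζ i) ∧ ∀ j ∈ (E i).vars, j < i) ∧
      -- any Kummer extension `L = K(X_0, …, X_{s-1})(z)` with `z ^ (p^s) = ∏ u_i ^ (p^i)`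
      ∀ (L : Type*) [Field L] [Algebra K L] (x : Fin s → L) (z : L),
        AlgebraicIndependent K x →
        IntermediateField.adjoin K (Set.range x ∪ {z}) = ⊤ →
        z ^ p ^ s = ∏ i : Fin s, KASW.kummerU ζ G x i ^ p ^ (i : ℕ) →
        -- `Z 0 = Z_{-1} = 1`, and `Z i.succ` stands for `Z_i`
        ∃ (Z : Fin (s + 1) → L) (Y : Fin s → L),
          Z 0 = 1 ∧ Z (Fin.last s) = z ∧
          (∀ i : Fin s, Z i.succ ^ p = Z i.castSucc * KASW.kummerU ζ G x i) ∧
          (∀ i : Fin s, Z i.succ =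
            MvPolynomial.aeval Y (E i) + algebraMap K L (KASW.lam p s ζ) * Y i) ∧
          AlgebraicIndependent K Y ∧
          -- `B_s` is the integral closure of `B_{s-1}` and of the coordinate ring of `𝒱_s` in `L`
          (integralClosure (KASW.coordB p ζ x (KASW.kummerU ζ G x) Y Z) L).restrictScalars
              (KASW.baseRing p ζ) = KASW.coordW p ζ Y Z ∧
          (integralClosure (KASW.coordV p ζ x (KASW.kummerU ζ G x)) L).restrictScalars
              (KASW.baseRing p ζ) = KASW.coordW p ζ Y Z ∧
          -- `𝒲_s → 𝒱_s` is an étale `ℤ/p^s`-cover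
          KASW.IsEtaleGaloisCover (KASW.coordV p ζ x (KASW.kummerU ζ G x))
            (integralClosure (KASW.coordV p ζ x (KASW.kummerU ζ G x)) L)
            (Multiplicative (ZMod (p ^ s))) ∧
          -- `𝒲_s` and `𝒱_s` are smooth over `R`, with special fibres `Spec 𝔽_p[y_0, …, y_{s-1}]`
          -- and `Spec 𝔽_p[x_0, …, x_{s-1}]`
          Algebra.Smooth (KASW.baseRing p ζ) (KASW.coordW p ζ Y Z) ∧
          KASW.ReductionIsPolynomialRing ζ (KASW.coordW p ζ Y Z) Y ∧
          Algebra.Smooth (KASW.baseRing p ζ)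
            (KASW.coordV p ζ x (KASW.kummerU ζ G x)) ∧
          KASW.ReductionIsPolynomialRing ζ (KASW.coordV p ζ x (KASW.kummerU ζ G x)) x := by
  obtain ⟨G, E, hG, hE, hG1, hE1, hX, hZc, hZE, hZG, hEG⟩ := KASW.exists_polynomials hs hζ
  refine ⟨G, E, hG, hE, ?_⟩
  intro L _ _ x z hx htop hz
  obtain ⟨Z, Y, hZl, h⟩ := KASW.exists_isTower hs hζ (fun i => (hG i).2) (fun i => (hE i).2)
    hG1 hE1 hX hZc hZE hZG hEG hx htop hz
  have hZ (i : Fin s) : Z i.succ =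
      MvPolynomial.aeval Y (E i) + algebraMap K L (KASW.lam p s ζ) * Y i := by
    rw [h.Z_succ, KASW.aeval_polyZ]
  have hY := h.algebraicIndependent_Y
  have hDY := KASW.polyZ_eq_one_add h.E_eq
  have hDx := KASW.polyU_eq_one_add h.G_eq
  refine ⟨Z, Y, h.Z_zero, hZl, h.Z_pow, hZ, hY, h.integralClosure_coordB hs hζ,
    h.integralClosure_coordV hs hζ, h.isEtaleGaloisCover hs hζ, ?_, ?_, ?_, ?_⟩
  · rw [h.coordW_eq]
    exact KASW.smooth_adjoinInv (KASW.algebraicIndependent_baseRing hY)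
      fun i => KASW.aeval_ne_zero hs hζ hY (hDY i)
  · rw [h.coordW_eq]
    exact KASW.reductionIsPolynomialRing_adjoinInv hs hζ hY hDY
  · rw [h.coordV_eq]
    exact KASW.smooth_adjoinInv (KASW.algebraicIndependent_baseRing hx)
      fun i => KASW.aeval_ne_zero hs hζ hx (hDx i)
  · rw [h.coordV_eq]
    exact KASW.reductionIsPolynomialRing_adjoinInv hs hζ hx hDx
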